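/- Let $n\ge 2$ and let $\Omega\subsetneq\mathbb R^n$ be a domain (a nonempty connected open set), with $d(x)=\operatorname{dist}(x,\partial\Omega)$. Assume: (i) $\Omega$ is uniformly Lipschitz: there are $\varepsilon>0$, $L\ge 0$, $N\in\mathbb N$ and a countable family of open sets $U_i\subset\mathbb R^n$ such that every $x\in\partial\Omega$ satisfies $B(x,\varepsilon)\subset U_i$ for some $i$; no point of $\mathbb R^n$ belongs to more than $N$ of the $U_i$; and for each $i$ there is a unit vector $\nu_i$ and a function $g_i:\nu_i^\perp\to\mathbb R$, Lipschitz with constant $L$, such that $\Omega\cap U_i=\{x'+t\nu_i:\ x'\in\nu_i^\perp,\ t>g_i(x')\}\cap U_i$; (ii) $\Omega$ has finite inner radius, $\sup_{x\in\Omega}d(x)<\infty$; (iii) $-\Delta d\ge 0$ in $\Omega$ in the distributional sense, that is, $\int_\Omega d\,(-\Delta\varphi)\,dx\ge 0$ for all $\varphi\in C_0^\infty(\Omega)$ with $\varphi\ge 0$. Then there exists a constant $c>0$, which may depend on $\Omega$ (and $n$), such that for all real-valued $u\in C_0^\infty(\Omega\times\mathbb R)$ $$\int_0^\infty\!\!\int_\Omega|\nabla_{(x,y)}u(x,y)|^2\,dx\,dy\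 \ge\ \frac2\pi\int_\Omega\frac{u(x,0)^2}{d(x)}\,dx+c\left(\int_\Omega|u(x,0)|^{\frac{2n}{n-1}}\,dx\right)^{\frac{n-1}{n}}.$$ Moreover, the constant $2/\pi$ is best possible in the corresponding trace Hardy inequality (hence also in the inequality above): for every $K>2/\pi$ there exists $u\in C_0^\infty(\Omega\times\mathbb R)$ with $$\int_0^\infty\!\!\int_\Omega|\nabla_{(x,y)}u(x,y)|^2\,dx\,dy\ <\ K\int_\Omega\frac{u(x,0)^2}{d(x)}\,dx .$$ -/

import Mathlib

open Set MeasureTheory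
open scoped NNReal ContDiff

noncomputable section

/-- The distance `d(x) = dist(x, ∂Ω)` to the boundary of `Ω`. -/
def bdryDist {n : ℕ} (Ω : Set (EuclideanSpace ℝ (Fin n))) (x : EuclideanSpace ℝ (Fin n)) : ℝ :=
  Metric.infDist x (frontier Ω)

/-- Finite inner radius: `sup_{x ∈ Ω} d(x) < ∞`. -/
def HasFiniteInnerRadius {n : ℕ} (Ω : Set (EuclideanSpace ℝ (Fin n))) : Prop :=
  BddAbove (bdryDist Ω '' Ω)

/-- A domain: a nonempty connected open set (`IsConnected` includes nonemptiness). -/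
def IsDomainSet {n : ℕ} (Ω : Set (EuclideanSpace ℝ (Fin n))) : Prop :=
  IsOpen Ω ∧ IsConnected Ω

/-- `φ ∈ C₀^∞(V)`: `φ` is smooth on the whole space, with compact support contained in `V`. -/
def IsTestFunction {E : Type*} [NormedAddCommGroup E] [NormedSpace ℝ E] (V : Set E)
    (φ : E → ℝ) : Prop :=
  ContDiff ℝ ∞ φ ∧ HasCompactSupport φ ∧ tsupport φ ⊆ V

/-- `-Δd ≥ 0` in `Ω` in the distributional sense: `∫_Ω d (-Δφ) dx ≥ 0` for all nonnegative
`φ ∈ C₀^∞(Ω)`. -/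
def IsWeaklyMeanConvex {n : ℕ} (Ω : Set (EuclideanSpace ℝ (Fin n))) : Prop :=
  ∀ φ : EuclideanSpace ℝ (Fin n) → ℝ, IsTestFunction Ω φ → (∀ x, 0 ≤ φ x) →
    0 ≤ ∫ x in Ω, bdryDist Ω x * (-(Laplacian.laplacian φ x))

/-- The set lying strictly above the graph, in the direction of the unit vector `ν`, of a function
`g` on the hyperplane orthogonal to `ν`. In the orthonormal coordinates
`x = x' + t ν` with `x' ⊥ ν` it is `{t > g(x')}`. -/
def epigraphAlong {n : ℕ} (ν : EuclideanSpace ℝ (Fin n))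
    (g : ((ℝ ∙ ν)ᗮ : Submodule ℝ (EuclideanSpace ℝ (Fin n))) → ℝ) :
    Set (EuclideanSpace ℝ (Fin n)) :=
  {x | g ((ℝ ∙ ν)ᗮ.orthogonalProjectionOnto x) < inner ℝ ν x}

/-- Uniformly Lipschitz (minimally smooth) sets: there are `ε > 0`, `L ≥ 0`, `N ∈ ℕ` and countably
many open sets `U i` such that every boundary point `x` has `B(x, ε) ⊆ U i` for some `i`, no point
lies in more than `N` of the `U i`, and in each `U i` the set `Ω` agrees, up to a rotation, with
the region above the graph of an `L`-Lipschitz function of `n - 1` variables.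
(Finite families are allowed, since `U i` may be empty.) -/
def IsUniformlyLipschitz {n : ℕ} (Ω : Set (EuclideanSpace ℝ (Fin n))) : Prop :=
  ∃ (ε : ℝ) (L : ℝ≥0) (N : ℕ) (U : ℕ → Set (EuclideanSpace ℝ (Fin n))),
    0 < ε ∧
    (∀ i, IsOpen (U i)) ∧
    (∀ x ∈ frontier Ω, ∃ i, Metric.ball x ε ⊆ U i) ∧
    (∀ x, {i | x ∈ U i}.encard ≤ N) ∧
    (∀ i, ∃ (ν : EuclideanSpace ℝ (Fin n)) (g : ((ℝ ∙ ν)ᗮ : Submodule ℝ _) → ℝ),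
      ‖ν‖ = 1 ∧ LipschitzWith L g ∧ Ω ∩ U i = epigraphAlong ν g ∩ U i)

/-- `|∇_{(x,y)} u(x,y)|² = |∇_x u(x,y)|² + (∂_y u(x,y))²`, with Euclidean norms. -/
def gradSq {n : ℕ} (u : EuclideanSpace ℝ (Fin n) × ℝ → ℝ) (x : EuclideanSpace ℝ (Fin n))
    (y : ℝ) : ℝ :=
  ‖gradient (fun x' => u (x', y)) x‖ ^ 2 + (deriv (fun y' => u (x, y')) y) ^ 2

/-- `∫_0^∞ ∫_Ω |∇_{(x,y)} u(x,y)|² dx dy`. -/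
def dirichletEnergy {n : ℕ} (Ω : Set (EuclideanSpace ℝ (Fin n)))
    (u : EuclideanSpace ℝ (Fin n) × ℝ → ℝ) : ℝ :=
  ∫ y in Ioi (0 : ℝ), ∫ x in Ω, gradSq u x y

/-- `∫_Ω u(x,0)² / d(x) dx`. -/
def traceHardyTerm {n : ℕ} (Ω : Set (EuclideanSpace ℝ (Fin n)))
    (u : EuclideanSpace ℝ (Fin n) × ℝ → ℝ) : ℝ :=
  ∫ x in Ω, (u (x, 0)) ^ 2 / bdryDist Ω x

/-- `(∫_Ω |u(x,0)|^{2n/(n-1)} dx)^{(n-1)/n}`. -/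
def traceSobolevTerm {n : ℕ} (Ω : Set (EuclideanSpace ℝ (Fin n)))
    (u : EuclideanSpace ℝ (Fin n) × ℝ → ℝ) : ℝ :=
  (∫ x in Ω, |u (x, 0)| ^ (2 * (n : ℝ) / ((n : ℝ) - 1))) ^ (((n : ℝ) - 1) / (n : ℝ))

end

/-! The inequality comes from a ground state substitution followed by a Sobolev trace inequality for
the quotient. Choose `R` with `d ≤ R`, put `a = 1/R`, and let `P(s,y) = 1 - (2/π) arctan (sinh (a y)
/ sin (a s))`. This function is positive and harmonic for `0 < a s ≤ 1`, equals `1` at `y = 0`, and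
is nondecreasing in `s` when `y ≥ 0`; its normal derivative `-∂_y P` at `y = 0` is `(2/π) a / sin (a
s)`. Write `u = P(d(x),y) v`. Since `|∇d| = 1` almost everywhere and `P` is harmonic, `|∇u|² =
P²|∇v|² + ∇d · ∇F + ∂_y G` with `F = (P_s/P) u²` and `G = (P_y/P) u²` (`gradSq_eq_profile`,
integrated in `IsProfileDistance.ground_state_identity`). As `F ≥ 0`, the condition `-Δd ≥ 0` makes
the `F` term nonnegative (`integral_fluxFst_nonneg`), and `G` leaves a boundary term with weight
`(2/π) a / sin (a d)`. From `a / sin (a d) ≥ 1/d + (a²/12) d` one obtains the Hardy term with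
constant `2/π` plus the remainder `c₁ ∫ d u(x,0)² + ∫ P²|∇v|²` (`traceHardyTerm_add_le`).

On the cone `0 < y < d(x)` the profile is bounded below by a positive constant, so the remainder
controls `H = ∫ d v(x,0)²` and the Dirichlet integral of `v` over the cone; note `v(x,0) = u(x,0)`.
It remains to bound the `L^p` norm of `v(x,0)`, `p = 2n/(n-1)`, by these two quantities
(`exists_lintegral_trace_rpow_le`). After the change of variable `y = t d(x)`, four bounds are
combined: the inequality `∫|f| ≤ C ∫ d (|f| + |∇f|)`, valid in uniformly Lipschitz domains without
boundary conditions (`IsUniformlyLipschitz.exists_lintegral_le`) and applied to `|v|^p` on the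
slices; two one-dimensional integrations by parts in `t` with weights `(1-t)^k`; the `L¹` Sobolev
inequality in dimension `n+1` for `|(1-y/d)₊ v|^p`; and Cauchy–Schwarz. They close up algebraically
in `ENNReal.rpow_le_of_le_mul_rpow`.

For sharpness, take a boundary point where the local graph is differentiable. Under magnification
`Ω` contains any prescribed compact part of a half-space, and `d` is at most the half-space distance
up to a small error (`IsUniformlyLipschitz.exists_blowup`). Both sides of the Hardy inequality scale
alike, so it suffices to treat the half-space (`exists_isTestFunction_rescale`). There the test
function is the profile times a cutoff that vanishes within distance `ε` of the bounding hyperplane.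
The identity above shows that its energy exceeds `2/π` times the Hardy term by an amount bounded in
`ε`, whereas the Hardy term diverges logarithmically (`exists_halfSpace_sharp`). -/

/-! ### Mollification, and the Sobolev inequality for Lipschitz functions -/

open Filter Topology Convolution ContinuousLinearMap in
/-- Mollification of a Lipschitz function: the gradients stay bounded and
converge almost everywhere. -/
theorem LipschitzWith.exists_smooth_approx {F : Type*} [NormedAddCommGroup F] [NormedSpace ℝ F]
    [FiniteDimensional ℝ F] [MeasurableSpace F] [BorelSpace F] (μ : Measure F)
    [μ.IsAddHaarMeasure] {f : F → ℝ} {C : ℝ≥0} (hf : LipschitzWith C f) :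
    ∃ g : ℕ → F → ℝ, (∀ k, ContDiff ℝ ∞ (g k)) ∧
      (∀ k, tsupport (g k) ⊆ Metric.cthickening (1 / ((k : ℝ) + 1)) (tsupport f)) ∧
      ((∀ x, 0 ≤ f x) → ∀ k x, 0 ≤ g k x) ∧
      (∀ x, Tendsto (fun k => g k x) atTop (𝓝 (f x))) ∧
      (∀ k x, ‖fderiv ℝ (g k) x‖ ≤ C) ∧
      (∀ᵐ x ∂μ, Tendsto (fun k => fderiv ℝ (g k) x) atTop (𝓝 (fderiv ℝ f x))) := by
  -- The outer radius is exactly twice the inner one. Almost everywhere convergence of the mollified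
  -- gradients, by Lebesgue differentiation, needs this ratio to stay bounded.
  let φ : ℕ → ContDiffBump (0 : F) := fun k =>
    ⟨1 / (2 * ((k : ℝ) + 1)), 1 / ((k : ℝ) + 1), by positivity, by
      apply one_div_lt_one_div_of_lt <;> linarith [(Nat.cast_nonneg k : (0 : ℝ) ≤ k)]⟩
  have hφ : Tendsto (fun k => (φ k).rOut) atTop (𝓝 0) := tendsto_one_div_add_atTop_nhds_zero_nat
  have hfi : LocallyIntegrable f μ := hf.continuous.locallyIntegrable
  have hnint : ∀ k, Integrable ((φ k).normed μ) μ := fun k => (φ k).integrable_normed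
  let g : ℕ → F → ℝ := fun k => (φ k).normed μ ⋆[lsmul ℝ ℝ, μ] f
  have hg : ∀ k x, g k x = ∫ t, (φ k).normed μ t * f (x - t) ∂μ := fun k x => rfl
  have hint : ∀ k x, Integrable (fun t => (φ k).normed μ t * f (x - t)) μ := fun k x =>
    ((((φ k).continuous_normed).mul (hf.continuous.comp (continuous_const.sub continuous_id)))
      ).integrable_of_hasCompactSupport ((φ k).hasCompactSupport_normed.mul_right)
  have hderb : ∀ x, ‖fderiv ℝ f x‖ ≤ C := fun x => norm_fderiv_le_of_lipschitz ℝ hf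
  -- The derivative is moved onto `f`, which is differentiable almost everywhere by Rademacher's
  -- theorem; the gradient of the mollification is then the mollified gradient.
  have hfd : ∀ k x, fderiv ℝ (g k) x = ((φ k).normed μ ⋆[lsmul ℝ ℝ, μ] (fderiv ℝ f)) x := by
    intro k x
    have hae : ∀ᵐ t ∂μ, DifferentiableAt ℝ f (x - t) := by
      have := hf.ae_differentiableAt (μ := μ)
      exact (quasiMeasurePreserving_sub_left μ x).ae this
    have := hasFDerivAt_integral_of_dominated_loc_of_lip (μ := μ) (x₀ := x) (s := univ)
      (F := fun x t => (φ k).normed μ t * f (x - t))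
      (F' := fun t => (φ k).normed μ t • fderiv ℝ f (x - t))
      (bound := fun t => (φ k).normed μ t * C) univ_mem
      (Eventually.of_forall fun x => (hint k x).aestronglyMeasurable) (hint k x)
      (((φ k).continuous_normed.measurable.smul
        ((measurable_fderiv ℝ f).comp (measurable_const.sub measurable_id))).aestronglyMeasurable)
      (Eventually.of_forall fun t => by
        refine LipschitzWith.lipschitzOnWith ?_
        refine LipschitzWith.of_dist_le_mul fun y z => ?_
        have h1 := hf.dist_le_mul (y - t) (z - t)
        rw [dist_sub_right] at h1
        rw [Real.dist_eq, ← mul_sub, abs_mul, abs_of_nonneg (a := (φ k).normed μ t) ((φ k).nonneg_normed t),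
          Real.coe_nnabs, abs_of_nonneg (a := (φ k).normed μ t * C)
            (mul_nonneg ((φ k).nonneg_normed t) C.2), mul_assoc]
        exact mul_le_mul_of_nonneg_left h1 ((φ k).nonneg_normed t))
      ((hnint k).mul_const _)
      (hae.mono fun t ht => by
        have h2 : HasFDerivAt (fun y => f (y - t)) (fderiv ℝ f (x - t)) x :=
          (hasFDerivAt_comp_sub t).2 ht.hasFDerivAt
        exact h2.const_mul _)
    exact this.2.fderiv
  refine ⟨g, fun k => ?_, fun k => ?_, fun h k x => ?_, fun x => ?_, fun k x => ?_, ?_⟩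
  · exact (φ k).hasCompactSupport_normed.contDiff_convolution_left _ (φ k).contDiff_normed hfi
  · refine closure_minimal ?_ Metric.isClosed_cthickening
    refine (support_convolution_subset _).trans ?_
    rintro _ ⟨a, ha, b, hb, rfl⟩
    rw [(φ k).support_normed_eq, Metric.mem_ball] at ha
    refine Metric.mem_cthickening_of_dist_le (a + b) b _ _ (subset_tsupport _ hb) ?_
    rw [dist_eq_norm, add_sub_cancel_right, ← dist_zero_right]
    exact ha.le
  · rw [hg]
    exact integral_nonneg fun t => mul_nonneg ((φ k).nonneg_normed t) (h _)
  · exact ContDiffBump.convolution_tendsto_right_of_continuous hφ hf.continuous x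
  · have : LipschitzWith C (g k) := by
      refine LipschitzWith.of_dist_le_mul fun y z => ?_
      rw [hg, hg, dist_eq_norm, ← integral_sub (hint k y) (hint k z)]
      calc ‖∫ t, ((φ k).normed μ t * f (y - t) - (φ k).normed μ t * f (z - t)) ∂μ‖
          ≤ ∫ t, (φ k).normed μ t * (C * dist y z) ∂μ := by
            refine norm_integral_le_of_norm_le ((hnint k).mul_const _)
              (Eventually.of_forall fun t => ?_)
            have h1 := hf.dist_le_mul (y - t) (z - t)
            rw [dist_sub_right] at h1
            rw [Real.norm_eq_abs, ← mul_sub, abs_mul, abs_of_nonneg ((φ k).nonneg_normed t)]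
            exact mul_le_mul_of_nonneg_left h1 ((φ k).nonneg_normed t)
        _ = C * dist y z := by rw [integral_mul_const, (φ k).integral_normed, one_mul]
    exact norm_fderiv_le_of_lipschitz ℝ this
  · have hloc : LocallyIntegrable (fderiv ℝ f) μ := by
      have : LocallyIntegrable (fun _ : F => (C : ℝ)) μ := locallyIntegrable_const _
      refine this.mono (measurable_fderiv ℝ f).aestronglyMeasurable
        (Eventually.of_forall fun x => ?_)
      simpa using hderb x
    have := ContDiffBump.ae_convolution_tendsto_right_of_locallyIntegrable (φ := φ) (K := 2) hφ
      (Eventually.of_forall fun k => le_of_eq (by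
        change 1 / ((k : ℝ) + 1) = 2 * (1 / (2 * ((k : ℝ) + 1)))
        field_simp)) hloc
    filter_upwards [this] with x hx
    simpa only [hfd] using hx

open Filter Topology in
/-- Gagliardo–Nirenberg–Sobolev inequality for compactly supported Lipschitz functions. -/
theorem LipschitzWith.lintegral_pow_le_pow_lintegral_fderiv {F : Type*} [NormedAddCommGroup F]
    [NormedSpace ℝ F] [FiniteDimensional ℝ F] [MeasurableSpace F] [BorelSpace F] (μ : Measure F)
    [μ.IsAddHaarMeasure] {p : ℝ} (hp : Real.HolderConjugate (Module.finrank ℝ F) p)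
    {f : F → ℝ} {C : ℝ≥0} (hf : LipschitzWith C f) (hc : HasCompactSupport f) :
    ∫⁻ x, ‖f x‖ₑ ^ p ∂μ ≤
      lintegralPowLePowLIntegralFDerivConst μ p * (∫⁻ x, ‖fderiv ℝ f x‖ₑ ∂μ) ^ p := by
  obtain ⟨g, hg1, hg2, -, hg4, hg5, hg6⟩ := hf.exists_smooth_approx μ
  have hK : IsCompact (Metric.cthickening 1 (tsupport f)) := hc.isCompact.cthickening
  have hsub : ∀ k, tsupport (g k) ⊆ Metric.cthickening 1 (tsupport f) := fun k =>
    (hg2 k).trans (Metric.cthickening_mono (by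
      rw [div_le_one (by positivity)]; linarith [(Nat.cast_nonneg k : (0 : ℝ) ≤ k)]) _)
  have hcs : ∀ k, HasCompactSupport (g k) := fun k =>
    hK.of_isClosed_subset (isClosed_tsupport _) (hsub k)
  have hp1 : 0 ≤ p := hp.symm.nonneg
  have hlim : Tendsto (fun k => ∫⁻ x, ‖fderiv ℝ (g k) x‖ₑ ∂μ) atTop
      (𝓝 (∫⁻ x, ‖fderiv ℝ f x‖ₑ ∂μ)) := by
    refine tendsto_lintegral_of_dominated_convergence
      ((Metric.cthickening 1 (tsupport f)).indicator fun _ => (C : ENNReal))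
      (fun k => (measurable_fderiv ℝ (g k)).enorm) (fun k => Eventually.of_forall fun x => ?_) ?_ ?_
    · by_cases hx : x ∈ Metric.cthickening 1 (tsupport f)
      · rw [indicator_of_mem hx]
        have := hg5 k x
        rw [← coe_nnnorm, NNReal.coe_le_coe] at this
        beta_reduce
        rw [enorm_eq_nnnorm]
        exact_mod_cast this
      · have : fderiv ℝ (g k) x = 0 := by
          by_contra h
          exact hx (hsub k (support_fderiv_subset ℝ h))
        beta_reduce
        rw [enorm_eq_nnnorm, this, nnnorm_zero]; exact zero_le
    · rw [lintegral_indicator_const hK.measurableSet]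
      exact ENNReal.mul_ne_top ENNReal.coe_ne_top hK.measure_lt_top.ne
    · filter_upwards [hg6] with x hx
      exact (continuous_enorm.tendsto _).comp hx
  have hr : Tendsto (fun k => lintegralPowLePowLIntegralFDerivConst μ p *
      (∫⁻ x, ‖fderiv ℝ (g k) x‖ₑ ∂μ) ^ p) atTop
      (𝓝 (lintegralPowLePowLIntegralFDerivConst μ p * (∫⁻ x, ‖fderiv ℝ f x‖ₑ ∂μ) ^ p)) :=
    ENNReal.Tendsto.const_mul ((ENNReal.continuous_rpow_const.tendsto _).comp hlim)
      (Or.inr ENNReal.coe_ne_top)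
  -- Fatou's lemma on the left, against dominated convergence of the gradients on the right.
  calc ∫⁻ x, ‖f x‖ₑ ^ p ∂μ = ∫⁻ x, liminf (fun k => ‖g k x‖ₑ ^ p) atTop ∂μ := by
        refine lintegral_congr fun x => ?_
        refine (Tendsto.liminf_eq ?_).symm
        exact (ENNReal.continuous_rpow_const.tendsto _).comp
          ((continuous_enorm.tendsto _).comp (hg4 x))
    _ ≤ liminf (fun k => ∫⁻ x, ‖g k x‖ₑ ^ p ∂μ) atTop :=
        lintegral_liminf_le fun k => ((hg1 k).continuous.measurable.enorm.pow_const p)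
    _ ≤ liminf (fun k => lintegralPowLePowLIntegralFDerivConst μ p *
          (∫⁻ x, ‖fderiv ℝ (g k) x‖ₑ ∂μ) ^ p) atTop := by
        refine liminf_le_liminf (Eventually.of_forall fun k => ?_)
        exact MeasureTheory.lintegral_pow_le_pow_lintegral_fderiv μ
          ((hg1 k).of_le (by exact_mod_cast le_top)) (hcs k) hp
    _ = _ := hr.liminf_eq

theorem lipschitzWith_bdryDist {n : ℕ} (Ω : Set (EuclideanSpace ℝ (Fin n))) :
    LipschitzWith 1 (bdryDist Ω) :=
  Metric.lipschitz_infDist_pt _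

/-! ### Gradients, Green's identity, and superharmonicity of the distance tested on Lipschitz
functions -/

section gradient

variable {F : Type*} [NormedAddCommGroup F] [InnerProductSpace ℝ F] [CompleteSpace F]

theorem norm_gradient_eq_norm_fderiv (f : F → ℝ) (x : F) : ‖gradient f x‖ = ‖fderiv ℝ f x‖ := by
  simp [gradient]

theorem inner_gradient_eq_fderiv (f : F → ℝ) (x v : F) :
    inner ℝ (gradient f x) v = fderiv ℝ f x v := by
  simp [gradient]

theorem inner_gradient_gradient_eq_sum {ι : Type*} [Fintype ι] (b : OrthonormalBasis ι ℝ F)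
    (f g : F → ℝ) (x : F) : inner ℝ (gradient f x) (gradient g x) =
      ∑ i, fderiv ℝ f x (b i) * fderiv ℝ g x (b i) := by
  rw [← b.sum_inner_mul_inner]
  refine Finset.sum_congr rfl fun i _ => ?_
  rw [inner_gradient_eq_fderiv, real_inner_comm, inner_gradient_eq_fderiv]

theorem measurable_gradient [FiniteDimensional ℝ F] [MeasurableSpace F] [BorelSpace F]
    (f : F → ℝ) : Measurable (gradient f) :=
  (InnerProductSpace.toDual ℝ F).symm.continuous.measurable.comp (measurable_fderiv ℝ f)

theorem gradient_eq_zero_of_notMem_tsupport {f : F → ℝ} {x : F} (hx : x ∉ tsupport f) :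
    gradient f x = 0 := by
  have : fderiv ℝ f x = 0 := by
    by_contra h
    exact hx (support_fderiv_subset ℝ h)
  simp [gradient, this]

end gradient

/-- Green's identity for a Lipschitz function against a test function. -/
theorem LipschitzWith.integral_inner_gradient_eq {F : Type*} [NormedAddCommGroup F]
    [InnerProductSpace ℝ F] [FiniteDimensional ℝ F] [MeasurableSpace F] [BorelSpace F]
    {f φ : F → ℝ} {C : ℝ≥0} (hf : LipschitzWith C f) (hφ : ContDiff ℝ ∞ φ)
    (hc : HasCompactSupport φ) :
    ∫ x, inner ℝ (gradient f x) (gradient φ x) = ∫ x, f x * (-(Laplacian.laplacian φ x)) := by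
  let b := stdOrthonormalBasis ℝ F
  have hφ1 : ∀ v : F, ContDiff ℝ ∞ fun x => fderiv ℝ φ x v := fun v =>
    (hφ.fderiv_right (m := ∞) (by simp)).clm_apply contDiff_const
  have hs1 : ∀ v : F, HasCompactSupport fun x => fderiv ℝ φ x v := fun v =>
    hc.fderiv_apply ℝ v
  have hL : ∀ v : F, ∃ D, LipschitzWith D fun x => fderiv ℝ φ x v := fun v =>
    ((hφ1 v).of_le (by simp)).lipschitzWith_of_hasCompactSupport (hs1 v) one_ne_zero
  have key : ∀ i, ∫ x, fderiv ℝ f x (b i) * fderiv ℝ φ x (b i) =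
      ∫ x, f x * -(fderiv ℝ (fun y => fderiv ℝ φ y (b i)) x (b i)) := by
    intro i
    obtain ⟨D, hD⟩ := hL (b i)
    have h := hf.integral_lineDeriv_mul_eq (μ := volume) hD (hs1 (b i)) (b i)
    have h1 : ∫ x, fderiv ℝ f x (b i) * fderiv ℝ φ x (b i) =
        ∫ x, lineDeriv ℝ f x (b i) * fderiv ℝ φ x (b i) := by
      refine integral_congr_ae ?_
      filter_upwards [hf.ae_differentiableAt (μ := volume)] with x hx
      rw [hx.lineDeriv_eq_fderiv]
    rw [h1, h]
    refine integral_congr_ae (Filter.Eventually.of_forall fun x => ?_)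
    have hd : DifferentiableAt ℝ (fun y => fderiv ℝ φ y (b i)) x :=
      (hφ1 (b i)).differentiable (by simp) x
    beta_reduce
    rw [hd.lineDeriv_eq_fderiv, map_neg, mul_comm]
  have hint1 : ∀ i, Integrable fun x => fderiv ℝ f x (b i) * fderiv ℝ φ x (b i) := by
    intro i
    have hi : Integrable fun x => fderiv ℝ φ x (b i) :=
      ((hφ1 (b i)).continuous).integrable_of_hasCompactSupport (hs1 (b i))
    refine hi.bdd_mul (c := C * ‖b i‖) (measurable_fderiv_apply_const ℝ f (b i)).aestronglyMeasurable
      (Filter.Eventually.of_forall fun x => ?_)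
    exact (ContinuousLinearMap.le_opNorm _ _).trans
      (mul_le_mul_of_nonneg_right (norm_fderiv_le_of_lipschitz ℝ hf) (norm_nonneg _))
  have hint2 : ∀ i, Integrable fun x => f x * -(fderiv ℝ (fun y => fderiv ℝ φ y (b i)) x (b i)) := by
    intro i
    have hcont : Continuous fun x => fderiv ℝ (fun y => fderiv ℝ φ y (b i)) x (b i) :=
      (((hφ1 (b i)).continuous_fderiv (by simp)).clm_apply continuous_const)
    refine (hf.continuous.mul hcont.neg).integrable_of_hasCompactSupport ?_
    exact ((hs1 (b i)).fderiv_apply ℝ (b i)).neg.mul_left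
  calc ∫ x, inner ℝ (gradient f x) (gradient φ x)
      = ∫ x, ∑ i, fderiv ℝ f x (b i) * fderiv ℝ φ x (b i) := by
        simp_rw [inner_gradient_gradient_eq_sum b]
    _ = ∑ i, ∫ x, fderiv ℝ f x (b i) * fderiv ℝ φ x (b i) :=
        integral_finsetSum _ fun i _ => hint1 i
    _ = ∑ i, ∫ x, f x * -(fderiv ℝ (fun y => fderiv ℝ φ y (b i)) x (b i)) := by
        simp_rw [key]
    _ = ∫ x, ∑ i, f x * -(fderiv ℝ (fun y => fderiv ℝ φ y (b i)) x (b i)) :=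
        (integral_finsetSum _ fun i _ => hint2 i).symm
    _ = ∫ x, f x * (-(Laplacian.laplacian φ x)) := by
        refine integral_congr_ae (Filter.Eventually.of_forall fun x => ?_)
        beta_reduce
        rw [InnerProductSpace.laplacian_eq_iteratedFDeriv_orthonormalBasis φ b, ← Finset.mul_sum,
          Finset.sum_neg_distrib]
        congr 2
        refine Finset.sum_congr rfl fun i _ => ?_
        rw [iteratedFDeriv_two_apply]
        have hd : DifferentiableAt ℝ (fderiv ℝ φ) x :=
          (hφ.fderiv_right (m := ∞) (by simp)).differentiable (by simp) x
        rw [fderiv_clm_apply hd (differentiableAt_const _)]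
        simp

open Filter Topology in
/-- If `-Δd ≥ 0` weakly, then `∫ ∇d · ∇ψ ≥ 0` for nonnegative compactly supported Lipschitz `ψ`. -/
theorem IsWeaklyMeanConvex.integral_inner_gradient_nonneg {n : ℕ}
    {Ω : Set (EuclideanSpace ℝ (Fin n))} (hΩ : IsOpen Ω) (hmc : IsWeaklyMeanConvex Ω)
    {ψ : EuclideanSpace ℝ (Fin n) → ℝ} {C : ℝ≥0} (hψ : LipschitzWith C ψ)
    (hc : HasCompactSupport ψ) (hs : tsupport ψ ⊆ Ω) (h0 : ∀ x, 0 ≤ ψ x) :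
    0 ≤ ∫ x, inner ℝ (gradient (bdryDist Ω) x) (gradient ψ x) := by
  obtain ⟨g, hg1, hg2, hg3, -, hg5, hg6⟩ := hψ.exists_smooth_approx volume
  have hd := lipschitzWith_bdryDist Ω
  have hK : IsCompact (Metric.cthickening 1 (tsupport ψ)) := hc.isCompact.cthickening
  have hsub : ∀ k, tsupport (g k) ⊆ Metric.cthickening 1 (tsupport ψ) := fun k =>
    (hg2 k).trans (Metric.cthickening_mono (by
      rw [div_le_one (by positivity)]; linarith [(Nat.cast_nonneg k : (0 : ℝ) ≤ k)]) _)
  have hcs : ∀ k, HasCompactSupport (g k) := fun k =>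
    hK.of_isClosed_subset (isClosed_tsupport _) (hsub k)
  obtain ⟨δ, hδ, hδs⟩ := hc.isCompact.exists_cthickening_subset_open hΩ hs
  -- The mollified functions are admissible in the distributional hypothesis only once the
  -- mollification radius is below the distance from the support to the complement.
  have hev : ∀ᶠ k : ℕ in atTop, tsupport (g k) ⊆ Ω := by
    have : ∀ᶠ k : ℕ in atTop, 1 / ((k : ℝ) + 1) < δ :=
      tendsto_one_div_add_atTop_nhds_zero_nat.eventually_lt_const hδ
    filter_upwards [this] with k hk
    exact (hg2 k).trans ((Metric.cthickening_mono hk.le _).trans hδs)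
  have hnn : ∀ᶠ k : ℕ in atTop,
      0 ≤ ∫ x, inner ℝ (gradient (bdryDist Ω) x) (gradient (g k) x) := by
    filter_upwards [hev] with k hk
    rw [hd.integral_inner_gradient_eq (hg1 k) (hcs k)]
    have := hmc (g k) ⟨hg1 k, hcs k, hk⟩ (hg3 h0 k)
    rwa [setIntegral_eq_integral_of_forall_compl_eq_zero] at this
    intro x hx
    have h1 : g k =ᶠ[𝓝 x] fun _ => 0 :=
      notMem_tsupport_iff_eventuallyEq.1 fun h => hx (hk h)
    rw [(InnerProductSpace.laplacian_congr_nhds h1).eq_of_nhds]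
    simp
  have hlim : Tendsto (fun k => ∫ x, inner ℝ (gradient (bdryDist Ω) x) (gradient (g k) x)) atTop
      (𝓝 (∫ x, inner ℝ (gradient (bdryDist Ω) x) (gradient ψ x))) := by
    refine tendsto_integral_of_dominated_convergence
      ((Metric.cthickening 1 (tsupport ψ)).indicator fun _ => (C : ℝ))
      (fun k => ((measurable_gradient _).inner (measurable_gradient _)).aestronglyMeasurable) ?_
      (fun k => Eventually.of_forall fun x => ?_) ?_
    · exact (integrable_indicator_iff hK.measurableSet).2
        (integrableOn_const hK.measure_lt_top.ne)
    · by_cases hx : x ∈ Metric.cthickening 1 (tsupport ψ)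
      · rw [indicator_of_mem hx]
        refine (norm_inner_le_norm _ _).trans ?_
        rw [norm_gradient_eq_norm_fderiv, norm_gradient_eq_norm_fderiv]
        have h1 : ‖fderiv ℝ (bdryDist Ω) x‖ ≤ 1 := norm_fderiv_le_of_lipschitz ℝ hd
        calc _ ≤ 1 * ‖fderiv ℝ (g k) x‖ := mul_le_mul_of_nonneg_right h1 (norm_nonneg _)
          _ ≤ C := by rw [one_mul]; exact hg5 k x
      · rw [gradient_eq_zero_of_notMem_tsupport fun h => hx (hsub k h), inner_zero_right,
          norm_zero]
        exact indicator_nonneg (fun _ _ => C.2) _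
    · filter_upwards [hg6] with x hx
      refine Tendsto.inner tendsto_const_nhds ?_
      exact ((InnerProductSpace.toDual ℝ _).symm.continuous.tendsto _).comp hx
  exact ge_of_tendsto hlim hnn

/-! ### Averaging over translations, and the weighted `L¹` inequality in Lipschitz domains -/

section translation

variable {F : Type*} [NormedAddCommGroup F] [NormedSpace ℝ F] [FiniteDimensional ℝ F]
  [MeasurableSpace F] [BorelSpace F] {μ : Measure F} [μ.IsAddHaarMeasure]

/-- By Fubini and translation invariance, a point `z` is counted once for every `σ` with `z - σν ∈
V`. The hypothesis puts all such `σ` in `(0, m z]`, so the multiplicity is at most `m z`. -/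
theorem lintegral_lintegral_translate_le {V W : Set F} (hV : MeasurableSet V)
    (hW : MeasurableSet W) {s : ℝ} {ν : F} {m : F → ℝ}
    (H : ∀ x ∈ V, ∀ σ ∈ Ioc 0 s, x + σ • ν ∈ W ∧ σ ≤ m (x + σ • ν))
    {h : F → ENNReal} (hh : Measurable h) :
    ∫⁻ x in V, (∫⁻ σ in Ioc 0 s, h (x + σ • ν)) ∂μ ≤ ∫⁻ z in W, ENNReal.ofReal (m z) * h z ∂μ := by
  have hm : Measurable fun q : F × ℝ => V.indicator (fun _ => (1 : ENNReal)) q.1 * h (q.1 + q.2 • ν) :=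
    ((measurable_const.indicator hV).comp measurable_fst).mul
      (hh.comp (measurable_fst.add (measurable_snd.smul_const ν)))
  have hm2 : Measurable fun q : F × ℝ => V.indicator (fun _ => (1 : ENNReal)) (q.1 - q.2 • ν) * h q.1 :=
    ((measurable_const.indicator hV).comp (measurable_fst.sub (measurable_snd.smul_const ν))).mul
      (hh.comp measurable_fst)
  calc ∫⁻ x in V, (∫⁻ σ in Ioc 0 s, h (x + σ • ν)) ∂μ
      = ∫⁻ x, (∫⁻ σ in Ioc 0 s, V.indicator (fun _ => (1 : ENNReal)) x * h (x + σ • ν)) ∂μ := by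
        rw [← lintegral_indicator hV]
        refine lintegral_congr fun x => ?_
        by_cases hx : x ∈ V <;> simp [hx]
    _ = ∫⁻ σ in Ioc 0 s, (∫⁻ x, V.indicator (fun _ => (1 : ENNReal)) x * h (x + σ • ν) ∂μ) :=
        lintegral_lintegral_swap (f := fun x σ =>
          V.indicator (fun _ => (1 : ENNReal)) x * h (x + σ • ν)) hm.aemeasurable
    _ = ∫⁻ σ in Ioc 0 s, (∫⁻ z, V.indicator (fun _ => (1 : ENNReal)) (z - σ • ν) * h z ∂μ) := by
        refine lintegral_congr fun σ => ?_
        rw [← lintegral_add_right_eq_self (fun z =>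
          V.indicator (fun _ => (1 : ENNReal)) (z - σ • ν) * h z) (σ • ν)]
        simp only [add_sub_cancel_right]
    _ = ∫⁻ z, (∫⁻ σ in Ioc 0 s, V.indicator (fun _ => (1 : ENNReal)) (z - σ • ν) * h z) ∂μ :=
        (lintegral_lintegral_swap (f := fun z σ =>
          V.indicator (fun _ => (1 : ENNReal)) (z - σ • ν) * h z) hm2.aemeasurable).symm
    _ ≤ ∫⁻ z, W.indicator (fun z => ENNReal.ofReal (m z) * h z) z ∂μ := by
        refine lintegral_mono fun z => ?_
        have hmz : Measurable fun σ : ℝ => V.indicator (fun _ => (1 : ENNReal)) (z - σ • ν) :=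
          (measurable_const.indicator hV).comp
            (measurable_const.sub (measurable_id.smul_const ν))
        by_cases hz : z ∈ W
        · rw [indicator_of_mem hz, lintegral_mul_const _ hmz]
          gcongr
          calc ∫⁻ σ in Ioc 0 s, V.indicator (fun _ => (1 : ENNReal)) (z - σ • ν)
              ≤ ∫⁻ σ in Ioc 0 s, (Ioc 0 (m z)).indicator (fun _ => (1 : ENNReal)) σ := by
                refine setLIntegral_mono (measurable_const.indicator measurableSet_Ioc) ?_
                intro σ hσ
                by_cases hv : z - σ • ν ∈ V
                · have := (H _ hv σ hσ).2
                  rw [sub_add_cancel] at this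
                  rw [indicator_of_mem hv, indicator_of_mem (show σ ∈ Ioc 0 (m z) from ⟨hσ.1, this⟩)]
                · rw [indicator_of_notMem hv]; exact zero_le
            _ ≤ ∫⁻ σ, (Ioc 0 (m z)).indicator (fun _ => (1 : ENNReal)) σ := setLIntegral_le_lintegral _ _
            _ = ENNReal.ofReal (m z) := by
                rw [lintegral_indicator_const measurableSet_Ioc]; simp
        · rw [indicator_of_notMem hz, lintegral_mul_const _ hmz]
          have : ∫⁻ σ in Ioc 0 s, V.indicator (fun _ => (1 : ENNReal)) (z - σ • ν) = 0 := by
            rw [setLIntegral_congr_fun (g := fun _ => 0) measurableSet_Ioc, lintegral_zero]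
            intro σ hσ
            have hv : z - σ • ν ∉ V := fun hv => hz (by
              have := (H _ hv σ hσ).1
              rwa [sub_add_cancel] at this)
            simp [hv]
          rw [this, zero_mul]
    _ = _ := lintegral_indicator hW _

/-- The fundamental theorem of calculus along a line, for a Lipschitz function. -/
theorem LipschitzWith.enorm_le_add_lintegral_lineDeriv {F : Type*} [NormedAddCommGroup F]
    [NormedSpace ℝ F] {f : F → ℝ} {D : ℝ≥0}
    (hf : LipschitzWith D f) (x ν : F) {σ s : ℝ} (hσ : 0 ≤ σ) (hs : σ ≤ s) :
    ‖f x‖ₑ ≤ ‖f (x + σ • ν)‖ₑ + ∫⁻ τ in Ioc 0 s, ‖lineDeriv ℝ f (x + τ • ν) ν‖ₑ := by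
  let φ : ℝ → ℝ := fun τ => f (x + τ • ν)
  have hφ : LipschitzWith (D * ‖ν‖₊) φ := by
    refine hf.comp (LipschitzWith.of_dist_le_mul fun a b => ?_)
    rw [dist_add_left, dist_eq_norm, ← sub_smul, norm_smul, dist_eq_norm, mul_comm]; rfl
  have hder : ∀ τ, deriv φ τ = lineDeriv ℝ f (x + τ • ν) ν := by
    intro τ
    have h2 : (fun t => f (x + τ • ν + t • ν)) = fun t => φ (τ + t) := by
      ext t; simp [φ, add_smul, add_assoc]
    rw [lineDeriv, h2, deriv_comp_const_add, add_zero]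
  have hac := (hφ.lipschitzOnWith (s := uIcc 0 σ)).absolutelyContinuousOnInterval
  have h1 : ∫ τ in (0 : ℝ)..σ, deriv φ τ = φ σ - φ 0 := hac.integral_deriv_eq_sub
  have h0 : f x = f (x + σ • ν) - ∫ τ in (0 : ℝ)..σ, deriv φ τ := by
    rw [h1]; simp [φ]
  calc ‖f x‖ₑ ≤ ‖f (x + σ • ν)‖ₑ + ‖∫ τ in (0 : ℝ)..σ, deriv φ τ‖ₑ := by
        rw [h0]; exact enorm_sub_le
    _ ≤ ‖f (x + σ • ν)‖ₑ + ∫⁻ τ in Ioc 0 σ, ‖deriv φ τ‖ₑ := by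
        gcongr
        rw [intervalIntegral.integral_of_le hσ]
        exact enorm_integral_le_lintegral_enorm _
    _ ≤ _ := by
        simp_rw [hder]
        gcongr

/-- Bound `|f(x)|` by `|f(x + σν)|` plus the integral of the directional derivative along the
segment, average over `σ ∈ (0, s]`, and integrate over `V`. The translation lemma turns both double
integrals into integrals over `W` with weight `m`, which later is a multiple of the distance to the
boundary. -/
theorem LipschitzWith.lintegral_le_of_translate {V W : Set F} (hV : MeasurableSet V)
    (hW : MeasurableSet W) {s : ℝ} (hs : 0 < s) {ν : F} (hν : ‖ν‖ = 1) {m : F → ℝ}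
    (H : ∀ x ∈ V, ∀ σ ∈ Ioc 0 s, x + σ • ν ∈ W ∧ σ ≤ m (x + σ • ν))
    {f : F → ℝ} {D : ℝ≥0} (hf : LipschitzWith D f) :
    ∫⁻ x in V, ‖f x‖ₑ ∂μ ≤ (ENNReal.ofReal s)⁻¹ * (∫⁻ z in W, ENNReal.ofReal (m z) * ‖f z‖ₑ ∂μ) +
      ∫⁻ z in W, ENNReal.ofReal (m z) * ‖fderiv ℝ f z‖ₑ ∂μ := by
  have hs0 : ENNReal.ofReal s ≠ 0 := by simpa using hs
  have hml : Measurable fun z => ‖lineDeriv ℝ f z ν‖ₑ := (measurable_lineDeriv hf.continuous).enorm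
  have hmf : Measurable fun z => ‖f z‖ₑ := hf.continuous.measurable.enorm
  have hmt : ∀ {h : F → ENNReal}, Measurable h →
      Measurable fun x => ∫⁻ σ in Ioc 0 s, h (x + σ • ν) := by
    intro h hh
    exact Measurable.lintegral_prod_right (f := fun x σ => h (x + σ • ν))
      (hh.comp (measurable_fst.add (measurable_snd.smul_const ν)))
  have hpt : ∀ x, ENNReal.ofReal s * ‖f x‖ₑ ≤ (∫⁻ σ in Ioc 0 s, ‖f (x + σ • ν)‖ₑ) +
      ENNReal.ofReal s * ∫⁻ τ in Ioc 0 s, ‖lineDeriv ℝ f (x + τ • ν) ν‖ₑ := by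
    intro x
    calc ENNReal.ofReal s * ‖f x‖ₑ = ∫⁻ σ in Ioc 0 s, ‖f x‖ₑ := by simp [mul_comm]
      _ ≤ ∫⁻ σ in Ioc 0 s, (‖f (x + σ • ν)‖ₑ +
          ∫⁻ τ in Ioc 0 s, ‖lineDeriv ℝ f (x + τ • ν) ν‖ₑ) :=
          setLIntegral_mono' measurableSet_Ioc fun σ hσ =>
            hf.enorm_le_add_lintegral_lineDeriv x ν hσ.1.le hσ.2
      _ = _ := by
          rw [lintegral_add_right _ measurable_const]
          simp [mul_comm]
  have hint : ENNReal.ofReal s * ∫⁻ x in V, ‖f x‖ₑ ∂μ ≤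
      (∫⁻ z in W, ENNReal.ofReal (m z) * ‖f z‖ₑ ∂μ) +
      ENNReal.ofReal s * ∫⁻ z in W, ENNReal.ofReal (m z) * ‖lineDeriv ℝ f z ν‖ₑ ∂μ := by
    rw [← lintegral_const_mul _ hmf]
    refine (lintegral_mono hpt).trans ?_
    rw [lintegral_add_left (hmt hmf), lintegral_const_mul _ (hmt hml)]
    exact add_le_add (lintegral_lintegral_translate_le hV hW H hmf)
      (mul_le_mul_right (lintegral_lintegral_translate_le hV hW H hml) _)
  have hle : ∫⁻ z in W, ENNReal.ofReal (m z) * ‖lineDeriv ℝ f z ν‖ₑ ∂μ ≤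
      ∫⁻ z in W, ENNReal.ofReal (m z) * ‖fderiv ℝ f z‖ₑ ∂μ := by
    refine lintegral_mono_ae ?_
    filter_upwards [ae_restrict_of_ae hf.ae_differentiableAt] with z hz
    gcongr
    rw [hz.lineDeriv_eq_fderiv, enorm_le_iff_norm_le]
    simpa [hν] using (fderiv ℝ f z).le_opNorm ν
  calc ∫⁻ x in V, ‖f x‖ₑ ∂μ
      = (ENNReal.ofReal s)⁻¹ * (ENNReal.ofReal s * ∫⁻ x in V, ‖f x‖ₑ ∂μ) := by
        rw [← mul_assoc, ENNReal.inv_mul_cancel hs0 ENNReal.ofReal_ne_top, one_mul]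
    _ ≤ (ENNReal.ofReal s)⁻¹ * ((∫⁻ z in W, ENNReal.ofReal (m z) * ‖f z‖ₑ ∂μ) +
          ENNReal.ofReal s * ∫⁻ z in W, ENNReal.ofReal (m z) * ‖lineDeriv ℝ f z ν‖ₑ ∂μ) := by gcongr
    _ ≤ _ := by
        rw [mul_add, ← mul_assoc (_⁻¹) (ENNReal.ofReal s),
          ENNReal.inv_mul_cancel hs0 ENNReal.ofReal_ne_top, one_mul]
        gcongr

end translation

/-- The cone property of a Lipschitz epigraph: moving inwards by `σ` along the axis of the chart
increases the distance to the boundary at least proportionally to `σ`. -/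
theorem add_smul_mem_of_epigraph {n : ℕ} {Ω U : Set (EuclideanSpace ℝ (Fin n))}
    (hΩ : IsOpen Ω) (hne : (frontier Ω).Nonempty) {ν : EuclideanSpace ℝ (Fin n)} (hν : ‖ν‖ = 1)
    {g : ((ℝ ∙ ν)ᗮ : Submodule ℝ _) → ℝ} {L : ℝ≥0} (hg : LipschitzWith L g)
    (hU : Ω ∩ U = epigraphAlong ν g ∩ U) {z : EuclideanSpace ℝ (Fin n)} {ε : ℝ}
    (hz : Metric.ball z ε ⊆ U) {x : EuclideanSpace ℝ (Fin n)} (hx : x ∈ Ω)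
    (hxz : dist x z < ε / 5) {σ : ℝ} (hσ : σ ∈ Ioc 0 (2 * ε / 5)) :
    x + σ • ν ∈ Ω ∩ U ∧ σ ≤ (1 + L) * bdryDist Ω (x + σ • ν) := by
  have hL : (0 : ℝ) < 1 + L := by positivity
  have hr : σ / (1 + L) ≤ σ := div_le_self hσ.1.le (by simp)
  have hε : 0 < ε := by have := dist_nonneg (x := x) (y := z); linarith
  have hxU : x ∈ U := hz (by rw [Metric.mem_ball]; linarith)
  have hxe : g ((ℝ ∙ ν)ᗮ.orthogonalProjectionOnto x) < inner ℝ ν x := by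
    have : x ∈ epigraphAlong ν g ∩ U := hU ▸ ⟨hx, hxU⟩
    exact this.1
  -- Such `w` lie in the chart because `ε/5 + 2ε/5 + 2ε/5 = ε`. They lie above the graph because the
  -- height drops by at most `r` and `g` rises by at most `L r`, where `r` is the displacement from
  -- the shifted point and `(1 + L) r < σ`.
  have hball : ∀ w, dist w (x + σ • ν) < σ / (1 + L) → w ∈ Ω ∩ U := by
    intro w hw
    have h1 : dist (x + σ • ν) x = σ := by
      rw [dist_eq_norm, add_sub_cancel_left, norm_smul, hν, mul_one, Real.norm_eq_abs,
        abs_of_pos hσ.1]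
    have hwU : w ∈ U := hz (by
      rw [Metric.mem_ball]
      have h2 := dist_triangle w (x + σ • ν) z
      have h3 := dist_triangle (x + σ • ν) x z
      have h4 := hσ.2
      linarith)
    rw [hU]
    refine ⟨?_, hwU⟩
    change g _ < inner ℝ ν w
    have hproj : (ℝ ∙ ν)ᗮ.orthogonalProjectionOnto (x + σ • ν) =
        (ℝ ∙ ν)ᗮ.orthogonalProjectionOnto x := by
      rw [map_add, map_smul, Submodule.orthogonalProjectionOnto_orthogonalComplement_singleton_eq_zero,
        smul_zero, add_zero]
    have h5 : dist (g ((ℝ ∙ ν)ᗮ.orthogonalProjectionOnto w))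
        (g ((ℝ ∙ ν)ᗮ.orthogonalProjectionOnto x)) ≤ L * dist w (x + σ • ν) := by
      refine (hg.dist_le_mul _ _).trans ?_
      gcongr
      rw [← hproj, dist_eq_norm, dist_eq_norm, ← map_sub]
      exact Submodule.norm_orthogonalProjectionOnto_apply_le _ _
    have h6 : inner ℝ ν w = inner ℝ ν x + σ + inner ℝ ν (w - (x + σ • ν)) := by
      rw [inner_sub_right, inner_add_right, inner_smul_right, real_inner_self_eq_norm_sq, hν]
      ring
    have h7 : |inner ℝ ν (w - (x + σ • ν))| ≤ dist w (x + σ • ν) := by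
      have := abs_real_inner_le_norm ν (w - (x + σ • ν))
      rwa [hν, one_mul, ← dist_eq_norm] at this
    have h8 : (1 + L) * dist w (x + σ • ν) < σ := by
      rw [lt_div_iff₀ hL] at hw; linarith
    have h9 := neg_abs_le (inner ℝ ν (w - (x + σ • ν)))
    rw [Real.dist_eq] at h5
    have h10 := le_abs_self (g ((ℝ ∙ ν)ᗮ.orthogonalProjectionOnto w) -
        g ((ℝ ∙ ν)ᗮ.orthogonalProjectionOnto x))
    rw [h6]
    nlinarith
  refine ⟨hball _ (by rw [dist_self]; exact div_pos hσ.1 hL), ?_⟩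
  have : σ / (1 + L) ≤ bdryDist Ω (x + σ • ν) := by
    refine (Metric.le_infDist hne).2 fun y hy => ?_
    by_contra! h
    rw [dist_comm] at h
    rw [hΩ.frontier_eq] at hy
    exact hy.2 (hball y h).1
  rw [div_le_iff₀ hL] at this
  linarith

/-- An `L¹` Hardy inequality with a lower order term in uniformly Lipschitz domains. -/
theorem IsUniformlyLipschitz.exists_lintegral_le {n : ℕ} {Ω : Set (EuclideanSpace ℝ (Fin n))}
    (hLip : IsUniformlyLipschitz Ω) (hΩ : IsOpen Ω) (hne : (frontier Ω).Nonempty) :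
    ∃ C : ℝ≥0, ∀ (f : EuclideanSpace ℝ (Fin n) → ℝ) (D : ℝ≥0), LipschitzWith D f →
      ∫⁻ x in Ω, ‖f x‖ₑ ≤ C * ((∫⁻ x in Ω, ENNReal.ofReal (bdryDist Ω x) * ‖f x‖ₑ) +
        ∫⁻ x in Ω, ENNReal.ofReal (bdryDist Ω x) * ‖fderiv ℝ f x‖ₑ) := by
  obtain ⟨ε, L, N, U, hε, hUo, hcov, hN, hchart⟩ := hLip
  choose ν g hν hg hU using hchart
  let V : ℕ → Set (EuclideanSpace ℝ (Fin n)) := fun i =>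
    Ω ∩ ⋃ z ∈ {z | Metric.ball z ε ⊆ U i}, Metric.ball z (ε / 5)
  have hVo : ∀ i, IsOpen (V i) := fun i =>
    hΩ.inter (isOpen_biUnion fun z _ => Metric.isOpen_ball)
  have hs : 0 < 2 * ε / 5 := by positivity
  -- Points near the boundary belong to a chart in which they can be pushed inwards; at the
  -- remaining points `1 ≤ (5/ε) d`, and the weight can be inserted for free.
  have hsub : Ω ⊆ (⋃ i, V i) ∪ (Ω ∩ {x | ε / 5 ≤ bdryDist Ω x}) := by
    intro x hx
    by_cases h : ε / 5 ≤ bdryDist Ω x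
    · exact Or.inr ⟨hx, h⟩
    · left
      obtain ⟨z, hz, hxz⟩ := (Metric.infDist_lt_iff hne).1 (not_le.1 h)
      obtain ⟨i, hi⟩ := hcov z hz
      exact mem_iUnion.2 ⟨i, hx, mem_biUnion (show z ∈ {z | Metric.ball z ε ⊆ U i} from hi) hxz⟩
  have hmd : Measurable (bdryDist Ω) := (lipschitzWith_bdryDist Ω).continuous.measurable
  have hmd' : Measurable fun x => ENNReal.ofReal (bdryDist Ω x) := hmd.ennreal_ofReal
  -- The bounded overlap of the charts makes the sum over infinitely many of them at most `N` times
  -- a single integral.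
  have hoverlap : ∀ h : EuclideanSpace ℝ (Fin n) → ENNReal, Measurable h →
      ∑' i, ∫⁻ x in Ω ∩ U i, h x ≤ N * ∫⁻ x in Ω, h x := by
    intro h hh
    have h1 : ∀ i, ∫⁻ x in Ω ∩ U i, h x = ∫⁻ x in Ω, (U i).indicator h x := fun i => by
      rw [lintegral_indicator (hUo i).measurableSet, Measure.restrict_restrict (hUo i).measurableSet,
        inter_comm]
    simp_rw [h1]
    rw [← lintegral_tsum fun i => (hh.indicator (hUo i).measurableSet).aemeasurable,
      ← lintegral_const_mul _ hh]
    refine lintegral_mono fun x => ?_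
    have h2 : ∀ i, (U i).indicator h x = ({i | x ∈ U i}.indicator (fun _ => (1 : ENNReal)) i) * h x := by
      intro i
      by_cases hi : x ∈ U i <;> simp [hi]
    simp_rw [h2]
    rw [ENNReal.tsum_mul_right]
    gcongr
    rw [← tsum_subtype {i | x ∈ U i} (fun _ => (1 : ENNReal)), ENNReal.tsum_set_one]
    exact_mod_cast hN x
  refine ⟨N * (1 + L) * (1 + (2 * ε / 5).toNNReal⁻¹) + (ε / 5).toNNReal⁻¹, fun f D hf => ?_⟩
  set I0 := ∫⁻ x in Ω, ENNReal.ofReal (bdryDist Ω x) * ‖f x‖ₑ with hI0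
  set I1 := ∫⁻ x in Ω, ENNReal.ofReal (bdryDist Ω x) * ‖fderiv ℝ f x‖ₑ with hI1
  have hm0 : Measurable fun x => ENNReal.ofReal (bdryDist Ω x) * ‖f x‖ₑ :=
    hmd'.mul hf.continuous.measurable.enorm
  have hm1 : Measurable fun x => ENNReal.ofReal (bdryDist Ω x) * ‖fderiv ℝ f x‖ₑ :=
    hmd'.mul (measurable_fderiv ℝ f).enorm
  have hfar : ∫⁻ x in Ω ∩ {x | ε / 5 ≤ bdryDist Ω x}, ‖f x‖ₑ ≤ ((ε / 5).toNNReal⁻¹ : ℝ≥0) * I0 := by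
    rw [← lintegral_const_mul _ hm0]
    calc _ ≤ ∫⁻ x in Ω ∩ {x | ε / 5 ≤ bdryDist Ω x}, (((ε / 5).toNNReal⁻¹ : ℝ≥0) : ENNReal) *
          (ENNReal.ofReal (bdryDist Ω x) * ‖f x‖ₑ) := by
          refine setLIntegral_mono (hm0.const_mul _) fun x hx => ?_
          rw [← mul_assoc]
          refine le_mul_of_one_le_left zero_le ?_
          have h5 : 0 < ε / 5 := by positivity
          rw [ENNReal.coe_inv (by simpa using h5)]
          rw [mul_comm, ← div_eq_mul_inv, ENNReal.le_div_iff_mul_le (by simp [h5]) (by simp), one_mul]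
          exact ENNReal.ofReal_le_ofReal hx.2
      _ ≤ _ := lintegral_mono_set inter_subset_left
  have hnear : ∀ i, ∫⁻ x in V i, ‖f x‖ₑ ≤ (1 + L : ℝ≥0) * ((1 + (2 * ε / 5).toNNReal⁻¹ : ℝ≥0) *
      ((∫⁻ x in Ω ∩ U i, ENNReal.ofReal (bdryDist Ω x) * ‖f x‖ₑ) +
        ∫⁻ x in Ω ∩ U i, ENNReal.ofReal (bdryDist Ω x) * ‖fderiv ℝ f x‖ₑ)) := by
    intro i
    have h := hf.lintegral_le_of_translate (μ := volume) (hVo i).measurableSet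
      (hΩ.inter (hUo i)).measurableSet hs (hν i) (m := fun x => (1 + L) * bdryDist Ω x)
      (fun x hx σ hσ => by
        obtain ⟨z, hz, hxz⟩ := mem_iUnion₂.1 hx.2
        exact add_smul_mem_of_epigraph hΩ hne (hν i) (hg i) (hU i) hz hx.1 hxz hσ) 
    refine h.trans ?_
    have hc : ∀ x, ENNReal.ofReal ((1 + L) * bdryDist Ω x) =
        ((1 + L : ℝ≥0) : ENNReal) * ENNReal.ofReal (bdryDist Ω x) := fun x => by
      rw [ENNReal.ofReal_mul (by positivity)]
      congr 1
      rw [ENNReal.ofReal, ENNReal.coe_inj, Real.toNNReal_of_nonneg (by positivity)]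
      ext; simp
    simp_rw [hc, mul_assoc]
    rw [lintegral_const_mul _ hm0, lintegral_const_mul _ hm1, mul_left_comm, ← mul_add]
    gcongr
    rw [mul_add]
    gcongr
    · rw [ENNReal.ofReal, ← ENNReal.coe_inv (by simpa using hs), ENNReal.coe_le_coe]
      exact le_add_self
    · refine le_mul_of_one_le_left zero_le ?_
      exact_mod_cast le_self_add
  calc ∫⁻ x in Ω, ‖f x‖ₑ
      ≤ (∫⁻ x in (⋃ i, V i), ‖f x‖ₑ) + ∫⁻ x in Ω ∩ {x | ε / 5 ≤ bdryDist Ω x}, ‖f x‖ₑ :=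
        (lintegral_mono_set hsub).trans (lintegral_union_le _ _ _)
    _ ≤ (∑' i, ∫⁻ x in V i, ‖f x‖ₑ) + ((ε / 5).toNNReal⁻¹ : ℝ≥0) * I0 := by
        gcongr
        exact lintegral_iUnion_le _ _
    _ ≤ (∑' i, (1 + L : ℝ≥0) * ((1 + (2 * ε / 5).toNNReal⁻¹ : ℝ≥0) *
      ((∫⁻ x in Ω ∩ U i, ENNReal.ofReal (bdryDist Ω x) * ‖f x‖ₑ) +
        ∫⁻ x in Ω ∩ U i, ENNReal.ofReal (bdryDist Ω x) * ‖fderiv ℝ f x‖ₑ))) +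
        ((ε / 5).toNNReal⁻¹ : ℝ≥0) * I0 := by
        gcongr with i
        exact hnear i
    _ ≤ (1 + L : ℝ≥0) * ((1 + (2 * ε / 5).toNNReal⁻¹ : ℝ≥0) * (N * I0 + N * I1)) +
        ((ε / 5).toNNReal⁻¹ : ℝ≥0) * (I0 + I1) := by
        rw [ENNReal.tsum_mul_left, ENNReal.tsum_mul_left, ENNReal.tsum_add]
        gcongr
        · exact hoverlap _ hm0
        · exact hoverlap _ hm1
        · exact le_self_add
    _ = _ := by
        push_cast
        ring

/-! ### From local to global Lipschitz bounds -/

section locallyLipschitz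

open Topology

variable {X Y Z : Type*} [PseudoMetricSpace X] [PseudoMetricSpace Y] [PseudoMetricSpace Z]

theorem LocallyLipschitzOn.comp_of_forall {O : Set X} {Φ : X → Y} {G : Y → Z}
    (hΦ : LocallyLipschitzOn O Φ)
    (hG : ∀ x ∈ O, ∃ K, ∃ t ∈ 𝓝 (Φ x), LipschitzOnWith K G t) :
    LocallyLipschitzOn O (G ∘ Φ) := by
  intro x hx
  obtain ⟨K, t, ht, hK⟩ := hG x hx
  obtain ⟨K', t', ht', hK'⟩ := hΦ hx
  have hc : ContinuousWithinAt Φ O x := hΦ.continuousOn x hx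
  refine ⟨K * K', t' ∩ (Φ ⁻¹' t), Filter.inter_mem ht' (hc ht), ?_⟩
  exact hK.comp (hK'.mono inter_subset_left) fun y hy => hy.2

theorem LocallyLipschitzOn.prodMk {O : Set X} {f : X → Y} {g : X → Z}
    (hf : LocallyLipschitzOn O f) (hg : LocallyLipschitzOn O g) :
    LocallyLipschitzOn O fun x => (f x, g x) := by
  intro x hx
  obtain ⟨K, t, ht, hK⟩ := hf hx
  obtain ⟨K', t', ht', hK'⟩ := hg hx
  exact ⟨max K K', t ∩ t', Filter.inter_mem ht ht',
    (hK.mono inter_subset_left).prodMk (hK'.mono inter_subset_right)⟩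

/-- If one of two points at distance at most `1` lies in the support, both lie in a compact
thickening of it, where a uniform constant exists. For points further apart the oscillation bound
`2M` is already at most `2M` times the distance. -/
theorem LocallyLipschitzOn.exists_lipschitzWith_of_hasCompactSupport [ProperSpace X]
    {f : X → ℝ} {O : Set X} (hO : IsOpen O) (h : LocallyLipschitzOn O f)
    (hc : HasCompactSupport f) (hs : tsupport f ⊆ O) : ∃ C, LipschitzWith C f := by
  have hloc : LocallyLipschitz f := by
    intro x
    by_cases hx : x ∈ tsupport f
    · obtain ⟨K, t, ht, hK⟩ := h (hs hx)
      rw [hO.nhdsWithin_eq (hs hx)] at ht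
      exact ⟨K, t, ht, hK⟩
    · have h0 := notMem_tsupport_iff_eventuallyEq.1 hx
      refine ⟨0, _, h0, fun y hy z hz => ?_⟩
      rw [show f y = 0 from hy, show f z = 0 from hz]
      simp
  have hcont := hloc.continuous
  obtain ⟨M, hM⟩ := hcont.bounded_above_of_compact_support hc
  have hM0 : ∀ x, 0 ≤ M := fun x => (norm_nonneg _).trans (hM x)
  obtain ⟨K, hK⟩ := (hloc.locallyLipschitzOn (s := Metric.cthickening 1 (tsupport f))
    ).exists_lipschitzOnWith_of_compact hc.isCompact.cthickening
  have hsub : tsupport f ⊆ Metric.cthickening 1 (tsupport f) :=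
    Metric.self_subset_cthickening _
  refine ⟨K + (2 * M).toNNReal, LipschitzWith.of_dist_le_mul fun x y => ?_⟩
  have h1 : (K : ℝ) * dist x y ≤ ((K + (2 * M).toNNReal : ℝ≥0) : ℝ) * dist x y := by
    gcongr
    simp
  by_cases hd : dist x y ≤ 1
  · by_cases hx : x ∈ tsupport f
    · refine (hK.dist_le_mul x (hsub hx) y ?_).trans h1
      exact Metric.mem_cthickening_of_dist_le y x _ _ hx (by rwa [dist_comm])
    · by_cases hy : y ∈ tsupport f
      · refine (hK.dist_le_mul x ?_ y (hsub hy)).trans h1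
        exact Metric.mem_cthickening_of_dist_le x y _ _ hy hd
      · rw [image_eq_zero_of_notMem_tsupport hx, image_eq_zero_of_notMem_tsupport hy, dist_self]
        positivity
  · push Not at hd
    have h2 : dist (f x) (f y) ≤ 2 * M := by
      rw [dist_eq_norm]
      linarith [norm_sub_le (f x) (f y), hM x, hM y]
    calc dist (f x) (f y) ≤ 2 * M := h2
      _ ≤ ((K + (2 * M).toNNReal : ℝ≥0) : ℝ) * 1 := by
          push_cast
          rw [Real.coe_toNNReal _ (by linarith [hM0 x])]
          linarith [K.2]
      _ ≤ _ := by gcongr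

end locallyLipschitz

/-- The `p`-th power of a bounded Lipschitz function is Lipschitz. -/
theorem LipschitzWith.exists_norm_rpow {X : Type*} [PseudoMetricSpace X] {f : X → ℝ} {C : ℝ≥0}
    (hf : LipschitzWith C f) {M : ℝ} (hM : ∀ x, ‖f x‖ ≤ M) {p : ℝ} (hp : 1 < p) :
    ∃ D, LipschitzWith D fun x => ‖f x‖ ^ p := by
  obtain ⟨K, hK⟩ := ((contDiff_norm_rpow (E := ℝ) hp).locallyLipschitz.locallyLipschitzOn
    (s := Metric.closedBall 0 M)).exists_lipschitzOnWith_of_compact (isCompact_closedBall 0 M)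
  refine ⟨K * C, ?_⟩
  rw [← lipschitzOnWith_univ] at hf ⊢
  exact hK.comp hf fun x _ => by simpa using hM x

/-! ### The Sobolev inequality in a half-space -/

open Filter Topology in
/-- Gagliardo–Nirenberg–Sobolev inequality in a half-space, without boundary condition. -/
theorem LipschitzWith.lintegral_halfSpace_pow_le {F : Type*} [NormedAddCommGroup F]
    [NormedSpace ℝ F] [FiniteDimensional ℝ F] [MeasurableSpace F] [BorelSpace F] (μ : Measure F)
    [μ.IsAddHaarMeasure] {p : ℝ}
    (hp : Real.HolderConjugate (Module.finrank ℝ (F × ℝ)) p) :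
    ∃ C : ℝ≥0, ∀ (g : F × ℝ → ℝ) (D : ℝ≥0), LipschitzWith D g → HasCompactSupport g →
      ∫⁻ q in univ ×ˢ Ioi (0 : ℝ), ‖g q‖ₑ ^ p ∂(μ.prod volume) ≤
        C * (∫⁻ q in univ ×ˢ Ioi (0 : ℝ), ‖fderiv ℝ g q‖ₑ ∂(μ.prod volume)) ^ p := by
  set C0 := lintegralPowLePowLIntegralFDerivConst (μ.prod (volume : Measure ℝ)) p
  have hp0 : 0 ≤ p := hp.symm.nonneg
  refine ⟨C0 * (2 : ℝ≥0) ^ p, fun g D hg hc => ?_⟩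
  -- Even reflection keeps the function Lipschitz with compact support on the whole space, and the
  -- gradient norm is the same on both halves. This is where the factor `2 ^ p` originates.
  let T : F × ℝ → F × ℝ := fun q => (q.1, |q.2|)
  have hT : LipschitzWith 1 T := by
    have h2 : LipschitzWith 1 fun q : F × ℝ => |q.2| := by
      have := (lipschitzWith_one_norm (E := ℝ)).comp (LipschitzWith.prod_snd (α := F) (β := ℝ))
      rw [one_mul] at this
      exact this
    have := (LipschitzWith.prod_fst (α := F) (β := ℝ)).prodMk h2
    simpa using this
  let G : F × ℝ → ℝ := g ∘ T
  have hG : LipschitzWith D G := by simpa using hg.comp hT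
  have hGc : HasCompactSupport G := by
    have hK : IsCompact (tsupport g ∪ (fun q : F × ℝ => (q.1, -q.2)) '' tsupport g) :=
      hc.isCompact.union (hc.isCompact.image (by fun_prop))
    refine HasCompactSupport.intro hK fun q hq => ?_
    by_contra h
    have hm : T q ∈ tsupport g := subset_tsupport _ h
    rcases abs_choice q.2 with h1 | h1
    · exact hq (Or.inl (by simpa [T, h1] using hm))
    · exact hq (Or.inr ⟨T q, hm, by simp [T, h1]⟩)
  have key := hG.lintegral_pow_le_pow_lintegral_fderiv (μ.prod (volume : Measure ℝ)) hp hGc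
  let U : Set (F × ℝ) := univ ×ˢ Ioi (0 : ℝ)
  let U' : Set (F × ℝ) := univ ×ˢ Iio (0 : ℝ)
  have hU : IsOpen U := isOpen_univ.prod isOpen_Ioi
  have hU' : IsOpen U' := isOpen_univ.prod isOpen_Iio
  have hpos : ∀ q ∈ U, fderiv ℝ G q = fderiv ℝ g q := by
    intro q hq
    refine EventuallyEq.fderiv_eq ?_
    filter_upwards [hU.mem_nhds hq] with r hr
    simp [G, T, abs_of_pos (show 0 < r.2 from hr.2)]
  let R : (F × ℝ) ≃ₗᵢ[ℝ] (F × ℝ) :=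
    { toLinearEquiv := (LinearEquiv.refl ℝ F).prodCongr (LinearEquiv.neg ℝ)
      norm_map' := fun q => by simp [Prod.norm_def] }
  have hR : ∀ q, R q = (q.1, -q.2) := fun q => rfl
  have hneg : ∀ q ∈ U', ‖fderiv ℝ G q‖ₑ = ‖fderiv ℝ g (R q)‖ₑ := by
    intro q hq
    have h1 : fderiv ℝ G q = fderiv ℝ (g ∘ R) q := by
      refine EventuallyEq.fderiv_eq ?_
      filter_upwards [hU'.mem_nhds hq] with r hr
      simp [G, T, hR, abs_of_neg (show r.2 < 0 from hr.2)]
    rw [h1]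
    have h2 := R.toContinuousLinearEquiv.comp_right_fderiv (f := g) (x := q)
    have h3 : fderiv ℝ (g ∘ R) q = (fderiv ℝ g (R q)).comp (R.toContinuousLinearEquiv : F × ℝ →L[ℝ] F × ℝ) := h2
    rw [h3, enorm_eq_nnnorm, enorm_eq_nnnorm]
    congr 1
    ext
    exact ContinuousLinearMap.opNorm_comp_linearIsometryEquiv (fderiv ℝ g (R q)) R
  have hRm : MeasurePreserving R (μ.prod (volume : Measure ℝ)) (μ.prod volume) :=
    (MeasurePreserving.id μ).prod (Measure.measurePreserving_neg (volume : Measure ℝ))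
  have hfin : ∫⁻ q, ‖fderiv ℝ G q‖ₑ ∂(μ.prod (volume : Measure ℝ)) ≤
      2 * ∫⁻ q in U, ‖fderiv ℝ g q‖ₑ ∂(μ.prod volume) := by
    have hnull : (μ.prod (volume : Measure ℝ)) (U ∪ U')ᶜ = 0 := by
      have : (U ∪ U')ᶜ = univ ×ˢ ({0} : Set ℝ) := by
        ext q
        simp only [U, U', mem_compl_iff, mem_union, mem_prod, mem_univ, true_and, mem_Ioi, mem_Iio,
          mem_singleton_iff, not_or, not_lt]
        exact ⟨fun h => le_antisymm h.1 h.2, fun h => ⟨h.le, h.ge⟩⟩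
      rw [this, Measure.prod_prod]
      simp
    have h1 : ∫⁻ q, ‖fderiv ℝ G q‖ₑ ∂(μ.prod (volume : Measure ℝ)) =
        ∫⁻ q in U ∪ U', ‖fderiv ℝ G q‖ₑ ∂(μ.prod volume) := by
      rw [Measure.restrict_eq_self_of_ae_mem]
      exact hnull
    rw [h1]
    refine (lintegral_union_le _ _ _).trans ?_
    have h2 : ∫⁻ q in U, ‖fderiv ℝ G q‖ₑ ∂(μ.prod volume) =
        ∫⁻ q in U, ‖fderiv ℝ g q‖ₑ ∂(μ.prod volume) :=
      setLIntegral_congr_fun hU.measurableSet fun q hq => by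
        rw [enorm_eq_nnnorm, hpos q hq, ← enorm_eq_nnnorm]
    have h3 : ∫⁻ q in U', ‖fderiv ℝ G q‖ₑ ∂(μ.prod volume) =
        ∫⁻ q in U, ‖fderiv ℝ g q‖ₑ ∂(μ.prod volume) := by
      rw [setLIntegral_congr_fun hU'.measurableSet hneg]
      have h4 : U' = R ⁻¹' U := by
        ext q
        simp [U, U', hR]
      rw [h4]
      exact hRm.setLIntegral_comp_preimage hU.measurableSet (measurable_fderiv ℝ g).enorm
    rw [h2, h3, two_mul]
  calc ∫⁻ q in U, ‖g q‖ₑ ^ p ∂(μ.prod volume)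
      = ∫⁻ q in U, ‖G q‖ₑ ^ p ∂(μ.prod volume) := by
        refine setLIntegral_congr_fun hU.measurableSet fun q hq => ?_
        simp [G, T, abs_of_pos (show 0 < q.2 from hq.2)]
    _ ≤ ∫⁻ q, ‖G q‖ₑ ^ p ∂(μ.prod volume) := setLIntegral_le_lintegral _ _
    _ ≤ C0 * (2 * ∫⁻ q in U, ‖fderiv ℝ g q‖ₑ ∂(μ.prod volume)) ^ p :=
        key.trans (by gcongr)
    _ = _ := by
        rw [ENNReal.mul_rpow_of_nonneg _ _ hp0, ENNReal.coe_mul, mul_assoc,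
          ENNReal.coe_rpow_of_nonneg _ hp0]
        simp [U]

/-! ### One-dimensional weighted estimates and derivatives of powers -/

/-- Integration by parts on `(0, 1)` against a power of `1 - t`. -/
theorem integral_one_sub_rpow_mul {k : ℝ} (hk : 1 ≤ k) {φ φ' : ℝ → ℝ}
    (hφ : ∀ t, HasDerivAt φ (φ' t) t) (hi : IntervalIntegrable φ' volume 0 1) :
    k * ∫ t in (0 : ℝ)..1, (1 - t) ^ (k - 1) * φ t =
      φ 0 + ∫ t in (0 : ℝ)..1, (1 - t) ^ k * φ' t := by
  have hc : Continuous fun t : ℝ => (1 - t) ^ k :=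
    (continuous_const.sub continuous_id).rpow_const fun _ => Or.inr (by linarith)
  have hc1 : Continuous fun t : ℝ => (1 - t) ^ (k - 1) :=
    (continuous_const.sub continuous_id).rpow_const fun _ => Or.inr (by linarith)
  have hφc : Continuous φ := continuous_iff_continuousAt.2 fun t => (hφ t).continuousAt
  have h1 : ∀ t : ℝ, HasDerivAt (fun t => (1 - t) ^ k) (-(k * (1 - t) ^ (k - 1))) t := by
    intro t
    have := ((hasDerivAt_id' t).const_sub 1).rpow_const (p := k) (Or.inr hk)
    convert this using 1
    ring
  have h2 := intervalIntegral.integral_mul_deriv_eq_deriv_mul (a := 0) (b := 1)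
    (fun t _ => h1 t) (fun t _ => hφ t)
    ((continuous_const.mul hc1).neg.intervalIntegrable 0 1) hi
  have h3 : (0 : ℝ) ^ k = 0 := Real.zero_rpow (by linarith)
  rw [h2]
  simp only [sub_self, h3, zero_mul, sub_zero, Real.one_rpow, one_mul, zero_sub, neg_mul]
  rw [intervalIntegral.integral_neg, ← intervalIntegral.integral_const_mul]
  simp_rw [mul_assoc]
  ring

/-- The preceding identity read in both directions. One direction bounds a weighted integral by the
value at `0`, the other recovers the value at `0` from the integral. The endpoint `t = 1`
contributes nothing because the weight vanishes there. -/
theorem lintegral_one_sub_rpow_mul_le {k : ℝ} (hk : 1 ≤ k) {φ φ' : ℝ → ℝ}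
    (hφ : ∀ t, HasDerivAt φ (φ' t) t) (hi : IntervalIntegrable φ' volume 0 1)
    (h0 : ∀ t, 0 ≤ φ t) :
    (ENNReal.ofReal k * ∫⁻ t in Ioc (0 : ℝ) 1, ENNReal.ofReal (1 - t) ^ (k - 1) * ‖φ t‖ₑ ≤
      ‖φ 0‖ₑ + ∫⁻ t in Ioc (0 : ℝ) 1, ENNReal.ofReal (1 - t) ^ k * ‖φ' t‖ₑ) ∧
    ‖φ 0‖ₑ ≤ ENNReal.ofReal k *
        (∫⁻ t in Ioc (0 : ℝ) 1, ENNReal.ofReal (1 - t) ^ (k - 1) * ‖φ t‖ₑ) +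
      ∫⁻ t in Ioc (0 : ℝ) 1, ENNReal.ofReal (1 - t) ^ k * ‖φ' t‖ₑ := by
  have hc : Continuous fun t : ℝ => (1 - t) ^ k :=
    (continuous_const.sub continuous_id).rpow_const fun _ => Or.inr (by linarith)
  have hc1 : Continuous fun t : ℝ => (1 - t) ^ (k - 1) :=
    (continuous_const.sub continuous_id).rpow_const fun _ => Or.inr (by linarith)
  have hφc : Continuous φ := continuous_iff_continuousAt.2 fun t => (hφ t).continuousAt
  have key := integral_one_sub_rpow_mul hk hφ hi
  rw [intervalIntegral.integral_of_le zero_le_one, intervalIntegral.integral_of_le zero_le_one] at key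
  have e1 : ∫⁻ t in Ioc (0 : ℝ) 1, ENNReal.ofReal (1 - t) ^ (k - 1) * ‖φ t‖ₑ =
      ENNReal.ofReal (∫ t in Ioc (0 : ℝ) 1, (1 - t) ^ (k - 1) * φ t) := by
    rw [ofReal_integral_eq_lintegral_ofReal]
    · refine setLIntegral_congr_fun measurableSet_Ioc fun t ht => ?_
      have ht' : 0 ≤ 1 - t := by linarith [ht.2]
      rw [ENNReal.ofReal_mul (Real.rpow_nonneg ht' _),
        ENNReal.ofReal_rpow_of_nonneg ht' (by linarith), Real.enorm_of_nonneg (h0 t)]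
    · exact (hc1.mul hφc).integrableOn_Ioc
    · filter_upwards [ae_restrict_mem measurableSet_Ioc] with t ht
      exact mul_nonneg (Real.rpow_nonneg (by linarith [ht.2]) _) (h0 t)
  have e2 : ‖∫ t in Ioc (0 : ℝ) 1, (1 - t) ^ k * φ' t‖ₑ ≤
      ∫⁻ t in Ioc (0 : ℝ) 1, ENNReal.ofReal (1 - t) ^ k * ‖φ' t‖ₑ := by
    refine (enorm_integral_le_lintegral_enorm _).trans_eq ?_
    refine setLIntegral_congr_fun measurableSet_Ioc fun t ht => ?_
    have ht' : 0 ≤ 1 - t := by linarith [ht.2]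
    rw [enorm_mul, Real.enorm_of_nonneg (Real.rpow_nonneg ht' _),
      ENNReal.ofReal_rpow_of_nonneg ht' (by linarith)]
  have hn : 0 ≤ ∫ t in Ioc (0 : ℝ) 1, (1 - t) ^ (k - 1) * φ t := by
    refine setIntegral_nonneg measurableSet_Ioc fun t ht => ?_
    exact mul_nonneg (Real.rpow_nonneg (by linarith [ht.2]) _) (h0 t)
  have e3 : ENNReal.ofReal k * ENNReal.ofReal (∫ t in Ioc (0 : ℝ) 1, (1 - t) ^ (k - 1) * φ t) =
      ‖φ 0 + ∫ t in Ioc (0 : ℝ) 1, (1 - t) ^ k * φ' t‖ₑ := by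
    rw [← key, ← ENNReal.ofReal_mul (by linarith), Real.enorm_of_nonneg (by positivity)]
  rw [e1, e3]
  constructor
  · exact (enorm_add_le _ _).trans (by gcongr)
  · have h4 := enorm_sub_le (a := φ 0 + ∫ t in Ioc (0 : ℝ) 1, (1 - t) ^ k * φ' t)
      (b := ∫ t in Ioc (0 : ℝ) 1, (1 - t) ^ k * φ' t)
    rw [add_sub_cancel_right] at h4
    exact h4.trans (by gcongr)

/-- Rescaling an integral over `(0, d)` to `(0, 1)`. -/
theorem setLIntegral_Ioc_eq_mul {d : ℝ} (hd : 0 < d) (h : ℝ → ENNReal) :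
    ∫⁻ y in Ioc 0 d, h y = ENNReal.ofReal d * ∫⁻ t in Ioc (0 : ℝ) 1, h (t * d) := by
  have h1 := Real.map_volume_mul_right hd.ne'
  have he : MeasurableEmbedding fun t : ℝ => t * d :=
    (Homeomorph.mulRight₀ d hd.ne').measurableEmbedding
  have h2 : (fun t : ℝ => t * d) ⁻¹' Ioc 0 d = Ioc 0 1 := by
    ext t
    simp only [mem_preimage, mem_Ioc]
    rw [mul_pos_iff_of_pos_right hd]
    exact and_congr_right fun _ => ⟨fun h => by nlinarith, fun h => by nlinarith⟩
  have h3 : ∫⁻ t in Ioc (0 : ℝ) 1, h (t * d) =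
      ∫⁻ y in Ioc 0 d, h y ∂(Measure.map (fun t : ℝ => t * d) volume) := by
    rw [← h2, he.restrict_map, he.lintegral_map]
  rw [h3, h1, Measure.restrict_smul, lintegral_smul_measure, smul_eq_mul, ← mul_assoc,
    ← ENNReal.ofReal_mul hd.le, abs_inv, abs_of_pos hd, mul_inv_cancel₀ hd.ne', ENNReal.ofReal_one,
    one_mul]

theorem hasFDerivAt_norm_rpow_comp {F : Type*} [NormedAddCommGroup F] [NormedSpace ℝ F]
    {f : F → ℝ} {f' : F →L[ℝ] ℝ} {x : F} {p : ℝ} (hp : 1 < p) (hf : HasFDerivAt f f' x) :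
    HasFDerivAt (fun z => ‖f z‖ ^ p) ((p * ‖f x‖ ^ (p - 2) * f x) • f') x :=
  (hasDerivAt_norm_rpow (f x) hp).comp_hasFDerivAt x hf

theorem enorm_mul_norm_rpow_mul {p : ℝ} (hp : 1 < p) (r : ℝ) :
    ‖p * ‖r‖ ^ (p - 2) * r‖ₑ = ENNReal.ofReal p * ‖r‖ₑ ^ (p - 1) := by
  rw [← ofReal_norm r, ENNReal.ofReal_rpow_of_nonneg (norm_nonneg _) (by linarith),
    ← ENNReal.ofReal_mul (by linarith), ← ofReal_norm]
  congr 1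
  rw [norm_mul, norm_mul, Real.norm_of_nonneg (by linarith : 0 ≤ p),
    Real.norm_of_nonneg (Real.rpow_nonneg (norm_nonneg _) _), mul_assoc]
  congr 1
  rcases eq_or_ne r 0 with rfl | hr
  · rw [norm_zero, mul_zero, Real.zero_rpow (by linarith)]
  · rw [← Real.rpow_add_one (norm_ne_zero_iff.2 hr)]
    congr 1
    ring

theorem enorm_fderiv_norm_rpow_comp_le {F : Type*} [NormedAddCommGroup F] [NormedSpace ℝ F]
    {f : F → ℝ} {x : F} {p : ℝ} (hp : 1 < p) (hf : DifferentiableAt ℝ f x) :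
    ‖fderiv ℝ (fun z => ‖f z‖ ^ p) x‖ₑ ≤
      ENNReal.ofReal p * ‖f x‖ₑ ^ (p - 1) * ‖fderiv ℝ f x‖ₑ := by
  rw [← enorm_mul_norm_rpow_mul hp, (hasFDerivAt_norm_rpow_comp hp hf.hasFDerivAt).fderiv,
    ← ofReal_norm, norm_smul, ENNReal.ofReal_mul (norm_nonneg _), ofReal_norm,
    ofReal_norm]

/-- Cauchy–Schwarz for the measure `w dμ`, with `w` split into two square roots. -/
theorem lintegral_weight_mul_mul_le {α : Type*} [MeasurableSpace α] (μ : Measure α)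
    {w h k : α → ENNReal} (hw : Measurable w) (hh : Measurable h) (hk : Measurable k) :
    ∫⁻ a, w a * (h a * k a) ∂μ ≤
      (∫⁻ a, w a * h a ^ (2 : ℝ) ∂μ) ^ (1 / 2 : ℝ) * (∫⁻ a, w a * k a ^ (2 : ℝ) ∂μ) ^ (1 / 2 : ℝ) := by
  have h1 : ∀ a : ENNReal, a ^ (1 / 2 : ℝ) * a ^ (1 / 2 : ℝ) = a := fun a => by
    rw [← ENNReal.rpow_add_of_nonneg _ _ (by norm_num) (by norm_num)]; norm_num
  have h2 : ∀ a : ENNReal, (a ^ (1 / 2 : ℝ)) ^ (2 : ℝ) = a := fun a => by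
    rw [← ENNReal.rpow_mul]; norm_num
  have key := ENNReal.lintegral_mul_le_Lp_mul_Lq μ Real.HolderConjugate.two_two
    (f := fun a => w a ^ (1 / 2 : ℝ) * h a) (g := fun a => w a ^ (1 / 2 : ℝ) * k a)
    ((hw.pow_const _).mul hh).aemeasurable ((hw.pow_const _).mul hk).aemeasurable
  simp only [Pi.mul_apply, ENNReal.mul_rpow_of_nonneg _ _ (zero_le_two : (0 : ℝ) ≤ 2), h2] at key
  refine le_trans (le_of_eq (lintegral_congr fun a => ?_)) key
  calc w a * (h a * k a) = (w a ^ (1 / 2 : ℝ) * w a ^ (1 / 2 : ℝ)) * (h a * k a) := by rw [h1]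
    _ = _ := by ring

/-! ### Weighted integrals over the cone `0 < y < d(x)` -/

section cone

variable {n : ℕ}

/-- The product measure on `Ω × (0, 1]`, the parameter domain of `(x, t) ↦ (x, t d(x))`. -/
noncomputable def coneMeasure (Ω : Set (EuclideanSpace ℝ (Fin n))) :
    Measure (EuclideanSpace ℝ (Fin n) × ℝ) :=
  (volume.restrict Ω).prod (volume.restrict (Ioc 0 1))

/-- The map `(x, t) ↦ (x, t d(x))`. -/
noncomputable def coneMap (Ω : Set (EuclideanSpace ℝ (Fin n)))
    (q : EuclideanSpace ℝ (Fin n) × ℝ) : EuclideanSpace ℝ (Fin n) × ℝ :=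
  (q.1, q.2 * bdryDist Ω q.1)

theorem continuous_bdryDist (Ω : Set (EuclideanSpace ℝ (Fin n))) : Continuous (bdryDist Ω) :=
  (lipschitzWith_bdryDist Ω).continuous

theorem continuous_coneMap (Ω : Set (EuclideanSpace ℝ (Fin n))) : Continuous (coneMap Ω) :=
  continuous_fst.prodMk (continuous_snd.mul ((continuous_bdryDist Ω).comp continuous_fst))

variable {Ω : Set (EuclideanSpace ℝ (Fin n))} {v : EuclideanSpace ℝ (Fin n) × ℝ → ℝ}

/-- The `L¹` Hardy inequality applied on the slices `y = t d(x)`. -/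
theorem lintegral_cone_rpow_le {C : ℝ≥0} {p : ℝ} (hp : 1 < p)
    (hC : ∀ (f : EuclideanSpace ℝ (Fin n) → ℝ) (D : ℝ≥0), LipschitzWith D f →
      ∫⁻ x in Ω, ‖f x‖ₑ ≤ C * ((∫⁻ x in Ω, ENNReal.ofReal (bdryDist Ω x) * ‖f x‖ₑ) +
        ∫⁻ x in Ω, ENNReal.ofReal (bdryDist Ω x) * ‖fderiv ℝ f x‖ₑ))
    {D : ℝ≥0} (hv : LipschitzWith D v) (hc : HasCompactSupport v)
    (hd : ∀ᵐ x ∂(volume.restrict Ω), ∀ y, DifferentiableAt ℝ v (x, y)) :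
    ∫⁻ q, (ENNReal.ofReal (1 - q.2) * ‖v (coneMap Ω q)‖ₑ) ^ p ∂(coneMeasure Ω) ≤
      C * ((∫⁻ q, ENNReal.ofReal (bdryDist Ω q.1) *
        ((ENNReal.ofReal (1 - q.2) * ‖v (coneMap Ω q)‖ₑ) *
          (ENNReal.ofReal (1 - q.2) * ‖v (coneMap Ω q)‖ₑ) ^ (p - 1)) ∂(coneMeasure Ω)) +
        ENNReal.ofReal p * ∫⁻ q, ENNReal.ofReal (bdryDist Ω q.1) *
        ((ENNReal.ofReal (1 - q.2) * ‖fderiv ℝ v (coneMap Ω q)‖ₑ) *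
          (ENNReal.ofReal (1 - q.2) * ‖v (coneMap Ω q)‖ₑ) ^ (p - 1)) ∂(coneMeasure Ω)) := by
  have hp0 : 0 ≤ p := by linarith
  have hmA : Measurable fun q => ‖v (coneMap Ω q)‖ₑ :=
    (hv.continuous.comp (continuous_coneMap Ω)).measurable.enorm
  have hmB : Measurable fun q => ‖fderiv ℝ v (coneMap Ω q)‖ₑ :=
    ((measurable_fderiv ℝ v).comp (continuous_coneMap Ω).measurable).enorm
  have hmw : Measurable fun q : EuclideanSpace ℝ (Fin n) × ℝ => ENNReal.ofReal (1 - q.2) :=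
    (measurable_const.sub measurable_snd).ennreal_ofReal
  have hmd : Measurable fun q : EuclideanSpace ℝ (Fin n) × ℝ => ENNReal.ofReal (bdryDist Ω q.1) :=
    ((continuous_bdryDist Ω).measurable.comp measurable_fst).ennreal_ofReal
  obtain ⟨M, hM⟩ := hv.continuous.bounded_above_of_compact_support hc
  obtain ⟨D', hD'⟩ := hv.exists_norm_rpow hM hp
  have hslice : ∀ t ∈ Ioc (0 : ℝ) 1, ∫⁻ x in Ω, ‖v (coneMap Ω (x, t))‖ₑ ^ p ≤
      C * ((∫⁻ x in Ω, ENNReal.ofReal (bdryDist Ω x) * ‖v (coneMap Ω (x, t))‖ₑ ^ p) +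
        ENNReal.ofReal p * ∫⁻ x in Ω, ENNReal.ofReal (bdryDist Ω x) *
          (‖fderiv ℝ v (coneMap Ω (x, t))‖ₑ * ‖v (coneMap Ω (x, t))‖ₑ ^ (p - 1))) := by
    intro t ht
    -- The product carries the sup norm and `d` is `1`-Lipschitz, so the constant is `1` when `0 < t
    -- ≤ 1`; restriction to the slice `y = t d(x)` does not increase gradient norms.
    have hcone : LipschitzWith (max 1 ‖t‖₊) fun x => coneMap Ω (x, t) := by
      refine LipschitzWith.id.prodMk ?_
      refine LipschitzWith.of_dist_le_mul fun x y => ?_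
      rw [dist_eq_norm, ← mul_sub, norm_mul]
      have := (lipschitzWith_bdryDist Ω).dist_le_mul x y
      rw [NNReal.coe_one, one_mul] at this
      exact mul_le_mul_of_nonneg_left this (norm_nonneg _)
    have h1 := hC _ _ (hD'.comp hcone)
    have h2 : ∀ x, ‖((fun q => ‖v q‖ ^ p) ∘ fun x => coneMap Ω (x, t)) x‖ₑ =
        ‖v (coneMap Ω (x, t))‖ₑ ^ p := fun x => by
      simp only [Function.comp]
      rw [← ofReal_norm (v _), ENNReal.ofReal_rpow_of_nonneg (norm_nonneg _) hp0,
        Real.enorm_of_nonneg (by positivity)]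
    simp_rw [h2] at h1
    refine h1.trans ?_
    gcongr C * (_ + ?_)
    have hmB' : Measurable fun x => ‖fderiv ℝ v (coneMap Ω (x, t))‖ₑ := hmB.comp measurable_prodMk_right
    have hmA' : Measurable fun x => ‖v (coneMap Ω (x, t))‖ₑ := hmA.comp measurable_prodMk_right
    rw [← lintegral_const_mul _ (by
      exact (continuous_bdryDist Ω).measurable.ennreal_ofReal.mul (hmB'.mul (hmA'.pow_const _)))]
    refine lintegral_mono_ae ?_
    have hΩd := (lipschitzWith_bdryDist Ω).ae_differentiableAt (μ := volume)
    filter_upwards [hd, ae_restrict_of_ae (hcone.ae_differentiableAt (μ := volume))] with x hx hcd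
    have h3 : fderiv ℝ ((fun q => ‖v q‖ ^ p) ∘ fun x => coneMap Ω (x, t)) x = _ :=
      fderiv_comp x (hasFDerivAt_norm_rpow_comp hp (hx (t * bdryDist Ω x)).hasFDerivAt
        ).differentiableAt hcd
    have h4 : ‖fderiv ℝ (fun x => coneMap Ω (x, t)) x‖ ≤ 1 := by
      have := norm_fderiv_le_of_lipschitz ℝ (x₀ := x) hcone
      refine this.trans ?_
      rw [NNReal.coe_max, NNReal.coe_one, coe_nnnorm, Real.norm_of_nonneg ht.1.le]
      exact max_le le_rfl ht.2
    have h5 : ‖fderiv ℝ ((fun q => ‖v q‖ ^ p) ∘ fun x => coneMap Ω (x, t)) x‖ₑ ≤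
        ‖fderiv ℝ (fun q => ‖v q‖ ^ p) (coneMap Ω (x, t))‖ₑ := by
      rw [h3, enorm_le_iff_norm_le]
      refine (ContinuousLinearMap.opNorm_comp_le _ _).trans ?_
      exact mul_le_of_le_one_right (norm_nonneg _) h4
    have h6 := enorm_fderiv_norm_rpow_comp_le hp (hx (t * bdryDist Ω x))
    calc _ ≤ ENNReal.ofReal (bdryDist Ω x) * (ENNReal.ofReal p *
          ‖v (coneMap Ω (x, t))‖ₑ ^ (p - 1) * ‖fderiv ℝ v (coneMap Ω (x, t))‖ₑ) :=
          mul_le_mul_right (h5.trans h6) _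
      _ = _ := by ring
  have hw : ∀ (t : ℝ) (a : ENNReal), (ENNReal.ofReal (1 - t) * a) ^ p =
      ENNReal.ofReal (1 - t) ^ p * a ^ p := fun t a => ENNReal.mul_rpow_of_nonneg _ _ hp0
  have hpp : ∀ a : ENNReal, a * a ^ (p - 1) = a ^ p := fun a => by
    nth_rewrite 1 [← ENNReal.rpow_one a]
    rw [← ENNReal.rpow_add_of_nonneg _ _ zero_le_one (by linarith)]
    congr 1; ring
  have e2 : ∀ q : EuclideanSpace ℝ (Fin n) × ℝ, ENNReal.ofReal (bdryDist Ω q.1) *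
        ((ENNReal.ofReal (1 - q.2) * ‖v (coneMap Ω q)‖ₑ) *
          (ENNReal.ofReal (1 - q.2) * ‖v (coneMap Ω q)‖ₑ) ^ (p - 1)) =
      ENNReal.ofReal (1 - q.2) ^ p * (ENNReal.ofReal (bdryDist Ω q.1) *
        ‖v (coneMap Ω q)‖ₑ ^ p) := fun q => by rw [hpp, hw]; ring
  have e3 : ∀ q : EuclideanSpace ℝ (Fin n) × ℝ, ENNReal.ofReal (bdryDist Ω q.1) *
        ((ENNReal.ofReal (1 - q.2) * ‖fderiv ℝ v (coneMap Ω q)‖ₑ) *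
          (ENNReal.ofReal (1 - q.2) * ‖v (coneMap Ω q)‖ₑ) ^ (p - 1)) =
      ENNReal.ofReal (1 - q.2) ^ p * (ENNReal.ofReal (bdryDist Ω q.1) *
        (‖fderiv ℝ v (coneMap Ω q)‖ₑ * ‖v (coneMap Ω q)‖ₑ ^ (p - 1))) := fun q => by
    rw [← hpp (ENNReal.ofReal (1 - q.2)), ENNReal.mul_rpow_of_nonneg _ _ (by linarith)]; ring
  simp_rw [e2, e3, hw]
  have hmw' : Measurable fun t : ℝ => ENNReal.ofReal (1 - t) ^ p :=
    (measurable_const.sub measurable_id).ennreal_ofReal.pow_const _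
  have hF : ∀ {h : EuclideanSpace ℝ (Fin n) × ℝ → ENNReal}, Measurable h →
      ∫⁻ q, ENNReal.ofReal (1 - q.2) ^ p * h q ∂(coneMeasure Ω) =
        ∫⁻ t in Ioc (0 : ℝ) 1, ENNReal.ofReal (1 - t) ^ p * ∫⁻ x in Ω, h (x, t) := by
    intro h hh
    have hm : Measurable fun q : EuclideanSpace ℝ (Fin n) × ℝ =>
        ENNReal.ofReal (1 - q.2) ^ p * h q := (hmw.pow_const _).mul hh
    rw [coneMeasure, lintegral_prod_symm' _ hm]
    refine lintegral_congr fun t => ?_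
    have hh' : Measurable fun x => h (x, t) := hh.comp measurable_prodMk_right
    exact lintegral_const_mul (ENNReal.ofReal (1 - t) ^ p) hh'
  have hm2 : Measurable fun q => ENNReal.ofReal (bdryDist Ω q.1) * ‖v (coneMap Ω q)‖ₑ ^ p :=
    hmd.mul (hmA.pow_const _)
  have hm3 : Measurable fun q => ENNReal.ofReal (bdryDist Ω q.1) *
      (‖fderiv ℝ v (coneMap Ω q)‖ₑ * ‖v (coneMap Ω q)‖ₑ ^ (p - 1)) :=
    hmd.mul (hmB.mul (hmA.pow_const _))
  rw [hF (hmA.pow_const _), hF hm2, hF hm3]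
  have hmx : ∀ {h : EuclideanSpace ℝ (Fin n) × ℝ → ENNReal}, Measurable h →
      Measurable fun t => ENNReal.ofReal (1 - t) ^ p * ∫⁻ x in Ω, h (x, t) := fun hh =>
    hmw'.mul hh.lintegral_prod_left'
  rw [← lintegral_const_mul _ (hmx hm3), ← lintegral_add_left (hmx hm2),
    ← lintegral_const_mul _ (by exact (hmx hm2).add ((hmx hm3).const_mul _))]
  refine setLIntegral_mono' measurableSet_Ioc fun t ht => ?_
  calc _ ≤ ENNReal.ofReal (1 - t) ^ p * _ := mul_le_mul_right (hslice t ht) _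
    _ = _ := by ring

theorem measurable_enorm_comp_coneMap (hv : Continuous v) :
    Measurable fun q => ‖v (coneMap Ω q)‖ₑ :=
  (hv.comp (continuous_coneMap Ω)).measurable.enorm

theorem measurable_enorm_fderiv_comp_coneMap :
    Measurable fun q => ‖fderiv ℝ v (coneMap Ω q)‖ₑ :=
  ((measurable_fderiv ℝ v).comp (continuous_coneMap Ω).measurable).enorm

theorem measurable_ofReal_one_sub_snd :
    Measurable fun q : EuclideanSpace ℝ (Fin n) × ℝ => ENNReal.ofReal (1 - q.2) :=
  (measurable_const.sub measurable_snd).ennreal_ofReal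

theorem measurable_ofReal_bdryDist_fst :
    Measurable fun q : EuclideanSpace ℝ (Fin n) × ℝ => ENNReal.ofReal (bdryDist Ω q.1) :=
  ((continuous_bdryDist Ω).measurable.comp measurable_fst).ennreal_ofReal

theorem lintegral_coneMeasure {h : EuclideanSpace ℝ (Fin n) × ℝ → ENNReal} (hh : Measurable h) :
    ∫⁻ q, h q ∂(coneMeasure Ω) = ∫⁻ x in Ω, ∫⁻ t in Ioc (0 : ℝ) 1, h (x, t) :=
  lintegral_prod _ hh.aemeasurable

theorem ENNReal.mul_rpow_sub_one {p : ℝ} (hp : 1 ≤ p) (a : ENNReal) : a * a ^ (p - 1) = a ^ p := by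
  nth_rewrite 1 [← ENNReal.rpow_one a]
  rw [← ENNReal.rpow_add_of_nonneg _ _ zero_le_one (by linarith)]
  congr 1; ring

theorem bdryDist_nonneg (x : EuclideanSpace ℝ (Fin n)) : 0 ≤ bdryDist Ω x := Metric.infDist_nonneg

/-- Along a vertical fibre `t ↦ (x, t d(x))`, weighted one-dimensional inequalities. -/
theorem fibre_le {p : ℝ} (hp : 1 < p) {D : ℝ≥0} (hv : LipschitzWith D v)
    (hc : HasCompactSupport v) {x : EuclideanSpace ℝ (Fin n)}
    (hd : ∀ y, DifferentiableAt ℝ v (x, y)) {k : ℝ} (hk : 1 ≤ k) :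
    (ENNReal.ofReal k * ∫⁻ t in Ioc (0 : ℝ) 1,
        ENNReal.ofReal (1 - t) ^ (k - 1) * ‖v (coneMap Ω (x, t))‖ₑ ^ p ≤
      ‖v (x, 0)‖ₑ ^ p + ENNReal.ofReal p * ∫⁻ t in Ioc (0 : ℝ) 1, ENNReal.ofReal (1 - t) ^ k *
        (ENNReal.ofReal (bdryDist Ω x) * (‖fderiv ℝ v (coneMap Ω (x, t))‖ₑ *
          ‖v (coneMap Ω (x, t))‖ₑ ^ (p - 1)))) ∧
    ‖v (x, 0)‖ₑ ^ p ≤ ENNReal.ofReal k * (∫⁻ t in Ioc (0 : ℝ) 1,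
        ENNReal.ofReal (1 - t) ^ (k - 1) * ‖v (coneMap Ω (x, t))‖ₑ ^ p) +
      ENNReal.ofReal p * ∫⁻ t in Ioc (0 : ℝ) 1, ENNReal.ofReal (1 - t) ^ k *
        (ENNReal.ofReal (bdryDist Ω x) * (‖fderiv ℝ v (coneMap Ω (x, t))‖ₑ *
          ‖v (coneMap Ω (x, t))‖ₑ ^ (p - 1))) := by
  have hp0 : 0 ≤ p := by linarith
  obtain ⟨M, hM⟩ := hv.continuous.bounded_above_of_compact_support hc
  obtain ⟨D', hD'⟩ := hv.exists_norm_rpow hM hp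
  let γ : ℝ → EuclideanSpace ℝ (Fin n) × ℝ := fun t => coneMap Ω (x, t)
  have hγ : ∀ t, HasDerivAt γ (0, bdryDist Ω x) t := fun t => by
    have h1 : HasDerivAt (fun t : ℝ => t * bdryDist Ω x) (bdryDist Ω x) t := by
      simpa using (hasDerivAt_id t).mul_const (bdryDist Ω x)
    exact (hasDerivAt_const t x).prodMk h1
  have hγL : LipschitzWith ‖bdryDist Ω x‖₊ γ := by
    refine LipschitzWith.of_dist_le_mul fun s t => ?_
    rw [Prod.dist_eq]
    refine max_le (by simp only [γ, coneMap, dist_self]; positivity) ?_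
    simp only [γ, coneMap, dist_eq_norm]
    rw [← sub_mul, norm_mul, mul_comm]; rfl
  let φ : ℝ → ℝ := fun t => ‖v (γ t)‖ ^ p
  let φ' : ℝ → ℝ := fun t =>
    (p * ‖v (γ t)‖ ^ (p - 2) * v (γ t)) * fderiv ℝ v (γ t) (0, bdryDist Ω x)
  have hφ : ∀ t, HasDerivAt φ (φ' t) t := fun t =>
    HasFDerivAt.comp_hasDerivAt (f := γ) t
      (hasFDerivAt_norm_rpow_comp hp (hd (t * bdryDist Ω x)).hasFDerivAt) (hγ t)
  have hi : IntervalIntegrable φ' volume 0 1 := by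
    have h1 : φ' = deriv φ := funext fun t => (hφ t).deriv.symm
    rw [h1]
    exact ((hD'.comp hγL).lipschitzOnWith (s := uIcc 0 1)
      ).absolutelyContinuousOnInterval.intervalIntegrable_deriv
  have hφe : ∀ t, ‖φ t‖ₑ = ‖v (coneMap Ω (x, t))‖ₑ ^ p := fun t => by
    rw [← ofReal_norm (v _), ENNReal.ofReal_rpow_of_nonneg (norm_nonneg _) hp0,
        Real.enorm_of_nonneg (by positivity)]
  have hφ0 : ‖φ 0‖ₑ = ‖v (x, 0)‖ₑ ^ p := by rw [hφe]; simp [coneMap]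
  have hφ'e : ∀ t, ‖φ' t‖ₑ ≤ ENNReal.ofReal p * (ENNReal.ofReal (bdryDist Ω x) *
      (‖fderiv ℝ v (coneMap Ω (x, t))‖ₑ * ‖v (coneMap Ω (x, t))‖ₑ ^ (p - 1))) := fun t => by
    have h1 : ‖fderiv ℝ v (γ t) (0, bdryDist Ω x)‖ₑ ≤
        ‖fderiv ℝ v (γ t)‖ₑ * ENNReal.ofReal (bdryDist Ω x) := by
      rw [← ofReal_norm, ← ofReal_norm, ← ENNReal.ofReal_mul (norm_nonneg _)]
      refine ENNReal.ofReal_le_ofReal (((fderiv ℝ v (γ t)).le_opNorm _).trans_eq ?_)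
      rw [Prod.norm_def]
      simp [abs_of_nonneg (bdryDist_nonneg x), bdryDist_nonneg x]
    calc ‖φ' t‖ₑ = ENNReal.ofReal p * ‖v (γ t)‖ₑ ^ (p - 1) *
          ‖fderiv ℝ v (γ t) (0, bdryDist Ω x)‖ₑ := by
          rw [← enorm_mul_norm_rpow_mul hp, ← enorm_mul]
      _ ≤ ENNReal.ofReal p * ‖v (γ t)‖ₑ ^ (p - 1) *
          (‖fderiv ℝ v (γ t)‖ₑ * ENNReal.ofReal (bdryDist Ω x)) := by gcongr
      _ = _ := by simp only [γ]; ring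
  have hle : ∫⁻ t in Ioc (0 : ℝ) 1, ENNReal.ofReal (1 - t) ^ k * ‖φ' t‖ₑ ≤
      ENNReal.ofReal p * ∫⁻ t in Ioc (0 : ℝ) 1, ENNReal.ofReal (1 - t) ^ k *
        (ENNReal.ofReal (bdryDist Ω x) * (‖fderiv ℝ v (coneMap Ω (x, t))‖ₑ *
          ‖v (coneMap Ω (x, t))‖ₑ ^ (p - 1))) := by
    rw [← lintegral_const_mul' _ _ ENNReal.ofReal_ne_top]
    refine lintegral_mono fun t => ?_
    calc _ ≤ ENNReal.ofReal (1 - t) ^ k * _ := mul_le_mul_right (hφ'e t) _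
      _ = _ := by ring
  obtain ⟨h1, h2⟩ := lintegral_one_sub_rpow_mul_le hk hφ hi fun t => by positivity
  simp_rw [hφe] at h1 h2
  have hv0 : v (coneMap Ω (x, 0)) = v (x, 0) := by simp [coneMap]
  rw [hv0] at h1 h2
  exact ⟨h1.trans (by gcongr), h2.trans (by gcongr)⟩

/-- The fibre estimate with `k = p + 1`, which produces exactly the weight `(1-t)^p` attached to
`|v|^p`. In the gradient term one power of `1 - t ≤ 1` is surplus and is dropped. -/
theorem lintegral_trace_le {p : ℝ} (hp : 1 < p) {D : ℝ≥0} (hv : LipschitzWith D v)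
    (hc : HasCompactSupport v)
    (hd : ∀ᵐ x ∂(volume.restrict Ω), ∀ y, DifferentiableAt ℝ v (x, y)) :
    ∫⁻ x in Ω, ‖v (x, 0)‖ₑ ^ p ≤ ENNReal.ofReal (p + 1) *
        (∫⁻ q, (ENNReal.ofReal (1 - q.2) * ‖v (coneMap Ω q)‖ₑ) ^ p ∂(coneMeasure Ω)) +
      ENNReal.ofReal p * ∫⁻ q, ENNReal.ofReal (bdryDist Ω q.1) *
        ((ENNReal.ofReal (1 - q.2) * ‖fderiv ℝ v (coneMap Ω q)‖ₑ) *
          (ENNReal.ofReal (1 - q.2) * ‖v (coneMap Ω q)‖ₑ) ^ (p - 1)) ∂(coneMeasure Ω) := by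
  have hmA := measurable_enorm_comp_coneMap (Ω := Ω) hv.continuous
  have hmB := measurable_enorm_fderiv_comp_coneMap (Ω := Ω) (v := v)
  have hmw := measurable_ofReal_one_sub_snd (n := n)
  have hmd := measurable_ofReal_bdryDist_fst (Ω := Ω)
  have hm1 : Measurable fun q => (ENNReal.ofReal (1 - q.2) * ‖v (coneMap Ω q)‖ₑ) ^ p :=
    (hmw.mul hmA).pow_const _
  have hm2 : Measurable fun q => ENNReal.ofReal (bdryDist Ω q.1) *
        ((ENNReal.ofReal (1 - q.2) * ‖fderiv ℝ v (coneMap Ω q)‖ₑ) *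
          (ENNReal.ofReal (1 - q.2) * ‖v (coneMap Ω q)‖ₑ) ^ (p - 1)) :=
    hmd.mul ((hmw.mul hmB).mul ((hmw.mul hmA).pow_const _))
  rw [lintegral_coneMeasure hm1, lintegral_coneMeasure hm2,
    ← lintegral_const_mul' _ _ ENNReal.ofReal_ne_top, ← lintegral_const_mul' _ _ ENNReal.ofReal_ne_top,
    ← lintegral_add_left (by exact (hm1.lintegral_prod_right').const_mul _)]
  refine lintegral_mono_ae ?_
  filter_upwards [hd] with x hx
  refine (fibre_le (Ω := Ω) hp hv hc hx (k := p + 1) (by linarith)).2.trans ?_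
  gcongr ENNReal.ofReal _ * ?_ + ENNReal.ofReal _ * ?_
  · refine le_of_eq (lintegral_congr fun t => ?_)
    rw [add_sub_cancel_right, ENNReal.mul_rpow_of_nonneg _ _ (by linarith)]
  · refine setLIntegral_mono' measurableSet_Ioc fun t ht => ?_
    have h1 : ENNReal.ofReal (1 - t) ^ (p + 1) ≤ ENNReal.ofReal (1 - t) ^ p :=
      ENNReal.rpow_le_rpow_of_exponent_ge (ENNReal.ofReal_le_one.2 (by linarith [ht.1]))
        (by linarith)
    refine (mul_le_mul_left h1 _).trans (le_of_eq ?_)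
    rw [← ENNReal.mul_rpow_sub_one hp.le, ENNReal.mul_rpow_of_nonneg _ _ (by linarith : 0 ≤ p - 1)]
    ring

/-- The fibre estimate with `k = p`, used in the direction opposite to `lintegral_trace_le`. The
integral on the left has one power of `1 - t` fewer than `|v|`, and it arises when the Sobolev
cutoff is differentiated. -/
theorem lintegral_cone_sub_one_le {p : ℝ} (hp : 1 < p) {D : ℝ≥0} (hv : LipschitzWith D v)
    (hc : HasCompactSupport v)
    (hd : ∀ᵐ x ∂(volume.restrict Ω), ∀ y, DifferentiableAt ℝ v (x, y)) :
    ENNReal.ofReal p * (∫⁻ q, (ENNReal.ofReal (1 - q.2) * ‖v (coneMap Ω q)‖ₑ) ^ (p - 1) *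
        ‖v (coneMap Ω q)‖ₑ ∂(coneMeasure Ω)) ≤
      (∫⁻ x in Ω, ‖v (x, 0)‖ₑ ^ p) +
      ENNReal.ofReal p * ∫⁻ q, ENNReal.ofReal (bdryDist Ω q.1) *
        ((ENNReal.ofReal (1 - q.2) * ‖fderiv ℝ v (coneMap Ω q)‖ₑ) *
          (ENNReal.ofReal (1 - q.2) * ‖v (coneMap Ω q)‖ₑ) ^ (p - 1)) ∂(coneMeasure Ω) := by
  have hmA := measurable_enorm_comp_coneMap (Ω := Ω) hv.continuous
  have hmB := measurable_enorm_fderiv_comp_coneMap (Ω := Ω) (v := v)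
  have hmw := measurable_ofReal_one_sub_snd (n := n)
  have hmd := measurable_ofReal_bdryDist_fst (Ω := Ω)
  have hm1 : Measurable fun q => (ENNReal.ofReal (1 - q.2) * ‖v (coneMap Ω q)‖ₑ) ^ (p - 1) *
        ‖v (coneMap Ω q)‖ₑ :=
    ((hmw.mul hmA).pow_const _).mul hmA
  have hm2 : Measurable fun q => ENNReal.ofReal (bdryDist Ω q.1) *
        ((ENNReal.ofReal (1 - q.2) * ‖fderiv ℝ v (coneMap Ω q)‖ₑ) *
          (ENNReal.ofReal (1 - q.2) * ‖v (coneMap Ω q)‖ₑ) ^ (p - 1)) :=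
    hmd.mul ((hmw.mul hmB).mul ((hmw.mul hmA).pow_const _))
  have hm3 : Measurable fun x => ‖v (x, 0)‖ₑ ^ p :=
    ((hv.continuous.comp (continuous_id.prodMk continuous_const)).measurable.enorm).pow_const _
  rw [lintegral_coneMeasure hm1, lintegral_coneMeasure hm2,
    ← lintegral_const_mul' _ _ ENNReal.ofReal_ne_top, ← lintegral_const_mul' _ _ ENNReal.ofReal_ne_top,
    ← lintegral_add_left hm3]
  refine lintegral_mono_ae ?_
  filter_upwards [hd] with x hx
  refine le_trans (le_of_eq ?_) ((fibre_le (Ω := Ω) hp hv hc hx (k := p) hp.le).1.trans (le_of_eq ?_))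
  · congr 1
    refine lintegral_congr fun t => ?_
    rw [ENNReal.mul_rpow_of_nonneg _ _ (by linarith), mul_assoc, mul_comm (‖_‖ₑ ^ _),
      ENNReal.mul_rpow_sub_one hp.le]
  · congr 2
    refine lintegral_congr fun t => ?_
    rw [← ENNReal.mul_rpow_sub_one hp.le, ENNReal.mul_rpow_of_nonneg _ _ (by linarith : 0 ≤ p - 1)]
    ring

/-- Weighted `L²` bound on the cone in terms of the trace and the gradient. -/
theorem lintegral_cone_sq_le {D : ℝ≥0} (hv : LipschitzWith D v)
    (hd : ∀ᵐ x ∂(volume.restrict Ω), ∀ y, DifferentiableAt ℝ v (x, y)) {R : ℝ≥0}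
    (hΩ : MeasurableSet Ω) (hR : ∀ x ∈ Ω, bdryDist Ω x ≤ R) :
    ∫⁻ q, ENNReal.ofReal (bdryDist Ω q.1) *
        (ENNReal.ofReal (1 - q.2) * ‖v (coneMap Ω q)‖ₑ) ^ (2 : ℝ) ∂(coneMeasure Ω) ≤
      (4 * (1 + R ^ 2) : ℝ≥0) * ((∫⁻ x in Ω, ENNReal.ofReal (bdryDist Ω x) * ‖v (x, 0)‖ₑ ^ (2 : ℝ)) +
        ∫⁻ q, ENNReal.ofReal (bdryDist Ω q.1) * ‖fderiv ℝ v (coneMap Ω q)‖ₑ ^ (2 : ℝ) ∂(coneMeasure Ω)) := by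
  have hmA := measurable_enorm_comp_coneMap (Ω := Ω) hv.continuous
  have hmB := measurable_enorm_fderiv_comp_coneMap (Ω := Ω) (v := v)
  have hmw := measurable_ofReal_one_sub_snd (n := n)
  have hmd := measurable_ofReal_bdryDist_fst (Ω := Ω)
  have hm1 : Measurable fun q => ENNReal.ofReal (bdryDist Ω q.1) *
        (ENNReal.ofReal (1 - q.2) * ‖v (coneMap Ω q)‖ₑ) ^ (2 : ℝ) :=
    hmd.mul ((hmw.mul hmA).pow_const _)
  have hm2 : Measurable fun q => ENNReal.ofReal (bdryDist Ω q.1) *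
        ‖fderiv ℝ v (coneMap Ω q)‖ₑ ^ (2 : ℝ) := hmd.mul (hmB.pow_const _)
  have hm3 : Measurable fun x => ENNReal.ofReal (bdryDist Ω x) * ‖v (x, 0)‖ₑ ^ (2 : ℝ) :=
    (continuous_bdryDist Ω).measurable.ennreal_ofReal.mul
    (((hv.continuous.comp (continuous_id.prodMk continuous_const)).measurable.enorm).pow_const _)
  rw [lintegral_coneMeasure hm1, lintegral_coneMeasure hm2, ← lintegral_add_left hm3,
    ← lintegral_const_mul' _ _ ENNReal.coe_ne_top]
  refine lintegral_mono_ae ?_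
  filter_upwards [hd, ae_restrict_mem hΩ] with x hx hxΩ
  set δ := ENNReal.ofReal (bdryDist Ω x) with hδ
  have hδR : δ ≤ R := by
    rw [hδ]
    exact ENNReal.ofReal_le_of_le_toReal (by simpa using hR x hxΩ)
  have hmB' : Measurable fun t => ‖fderiv ℝ v (coneMap Ω (x, t))‖ₑ := hmB.comp measurable_prodMk_left
  set J := ∫⁻ t in Ioc (0 : ℝ) 1, ‖fderiv ℝ v (coneMap Ω (x, t))‖ₑ ^ (2 : ℝ) with hJ
  have hCS : ∫⁻ t in Ioc (0 : ℝ) 1, ‖fderiv ℝ v (coneMap Ω (x, t))‖ₑ ≤ J ^ (1 / 2 : ℝ) := by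
    have := lintegral_weight_mul_mul_le (volume.restrict (Ioc (0 : ℝ) 1)) (w := fun _ => 1)
      (h := fun _ => 1) measurable_const measurable_const hmB'
    rw [hJ]
    simpa using this
  -- The fundamental theorem of calculus along the vertical fibre, followed by Cauchy–Schwarz. The
  -- factor `δ` is the speed of `t ↦ t d(x)`; squaring gives the `δ²` that the inner radius bound
  -- absorbs.
  have hpt : ∀ t ∈ Ioc (0 : ℝ) 1, ‖v (coneMap Ω (x, t))‖ₑ ≤
      ‖v (x, 0)‖ₑ + δ * J ^ (1 / 2 : ℝ) := by
    intro t ht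
    have hder : ∀ s, HasDerivAt (fun s => v (coneMap Ω (x, s)))
        (fderiv ℝ v (coneMap Ω (x, s)) (0, bdryDist Ω x)) s := fun s => by
      have h1 : HasDerivAt (fun t : ℝ => t * bdryDist Ω x) (bdryDist Ω x) s := by
        simpa using (hasDerivAt_id s).mul_const (bdryDist Ω x)
      exact HasFDerivAt.comp_hasDerivAt (f := fun s => coneMap Ω (x, s)) s
        (hx (s * bdryDist Ω x)).hasFDerivAt ((hasDerivAt_const s x).prodMk h1)
    have hle : ∀ s, ‖fderiv ℝ v (coneMap Ω (x, s)) (0, bdryDist Ω x)‖ ≤ D * bdryDist Ω x := fun s => by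
      refine ((fderiv ℝ v _).le_opNorm _).trans ?_
      rw [Prod.norm_def]
      simp only [norm_zero, Real.norm_of_nonneg (bdryDist_nonneg (Ω := Ω) x)]
      rw [max_eq_right (bdryDist_nonneg x)]
      gcongr
      · exact bdryDist_nonneg x
      · exact norm_fderiv_le_of_lipschitz ℝ hv
    have hi : IntervalIntegrable (fun s => fderiv ℝ v (coneMap Ω (x, s)) (0, bdryDist Ω x))
        volume 0 t := by
      have hb : IntervalIntegrable (fun _ : ℝ => (D : ℝ) * bdryDist Ω x) volume 0 t :=
        intervalIntegrable_const
      refine hb.mono_fun ?_ ?_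
      · exact ((measurable_fderiv_apply_const ℝ v _).comp ((continuous_coneMap Ω).measurable.comp
          measurable_prodMk_left)).aestronglyMeasurable
      · refine Filter.Eventually.of_forall fun s => (hle s).trans (le_abs_self _)
    have hFTC := intervalIntegral.integral_eq_sub_of_hasDerivAt (fun s _ => hder s) hi
    have h0 : v (coneMap Ω (x, 0)) = v (x, 0) := by simp [coneMap]
    rw [h0, intervalIntegral.integral_of_le ht.1.le] at hFTC
    have h1 : v (coneMap Ω (x, t)) = v (x, 0) +
        ∫ s in Ioc 0 t, fderiv ℝ v (coneMap Ω (x, s)) (0, bdryDist Ω x) := by rw [hFTC]; ring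
    rw [h1]
    refine (enorm_add_le _ _).trans ?_
    gcongr
    refine (enorm_integral_le_lintegral_enorm _).trans ?_
    calc ∫⁻ s in Ioc 0 t, ‖fderiv ℝ v (coneMap Ω (x, s)) (0, bdryDist Ω x)‖ₑ
        ≤ ∫⁻ s in Ioc 0 t, δ * ‖fderiv ℝ v (coneMap Ω (x, s))‖ₑ := by
          refine lintegral_mono fun s => ?_
          rw [← ofReal_norm, ← ofReal_norm, hδ, ← ENNReal.ofReal_mul (bdryDist_nonneg x)]
          refine ENNReal.ofReal_le_ofReal (((fderiv ℝ v _).le_opNorm _).trans_eq ?_)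
          rw [Prod.norm_def]
          simp [abs_of_nonneg (bdryDist_nonneg x), bdryDist_nonneg x, mul_comm]
      _ ≤ ∫⁻ s in Ioc (0 : ℝ) 1, δ * ‖fderiv ℝ v (coneMap Ω (x, s))‖ₑ :=
          lintegral_mono_set (Ioc_subset_Ioc_right ht.2)
      _ ≤ δ * J ^ (1 / 2 : ℝ) := by
          rw [lintegral_const_mul _ hmB']
          gcongr
  have hsq : ∀ a b : ENNReal, (a + b) ^ (2 : ℝ) ≤ 4 * (a ^ (2 : ℝ) + b ^ (2 : ℝ)) := fun a b => by
    have h4 : ((2 : ENNReal) ^ (2 : ℝ)) = 4 := by norm_num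
    rcases le_total a b with h | h
    · calc (a + b) ^ (2 : ℝ) ≤ (2 * b) ^ (2 : ℝ) := by rw [two_mul]; gcongr
        _ = 4 * b ^ (2 : ℝ) := by rw [ENNReal.mul_rpow_of_nonneg _ _ zero_le_two, h4]
        _ ≤ _ := by gcongr; exact le_add_self
    · calc (a + b) ^ (2 : ℝ) ≤ (2 * a) ^ (2 : ℝ) := by rw [two_mul]; gcongr
        _ = 4 * a ^ (2 : ℝ) := by rw [ENNReal.mul_rpow_of_nonneg _ _ zero_le_two, h4]
        _ ≤ _ := by gcongr; exact le_self_add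
  have hJ2 : (J ^ (1 / 2 : ℝ)) ^ (2 : ℝ) = J := by
    rw [← ENNReal.rpow_mul]; norm_num
  have hmB2 : Measurable fun t => ‖fderiv ℝ v (coneMap Ω (x, t))‖ₑ ^ (2 : ℝ) := hmB'.pow_const _
  rw [lintegral_const_mul δ hmB2]
  calc ∫⁻ t in Ioc (0 : ℝ) 1, δ * (ENNReal.ofReal (1 - t) * ‖v (coneMap Ω (x, t))‖ₑ) ^ (2 : ℝ)
      ≤ ∫⁻ t in Ioc (0 : ℝ) 1, δ * (‖v (x, 0)‖ₑ + δ * J ^ (1 / 2 : ℝ)) ^ (2 : ℝ) := by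
        refine setLIntegral_mono' measurableSet_Ioc fun t ht => ?_
        gcongr
        refine (mul_le_of_le_one_left zero_le ?_).trans (hpt t ht)
        exact ENNReal.ofReal_le_one.2 (by linarith [ht.1])
    _ = δ * (‖v (x, 0)‖ₑ + δ * J ^ (1 / 2 : ℝ)) ^ (2 : ℝ) := by simp
    _ ≤ δ * (4 * (‖v (x, 0)‖ₑ ^ (2 : ℝ) + δ ^ (2 : ℝ) * J)) := by
        gcongr
        refine (hsq _ _).trans ?_
        rw [ENNReal.mul_rpow_of_nonneg δ _ zero_le_two, hJ2]
    _ ≤ δ * (4 * ((1 + R ^ 2 : ℝ≥0) * ‖v (x, 0)‖ₑ ^ (2 : ℝ) + (1 + R ^ 2 : ℝ≥0) * J)) := by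
        gcongr
        · refine le_mul_of_one_le_left zero_le ?_
          exact_mod_cast le_self_add
        · rw [ENNReal.rpow_two]
          push_cast
          exact (pow_le_pow_left' hδR 2).trans le_add_self
    _ = _ := by push_cast; ring

end cone

theorem bdryDist_pos {n : ℕ} {Ω : Set (EuclideanSpace ℝ (Fin n))} (hΩ : IsOpen Ω)
    (hne : (frontier Ω).Nonempty) {x : EuclideanSpace ℝ (Fin n)} (hx : x ∈ Ω) :
    0 < bdryDist Ω x := by
  refine (isClosed_frontier.notMem_iff_infDist_pos hne).1 fun h => ?_
  rw [hΩ.frontier_eq] at h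
  exact h.2 hx

/-! ### The Sobolev inequality on the cone -/

section coneCutoff

open Topology Filter

variable {n : ℕ} {Ω : Set (EuclideanSpace ℝ (Fin n))} {v : EuclideanSpace ℝ (Fin n) × ℝ → ℝ}

/-- The function `(1 - y / d(x))₊ v(x, y)`. -/
noncomputable def coneCutoff (Ω : Set (EuclideanSpace ℝ (Fin n)))
    (v : EuclideanSpace ℝ (Fin n) × ℝ → ℝ) (q : EuclideanSpace ℝ (Fin n) × ℝ) : ℝ :=
  max 0 (1 - q.2 * (bdryDist Ω q.1)⁻¹) * v q

theorem tsupport_coneCutoff_subset : tsupport (coneCutoff Ω v) ⊆ tsupport v := by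
  refine closure_mono fun q hq => ?_
  exact right_ne_zero_of_mul hq

theorem exists_lipschitzWith_coneCutoff (hΩ : IsOpen Ω) (hne : (frontier Ω).Nonempty) {D : ℝ≥0}
    (hv : LipschitzWith D v) (hc : HasCompactSupport v) (hs : tsupport v ⊆ Ω ×ˢ univ) :
    ∃ D', LipschitzWith D' (coneCutoff Ω v) := by
  have hO : IsOpen (Ω ×ˢ (univ : Set ℝ)) := hΩ.prod isOpen_univ
  refine LocallyLipschitzOn.exists_lipschitzWith_of_hasCompactSupport hO ?_
    (hc.of_isClosed_subset (isClosed_tsupport _) tsupport_coneCutoff_subset)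
    (tsupport_coneCutoff_subset.trans hs)
  have h1 : LocallyLipschitzOn (Ω ×ˢ (univ : Set ℝ))
      fun q : EuclideanSpace ℝ (Fin n) × ℝ => (bdryDist Ω q.1, q.2) :=
    ((((lipschitzWith_bdryDist Ω).comp LipschitzWith.prod_fst).locallyLipschitz.prodMk
      LipschitzWith.prod_snd.locallyLipschitz)).locallyLipschitzOn
  have h2 : LocallyLipschitzOn (Ω ×ˢ (univ : Set ℝ))
      fun q : EuclideanSpace ℝ (Fin n) × ℝ => 1 - q.2 * (bdryDist Ω q.1)⁻¹ := by
    refine h1.comp_of_forall (G := fun z : ℝ × ℝ => 1 - z.2 * z.1⁻¹) fun q hq => ?_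
    have hd : bdryDist Ω q.1 ≠ 0 := (bdryDist_pos hΩ hne hq.1).ne'
    have : ContDiffAt ℝ 1 (fun z : ℝ × ℝ => 1 - z.2 * z.1⁻¹) (bdryDist Ω q.1, q.2) :=
      contDiffAt_const.sub (contDiffAt_snd.mul (contDiffAt_fst.inv hd))
    exact this.exists_lipschitzOnWith
  have h3 := h2.prodMk (hv.locallyLipschitz.locallyLipschitzOn (s := Ω ×ˢ (univ : Set ℝ)))
  refine h3.comp_of_forall (G := fun z : ℝ × ℝ => max 0 z.1 * z.2) fun q _ => ?_
  have h4 : LocallyLipschitz fun z : ℝ × ℝ => (max 0 z.1, z.2) :=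
    (LocallyLipschitz.const_max LipschitzWith.prod_fst.locallyLipschitz 0).prodMk
      LipschitzWith.prod_snd.locallyLipschitz
  have h5 : LocallyLipschitz fun z : ℝ × ℝ => z.1 * z.2 :=
    (contDiff_fst.mul contDiff_snd : ContDiff ℝ 1 fun z : ℝ × ℝ => z.1 * z.2).locallyLipschitz
  exact (h5.comp h4) _

/-- Product rule: the gradient of `1 - y/d` has norm at most `(y/d²)|∇d| + 1/d`, and this is at most
`2/d` because `y < d` and `|∇d| ≤ 1`. -/
theorem enorm_fderiv_coneCutoff_le (hΩ : IsOpen Ω) (hne : (frontier Ω).Nonempty)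
    {x : EuclideanSpace ℝ (Fin n)} (hx : x ∈ Ω) {y : ℝ} (hy : y ∈ Ioo 0 (bdryDist Ω x))
    (hd : DifferentiableAt ℝ (bdryDist Ω) x) (hv : DifferentiableAt ℝ v (x, y)) :
    DifferentiableAt ℝ (coneCutoff Ω v) (x, y) ∧
    ‖fderiv ℝ (coneCutoff Ω v) (x, y)‖ₑ ≤
      ENNReal.ofReal (1 - y * (bdryDist Ω x)⁻¹) * ‖fderiv ℝ v (x, y)‖ₑ +
        2 * (ENNReal.ofReal (bdryDist Ω x))⁻¹ * ‖v (x, y)‖ₑ := by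
  have hd0 := bdryDist_pos hΩ hne hx
  have hpos : 0 < 1 - y * (bdryDist Ω x)⁻¹ := by
    rw [sub_pos, ← div_eq_mul_inv, div_lt_one hd0]; exact hy.2
  have hc : Continuous fun q : EuclideanSpace ℝ (Fin n) × ℝ => bdryDist Ω q.1 :=
    (continuous_bdryDist Ω).comp continuous_fst
  have hev : coneCutoff Ω v =ᶠ[𝓝 (x, y)] fun q => (1 - q.2 * (bdryDist Ω q.1)⁻¹) * v q := by
    have h1 : ContinuousAt (fun q : EuclideanSpace ℝ (Fin n) × ℝ => 1 - q.2 * (bdryDist Ω q.1)⁻¹)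
        (x, y) := continuousAt_const.sub (continuousAt_snd.mul (hc.continuousAt.inv₀ hd0.ne'))
    filter_upwards [h1.eventually (lt_mem_nhds hpos)] with q hq
    rw [coneCutoff, max_eq_right hq.le]
  have hfst : HasFDerivAt (fun q : EuclideanSpace ℝ (Fin n) × ℝ => bdryDist Ω q.1)
      ((fderiv ℝ (bdryDist Ω) x).comp (ContinuousLinearMap.fst ℝ _ _)) (x, y) :=
    HasFDerivAt.comp (g := bdryDist Ω) (x, y) hd.hasFDerivAt hasFDerivAt_fst
  have hinv : HasFDerivAt (fun q : EuclideanSpace ℝ (Fin n) × ℝ => (bdryDist Ω q.1)⁻¹)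
      ((-((bdryDist Ω x) ^ 2)⁻¹) • ((fderiv ℝ (bdryDist Ω) x).comp (ContinuousLinearMap.fst ℝ _ _)))
      (x, y) := (hasDerivAt_inv hd0.ne').comp_hasFDerivAt (x, y) hfst
  have hmul := ((hasFDerivAt_snd (p := (x, y)) (𝕜 := ℝ) (E := EuclideanSpace ℝ (Fin n)) (F := ℝ)
    ).mul hinv).const_sub 1
  have hprod := hmul.mul hv.hasFDerivAt
  refine ⟨(hprod.congr_of_eventuallyEq hev).differentiableAt, ?_⟩
  rw [(hprod.congr_of_eventuallyEq hev).fderiv]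
  set δ := bdryDist Ω x
  have h1 : ‖(fderiv ℝ (bdryDist Ω) x).comp
      (ContinuousLinearMap.fst ℝ (EuclideanSpace ℝ (Fin n)) ℝ)‖ ≤ 1 := by
    refine (ContinuousLinearMap.opNorm_comp_le _ _).trans ?_
    refine mul_le_one₀ ?_ (norm_nonneg _) (ContinuousLinearMap.norm_fst_le _ _ _)
    exact norm_fderiv_le_of_lipschitz ℝ (lipschitzWith_bdryDist Ω)
  have h2 : ‖ContinuousLinearMap.snd ℝ (EuclideanSpace ℝ (Fin n)) ℝ‖ ≤ 1 :=
    ContinuousLinearMap.norm_snd_le _ _ _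
  have h3 : ‖y • (-(δ ^ 2)⁻¹ • (fderiv ℝ (bdryDist Ω) x).comp
        (ContinuousLinearMap.fst ℝ (EuclideanSpace ℝ (Fin n)) ℝ)) +
        δ⁻¹ • ContinuousLinearMap.snd ℝ (EuclideanSpace ℝ (Fin n)) ℝ‖ ≤ 2 * δ⁻¹ := by
    refine (norm_add_le _ _).trans ?_
    rw [norm_smul, norm_smul, norm_smul, norm_neg, norm_inv, norm_pow, norm_inv,
      Real.norm_of_nonneg hd0.le, Real.norm_of_nonneg hy.1.le]
    have h4 : y * ((δ ^ 2)⁻¹ * 1) ≤ δ⁻¹ := by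
      rw [mul_one, ← div_eq_mul_inv, div_le_iff₀ (by positivity)]
      have : δ⁻¹ * δ ^ 2 = δ := by field_simp
      rw [this]; exact hy.2.le
    have h5 : y * ((δ ^ 2)⁻¹ * ‖(fderiv ℝ (bdryDist Ω) x).comp
      (ContinuousLinearMap.fst ℝ (EuclideanSpace ℝ (Fin n)) ℝ)‖) ≤ y * ((δ ^ 2)⁻¹ * 1) := by
      have := hy.1.le
      gcongr
    have h6 : δ⁻¹ * ‖ContinuousLinearMap.snd ℝ (EuclideanSpace ℝ (Fin n)) ℝ‖ ≤ δ⁻¹ * 1 := by gcongr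
    linarith
  have h7 : 2 * (ENNReal.ofReal δ)⁻¹ * ENNReal.ofReal ‖v (x, y)‖ =
      ENNReal.ofReal (2 * δ⁻¹ * ‖v (x, y)‖) := by
    rw [ENNReal.ofReal_mul (by positivity), ENNReal.ofReal_mul (by norm_num),
      ENNReal.ofReal_inv_of_pos hd0, ENNReal.ofReal_ofNat]
  rw [← ofReal_norm, ← ofReal_norm, ← ofReal_norm, ← ENNReal.ofReal_mul hpos.le, h7,
    ← ENNReal.ofReal_add (by positivity) (by positivity)]
  refine ENNReal.ofReal_le_ofReal ((norm_add_le _ _).trans ?_)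
  rw [norm_smul, norm_smul, norm_neg, mul_comm ‖v (x, y)‖]
  refine add_le_add (mul_le_mul_of_nonneg_right ?_ (norm_nonneg _))
    (mul_le_mul_of_nonneg_right h3 (norm_nonneg _))
  exact (Real.norm_of_nonneg hpos.le).le

/-- Sobolev inequality on the cone `{0 < y < d(x)}`. -/
theorem exists_lintegral_cone_sobolev (hn : 2 ≤ n) (hΩ : IsOpen Ω) (hne : (frontier Ω).Nonempty)
    {p : ℝ} (hp : p = 2 * (n : ℝ) / ((n : ℝ) - 1)) : ∃ C : ℝ≥0,
    ∀ (v : EuclideanSpace ℝ (Fin n) × ℝ → ℝ) (D : ℝ≥0), LipschitzWith D v → HasCompactSupport v →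
      tsupport v ⊆ Ω ×ˢ univ → (∀ᵐ x ∂(volume.restrict Ω), ∀ y, DifferentiableAt ℝ v (x, y)) →
    ∫⁻ q, ENNReal.ofReal (bdryDist Ω q.1) *
      ((ENNReal.ofReal (1 - q.2) * ‖v (coneMap Ω q)‖ₑ) ^ (p - 1)) ^ (2 : ℝ) ∂(coneMeasure Ω) ≤
      C * (ENNReal.ofReal p * (∫⁻ q, ENNReal.ofReal (bdryDist Ω q.1) *
        ((ENNReal.ofReal (1 - q.2) * ‖fderiv ℝ v (coneMap Ω q)‖ₑ) *
          (ENNReal.ofReal (1 - q.2) * ‖v (coneMap Ω q)‖ₑ) ^ (p - 1)) ∂(coneMeasure Ω)) +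
        2 * (ENNReal.ofReal p * ∫⁻ q, (ENNReal.ofReal (1 - q.2) * ‖v (coneMap Ω q)‖ₑ) ^ (p - 1) *
        ‖v (coneMap Ω q)‖ₑ ∂(coneMeasure Ω))) ^ (((n : ℝ) + 1) / n) := by
  have hn' : (2 : ℝ) ≤ n := by exact_mod_cast hn
  have hn1 : (0 : ℝ) < (n : ℝ) - 1 := by linarith
  have hp1 : 1 < p := by rw [hp, lt_div_iff₀ hn1]; linarith
  have hp0 : 0 ≤ p := by linarith
  set r : ℝ := ((n : ℝ) + 1) / n with hr
  have hr0 : 0 ≤ r := by positivity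
  -- The critical exponent enters here: the Sobolev power of `|v|^p` in dimension `n + 1` is exactly
  -- the square of the `|v|^(p-1)` that appears in the Cauchy–Schwarz step.
  have hpr : p * r = (p - 1) * 2 := by rw [hp, hr]; field_simp; ring
  have hconj : Real.HolderConjugate
      (Module.finrank ℝ (EuclideanSpace ℝ (Fin n) × ℝ) : ℝ) r := by
    have : Module.finrank ℝ (EuclideanSpace ℝ (Fin n) × ℝ) = n + 1 := by simp
    rw [this, Real.holderConjugate_iff]
    push_cast
    refine ⟨by linarith, ?_⟩
    rw [hr]; field_simp; ring
  obtain ⟨C, hC⟩ := LipschitzWith.lintegral_halfSpace_pow_le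
    (volume : Measure (EuclideanSpace ℝ (Fin n))) hconj
  refine ⟨C, fun v D hv hc hs hd => ?_⟩
  obtain ⟨D', hD'⟩ := exists_lipschitzWith_coneCutoff hΩ hne hv hc hs
  have hsc : HasCompactSupport (coneCutoff Ω v) :=
    hc.of_isClosed_subset (isClosed_tsupport _) tsupport_coneCutoff_subset
  obtain ⟨M, hM⟩ := hD'.continuous.bounded_above_of_compact_support hsc
  obtain ⟨D'', hg⟩ := hD'.exists_norm_rpow hM hp1
  set g : EuclideanSpace ℝ (Fin n) × ℝ → ℝ := fun q => ‖coneCutoff Ω v q‖ ^ p with hgdef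
  have hgc : HasCompactSupport g :=
    hsc.comp_left (g := fun a : ℝ => ‖a‖ ^ p) (by simp [Real.zero_rpow (by linarith : p ≠ 0)])
  have hgsupp : tsupport g ⊆ Ω ×ˢ univ := by
    refine Subset.trans (closure_mono (t := Function.support (coneCutoff Ω v)) fun q hq => ?_)
      (tsupport_coneCutoff_subset.trans hs)
    intro h
    apply hq
    simp [hgdef, h, Real.zero_rpow (by linarith : p ≠ 0)]
  have key := hC g D'' hg hgc
  have hres : (volume.prod (volume : Measure ℝ)).restrict
      ((univ : Set (EuclideanSpace ℝ (Fin n))) ×ˢ Ioi (0 : ℝ)) =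
      volume.prod (volume.restrict (Ioi 0)) := by
    rw [← Measure.prod_restrict, Measure.restrict_univ]
  rw [hres, lintegral_prod _ (by exact (hg.continuous.measurable.enorm.pow_const r).aemeasurable),
    lintegral_prod _ (by exact (measurable_fderiv ℝ g).enorm.aemeasurable)] at key
  have hmA := measurable_enorm_comp_coneMap (Ω := Ω) hv.continuous
  have hmB := measurable_enorm_fderiv_comp_coneMap (Ω := Ω) (v := v)
  have hmw := measurable_ofReal_one_sub_snd (n := n)
  have hmd := measurable_ofReal_bdryDist_fst (Ω := Ω)
  have hm1 : Measurable fun q => (ENNReal.ofReal (1 - q.2) * ‖v (coneMap Ω q)‖ₑ) ^ (p - 1) *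
        ‖v (coneMap Ω q)‖ₑ :=
    ((hmw.mul hmA).pow_const _).mul hmA
  have hm2 : Measurable fun q => ENNReal.ofReal (bdryDist Ω q.1) *
        ((ENNReal.ofReal (1 - q.2) * ‖fderiv ℝ v (coneMap Ω q)‖ₑ) *
          (ENNReal.ofReal (1 - q.2) * ‖v (coneMap Ω q)‖ₑ) ^ (p - 1)) :=
    hmd.mul ((hmw.mul hmB).mul ((hmw.mul hmA).pow_const _))
  have hm3 : Measurable fun q => ENNReal.ofReal (bdryDist Ω q.1) *
      ((ENNReal.ofReal (1 - q.2) * ‖v (coneMap Ω q)‖ₑ) ^ (p - 1)) ^ (2 : ℝ) :=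
    hmd.mul (((hmw.mul hmA).pow_const _).pow_const _)
  have hcut : ∀ x ∈ Ω, ∀ t ∈ Ioc (0 : ℝ) 1, ‖coneCutoff Ω v (coneMap Ω (x, t))‖ₑ =
      ENNReal.ofReal (1 - t) * ‖v (coneMap Ω (x, t))‖ₑ := by
    intro x hx t ht
    have hd0 := bdryDist_pos hΩ hne hx
    have h1 : (1 : ℝ) - t * bdryDist Ω x * (bdryDist Ω x)⁻¹ = 1 - t := by field_simp
    rw [coneCutoff, enorm_mul]
    congr 1
    simp only [coneMap]
    rw [h1, max_eq_right (by linarith [ht.2]), Real.enorm_of_nonneg (by linarith [ht.2])]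
  have hgn : ∀ q, ‖g q‖ₑ = ‖coneCutoff Ω v q‖ₑ ^ p := fun q => by
    rw [← ofReal_norm (coneCutoff Ω v q), ENNReal.ofReal_rpow_of_nonneg (norm_nonneg _) hp0,
      Real.enorm_of_nonneg (by positivity)]
  have hleft : ∫⁻ q, ENNReal.ofReal (bdryDist Ω q.1) *
      ((ENNReal.ofReal (1 - q.2) * ‖v (coneMap Ω q)‖ₑ) ^ (p - 1)) ^ (2 : ℝ) ∂(coneMeasure Ω) ≤
      ∫⁻ x, ∫⁻ y in Ioi 0, ‖g (x, y)‖ₑ ^ r := by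
    rw [lintegral_coneMeasure hm3]
    refine le_trans ?_ (setLIntegral_le_lintegral Ω _)
    refine setLIntegral_mono' hΩ.measurableSet fun x hx => ?_
    have hd0 := bdryDist_pos hΩ hne hx
    refine le_trans (le_of_eq ?_) (lintegral_mono_set
      (fun y hy => hy.1 : Ioc 0 (bdryDist Ω x) ⊆ Ioi 0))
    rw [setLIntegral_Ioc_eq_mul hd0, ← lintegral_const_mul' _ _ ENNReal.ofReal_ne_top]
    refine setLIntegral_congr_fun measurableSet_Ioc fun t ht => ?_
    have h1 := hcut x hx t ht
    simp only [coneMap] at h1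
    simp only [coneMap, hgn, h1]
    rw [← ENNReal.rpow_mul, ← ENNReal.rpow_mul, hpr]
  -- The cutoff vanishes for `y > d(x)`, so only the cone contributes. No condition is imposed at `y
  -- = 0`, which is why the half-space form of the Sobolev inequality is needed.
  have hright : ∫⁻ x, ∫⁻ y in Ioi 0, ‖fderiv ℝ g (x, y)‖ₑ ≤
      ENNReal.ofReal p * (∫⁻ q, ENNReal.ofReal (bdryDist Ω q.1) *
        ((ENNReal.ofReal (1 - q.2) * ‖fderiv ℝ v (coneMap Ω q)‖ₑ) *
          (ENNReal.ofReal (1 - q.2) * ‖v (coneMap Ω q)‖ₑ) ^ (p - 1)) ∂(coneMeasure Ω)) +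
        2 * (ENNReal.ofReal p * ∫⁻ q, (ENNReal.ofReal (1 - q.2) * ‖v (coneMap Ω q)‖ₑ) ^ (p - 1) *
        ‖v (coneMap Ω q)‖ₑ ∂(coneMeasure Ω)) := by
    have h0 : ∫⁻ x, ∫⁻ y in Ioi 0, ‖fderiv ℝ g (x, y)‖ₑ =
        ∫⁻ x in Ω, ∫⁻ y in Ioi 0, ‖fderiv ℝ g (x, y)‖ₑ := by
      rw [← lintegral_indicator hΩ.measurableSet]
      refine lintegral_congr fun x => ?_
      by_cases hx : x ∈ Ω
      · rw [indicator_of_mem hx]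
      · rw [indicator_of_notMem hx]
        have : ∀ y, ‖fderiv ℝ g (x, y)‖ₑ = 0 := fun y => by
          have h : fderiv ℝ g (x, y) = 0 := by
            by_contra h
            exact hx (hgsupp (support_fderiv_subset ℝ h)).1
          rw [enorm_eq_nnnorm, h, nnnorm_zero]; rfl
        simp [this]
    rw [h0, lintegral_coneMeasure hm1, lintegral_coneMeasure hm2,
      ← lintegral_const_mul' _ _ ENNReal.ofReal_ne_top,
      ← lintegral_const_mul' _ _ ENNReal.ofReal_ne_top,
      ← lintegral_const_mul' _ _ ENNReal.ofNat_ne_top,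
      ← lintegral_add_left (by exact (hm2.lintegral_prod_right').const_mul _)]
    refine lintegral_mono_ae ?_
    filter_upwards [hd, ae_restrict_mem hΩ.measurableSet,
      ae_restrict_of_ae ((lipschitzWith_bdryDist Ω).ae_differentiableAt (μ := volume))]
      with x hx hxΩ hxd
    have hd0 := bdryDist_pos hΩ hne hxΩ
    have hsplit : Ioi (0 : ℝ) = Ioc 0 (bdryDist Ω x) ∪ Ioi (bdryDist Ω x) :=
      (Ioc_union_Ioi_eq_Ioi hd0.le).symm
    have hfar : ∫⁻ y in Ioi (bdryDist Ω x), ‖fderiv ℝ g (x, y)‖ₑ = 0 := by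
      rw [setLIntegral_congr_fun (g := fun _ => 0) measurableSet_Ioi, lintegral_zero]
      intro y hy
      have hev : g =ᶠ[𝓝 (x, y)] fun _ => 0 := by
        have h1 : ContinuousAt (fun q : EuclideanSpace ℝ (Fin n) × ℝ => 1 - q.2 * (bdryDist Ω q.1)⁻¹)
            (x, y) := continuousAt_const.sub (continuousAt_snd.mul
              (((continuous_bdryDist Ω).comp continuous_fst).continuousAt.inv₀ hd0.ne'))
        have h2 : 1 - y * (bdryDist Ω x)⁻¹ < 0 := by
          rw [sub_neg, ← div_eq_mul_inv, one_lt_div hd0]; exact hy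
        filter_upwards [h1.eventually (gt_mem_nhds h2)] with q hq
        simp [hgdef, coneCutoff, max_eq_left hq.le, Real.zero_rpow (by linarith : p ≠ 0)]
      beta_reduce
      rw [enorm_eq_nnnorm, hev.fderiv_eq, fderiv_fun_const, Pi.zero_apply, nnnorm_zero]; rfl
    have hB : ∀ y ∈ Ioo 0 (bdryDist Ω x), ‖fderiv ℝ g (x, y)‖ₑ ≤ ENNReal.ofReal p *
        ‖coneCutoff Ω v (x, y)‖ₑ ^ (p - 1) *
        (ENNReal.ofReal (1 - y * (bdryDist Ω x)⁻¹) * ‖fderiv ℝ v (x, y)‖ₑ +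
        2 * (ENNReal.ofReal (bdryDist Ω x))⁻¹ * ‖v (x, y)‖ₑ) := by
      intro y hy
      obtain ⟨h1, h2⟩ := enorm_fderiv_coneCutoff_le hΩ hne hxΩ hy hxd (hx y)
      exact (enorm_fderiv_norm_rpow_comp_le hp1 h1).trans (mul_le_mul_right h2 _)
    rw [hsplit]
    refine (lintegral_union_le _ _ _).trans ?_
    rw [hfar, add_zero, ← restrict_Ioo_eq_restrict_Ioc]
    refine (setLIntegral_mono' measurableSet_Ioo hB).trans ?_
    rw [restrict_Ioo_eq_restrict_Ioc, setLIntegral_Ioc_eq_mul hd0,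
      ← lintegral_const_mul' _ _ ENNReal.ofReal_ne_top,
      ← lintegral_const_mul' _ _ ENNReal.ofReal_ne_top,
      ← lintegral_const_mul' _ _ ENNReal.ofReal_ne_top,
      ← lintegral_const_mul' _ _ ENNReal.ofNat_ne_top,
      ← lintegral_add_left (by exact (hm2.comp measurable_prodMk_left).const_mul _)]
    refine setLIntegral_mono' measurableSet_Ioc fun t ht => ?_
    have h1 := hcut x hxΩ t ht
    have h2 : (1 : ℝ) - t * bdryDist Ω x * (bdryDist Ω x)⁻¹ = 1 - t := by field_simp
    have h3 : ENNReal.ofReal (bdryDist Ω x) * (ENNReal.ofReal (bdryDist Ω x))⁻¹ = 1 :=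
      ENNReal.mul_inv_cancel (by simpa using hd0) ENNReal.ofReal_ne_top
    simp only [coneMap] at h1 ⊢
    rw [h1, h2]
    set A := ‖v (x, t * bdryDist Ω x)‖ₑ
    set B := ‖fderiv ℝ v (x, t * bdryDist Ω x)‖ₑ
    set δ := ENNReal.ofReal (bdryDist Ω x)
    set w := ENNReal.ofReal (1 - t)
    -- The Jacobian `d` of `y = t d(x)` cancels the `1/d` from differentiating the cutoff, so the
    -- second integral carries no distance weight.
    refine le_of_eq ?_
    calc δ * (ENNReal.ofReal p * (w * A) ^ (p - 1) * (w * B + 2 * δ⁻¹ * A))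
        = ENNReal.ofReal p * (δ * (w * B * (w * A) ^ (p - 1))) +
          2 * (ENNReal.ofReal p * ((w * A) ^ (p - 1) * A)) * (δ * δ⁻¹) := by ring
      _ = _ := by rw [h3, mul_one]
  calc _ ≤ _ := hleft
    _ ≤ _ := key
    _ ≤ _ := by gcongr

end coneCutoff

/-! ### Closing the estimates: the trace Sobolev inequality for the quotient -/

/-- Since `e² = G I ≤ b G e^r` and `r + s = 2`, cancelling `e^r` leaves `e^s ≤ b G`, and `T ≤ a e`
finishes. The cancellation requires `e` to be finite, hence the hypothesis on `I`. -/
theorem ENNReal.rpow_le_of_le_mul_rpow {a b : ℝ≥0} {r s : ℝ} (hs : 0 < s) (hr : 0 ≤ r)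
    (hrs : r + s = 2) {G e I T : ENNReal} (hT : T ≤ a * e) (hI : I ≤ b * e ^ r)
    (he : e = G ^ (1 / 2 : ℝ) * I ^ (1 / 2 : ℝ)) (hI' : I ≠ ⊤) :
    T ^ s ≤ ((a + 1) ^ s * (b + 1) : ℝ≥0) * G := by
  have ha0 : a + 1 ≠ 0 := by positivity
  rcases eq_or_ne G ⊤ with hG | hG
  · rw [hG, ENNReal.mul_top]
    · exact le_top
    · exact ENNReal.coe_ne_zero.2 (by positivity)
  rcases eq_or_ne e 0 with h0 | h0
  · rw [h0, mul_zero, nonpos_iff_eq_zero] at hT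
    rw [hT, ENNReal.zero_rpow_of_pos hs]
    exact zero_le
  have htop : e ≠ ⊤ := by
    rw [he]
    exact ENNReal.mul_ne_top (ENNReal.rpow_ne_top_of_nonneg (by norm_num) hG)
      (ENNReal.rpow_ne_top_of_nonneg (by norm_num) hI')
  have hsq : e ^ r * e ^ s = G * I := by
    rw [← ENNReal.rpow_add_of_nonneg _ _ hr hs.le, hrs, he,
      ENNReal.mul_rpow_of_nonneg _ _ (zero_le_two : (0 : ℝ) ≤ 2), ← ENNReal.rpow_mul,
      ← ENNReal.rpow_mul]
    norm_num
  have h1 : e ^ r * e ^ s ≤ e ^ r * (b * G) := by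
    rw [hsq]
    calc G * I ≤ G * (b * e ^ r) := by gcongr
      _ = _ := by ring
  have h2 : e ^ s ≤ b * G := by
    rwa [ENNReal.mul_le_mul_iff_right] at h1
    · exact (ENNReal.rpow_pos (pos_iff_ne_zero.2 h0) htop).ne'
    · exact ENNReal.rpow_ne_top_of_nonneg hr htop
  calc T ^ s ≤ (a * e) ^ s := by gcongr
    _ = (a : ENNReal) ^ s * e ^ s := ENNReal.mul_rpow_of_nonneg _ _ hs.le
    _ ≤ ((a + 1 : ℝ≥0) : ENNReal) ^ s * (((b + 1 : ℝ≥0) : ENNReal) * G) := by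
        refine mul_le_mul' (ENNReal.rpow_le_rpow (by simp) hs.le) (h2.trans ?_)
        gcongr
        simp
    _ = _ := by
        rw [ENNReal.coe_mul, ENNReal.coe_rpow_of_nonneg _ hs.le, mul_assoc]

section coneTrace

variable {n : ℕ} {Ω : Set (EuclideanSpace ℝ (Fin n))} {v : EuclideanSpace ℝ (Fin n) × ℝ → ℝ}

/-- A qualitative bound that depends on `v`. It serves only to justify the cancellation in
`ENNReal.rpow_le_of_le_mul_rpow` and does not enter any constant. -/
theorem lintegral_cone_rpow_ne_top (hΩ : MeasurableSet Ω) {R : ℝ≥0}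
    (hR : ∀ x ∈ Ω, bdryDist Ω x ≤ R) (hv : Continuous v) (hc : HasCompactSupport v) {p : ℝ}
    (hp : 1 < p) :
    ∫⁻ q, ENNReal.ofReal (bdryDist Ω q.1) *
      ((ENNReal.ofReal (1 - q.2) * ‖v (coneMap Ω q)‖ₑ) ^ (p - 1)) ^ (2 : ℝ) ∂(coneMeasure Ω) ≠ ⊤ := by
  have hmA := measurable_enorm_comp_coneMap (Ω := Ω) hv
  have hmw := measurable_ofReal_one_sub_snd (n := n)
  have hmd := measurable_ofReal_bdryDist_fst (Ω := Ω)
  have hp0 : 0 < p - 1 := by linarith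
  obtain ⟨M, hM⟩ := hv.bounded_above_of_compact_support hc
  have hK : IsCompact (Prod.fst '' tsupport v) := hc.isCompact.image continuous_fst
  rw [lintegral_coneMeasure (by exact hmd.mul (((hmw.mul hmA).pow_const _).pow_const _))]
  set c : ENNReal := R * (ENNReal.ofReal M ^ (p - 1)) ^ (2 : ℝ) with hcdef
  have hctop : c ≠ ⊤ := ENNReal.mul_ne_top ENNReal.coe_ne_top
    (ENNReal.rpow_ne_top_of_nonneg (by norm_num)
      (ENNReal.rpow_ne_top_of_nonneg hp0.le ENNReal.ofReal_ne_top))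
  refine ne_top_of_le_ne_top (b := ∫⁻ x in Ω, (Prod.fst '' tsupport v).indicator (fun _ => c) x) ?_ ?_
  · refine ne_top_of_le_ne_top ?_ (setLIntegral_le_lintegral _ _)
    rw [lintegral_indicator hK.measurableSet, lintegral_const, Measure.restrict_apply_univ]
    exact ENNReal.mul_ne_top hctop hK.measure_lt_top.ne
  refine setLIntegral_mono' hΩ fun x hx => ?_
  by_cases hxK : x ∈ Prod.fst '' tsupport v
  · rw [indicator_of_mem hxK]
    calc _ ≤ ∫⁻ _ in Ioc (0 : ℝ) 1, c := by
          refine setLIntegral_mono' measurableSet_Ioc fun t ht => ?_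
          refine mul_le_mul' ?_ ?_
          · refine ENNReal.ofReal_le_of_le_toReal ?_
            simpa using hR x hx
          · refine ENNReal.rpow_le_rpow (ENNReal.rpow_le_rpow ?_ hp0.le) zero_le_two
            calc _ ≤ 1 * ENNReal.ofReal M := by
                  refine mul_le_mul' ?_ ?_
                  · exact ENNReal.ofReal_le_one.2 (by simpa using ht.1.le)
                  · rw [← ofReal_norm]; exact ENNReal.ofReal_le_ofReal (hM _)
              _ = _ := one_mul _
      _ = c := by simp
  · have : ∀ t, v (x, t) = 0 := fun t => by
      by_contra h
      exact hxK ⟨_, subset_tsupport _ h, rfl⟩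
    simp [coneMap, this, ENNReal.zero_rpow_of_pos hp0]

/-- With `G` the bracket on the right and `I` the Sobolev integral of `|v|^(2(p-1))` on the cone,
Cauchy–Schwarz bounds the mixed integrals by multiples of `e = (G I)^(1/2)`. The trace integral is
then `O(e)`, and Sobolev gives `I = O(e^((n+1)/n))`; these two facts close the argument. -/
theorem exists_lintegral_trace_rpow_le (hn : 2 ≤ n) (hΩ : IsOpen Ω)
    (hne : (frontier Ω).Nonempty) (hLip : IsUniformlyLipschitz Ω) (hR : HasFiniteInnerRadius Ω)
    {p : ℝ} (hp : p = 2 * (n : ℝ) / ((n : ℝ) - 1)) : ∃ C : ℝ≥0, 0 < C ∧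
    ∀ (v : EuclideanSpace ℝ (Fin n) × ℝ → ℝ) (D : ℝ≥0), LipschitzWith D v → HasCompactSupport v →
      tsupport v ⊆ Ω ×ˢ univ → (∀ᵐ x ∂(volume.restrict Ω), ∀ y, DifferentiableAt ℝ v (x, y)) →
    (∫⁻ x in Ω, ‖v (x, 0)‖ₑ ^ p) ^ (((n : ℝ) - 1) / n) ≤ C *
      ((∫⁻ x in Ω, ENNReal.ofReal (bdryDist Ω x) * ‖v (x, 0)‖ₑ ^ (2 : ℝ)) +
        ∫⁻ q, ENNReal.ofReal (bdryDist Ω q.1) *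
          ‖fderiv ℝ v (coneMap Ω q)‖ₑ ^ (2 : ℝ) ∂(coneMeasure Ω)) := by
  have hn' : (2 : ℝ) ≤ n := by exact_mod_cast hn
  have hn1 : (0 : ℝ) < (n : ℝ) - 1 := by linarith
  have hp1 : 1 < p := by rw [hp, lt_div_iff₀ hn1]; linarith
  obtain ⟨C1, hC1⟩ := hLip.exists_lintegral_le hΩ hne
  obtain ⟨C2, hC2⟩ := exists_lintegral_cone_sobolev hn hΩ hne hp
  obtain ⟨R, hR⟩ : ∃ R : ℝ≥0, ∀ x ∈ Ω, bdryDist Ω x ≤ R := by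
    obtain ⟨R, hR⟩ := hR
    exact ⟨R.toNNReal, fun x hx => (hR ⟨x, hx, rfl⟩).trans (Real.le_coe_toNNReal R)⟩
  have hr0 : (0 : ℝ) ≤ ((n : ℝ) + 1) / n := by positivity
  have hs0 : (0 : ℝ) < ((n : ℝ) - 1) / n := by positivity
  have hrs : ((n : ℝ) + 1) / n + ((n : ℝ) - 1) / n = 2 := by field_simp; ring
  obtain ⟨P, hP⟩ : ∃ P : ℝ≥0, ENNReal.ofReal p = P := ⟨_, rfl⟩
  obtain ⟨Q, hQ⟩ : ∃ Q : ℝ≥0, ENNReal.ofReal (p + 1) = Q := ⟨_, rfl⟩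
  -- `K` is the square root of the constant in `lintegral_cone_sq_le`. The numbers `a` and `b` are
  -- the constants in `T ≤ a e` and `I ≤ b e^((n+1)/n)`, obtained by substituting the bounds on the
  -- mixed integrals.
  set K : ℝ≥0 := (4 * (1 + R ^ 2)) ^ (1 / 2 : ℝ) with hK
  set a : ℝ≥0 := Q * (C1 * (K + P)) + P with ha
  set b : ℝ≥0 := C2 * (P + 2 * (a + P)) ^ (((n : ℝ) + 1) / n) with hb
  refine ⟨(a + 1) ^ (((n : ℝ) - 1) / n) * (b + 1), by positivity, fun v D hv hc hs hd => ?_⟩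
  have hmA := measurable_enorm_comp_coneMap (Ω := Ω) hv.continuous
  have hmB := measurable_enorm_fderiv_comp_coneMap (Ω := Ω) (v := v)
  have hmw := measurable_ofReal_one_sub_snd (n := n)
  have hmd := measurable_ofReal_bdryDist_fst (Ω := Ω)
  have hX := lintegral_cone_rpow_le hp1 hC1 hv hc hd
  have hT := lintegral_trace_le hp1 hv hc hd
  have hM := lintegral_cone_sub_one_le hp1 hv hc hd
  have hI := hC2 v D hv hc hs hd
  have hS := lintegral_cone_sq_le hv hd hΩ.measurableSet hR
  have hItop := lintegral_cone_rpow_ne_top hΩ.measurableSet hR hv.continuous hc hp1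
  have hY := lintegral_weight_mul_mul_le (coneMeasure Ω) hmd (hmw.mul hmB)
    ((hmw.mul hmA).pow_const (p - 1))
  have hZ := lintegral_weight_mul_mul_le (coneMeasure Ω) hmd (hmw.mul hmA)
    ((hmw.mul hmA).pow_const (p - 1))
  have hB : ∫⁻ q, ENNReal.ofReal (bdryDist Ω q.1) *
      (ENNReal.ofReal (1 - q.2) * ‖fderiv ℝ v (coneMap Ω q)‖ₑ) ^ (2 : ℝ) ∂(coneMeasure Ω) ≤
      ∫⁻ q, ENNReal.ofReal (bdryDist Ω q.1) *
        ‖fderiv ℝ v (coneMap Ω q)‖ₑ ^ (2 : ℝ) ∂(coneMeasure Ω) := by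
    rw [lintegral_coneMeasure (by exact hmd.mul ((hmw.mul hmB).pow_const _)),
      lintegral_coneMeasure (by exact hmd.mul (hmB.pow_const _))]
    refine lintegral_mono fun x => setLIntegral_mono' measurableSet_Ioc fun t ht => ?_
    refine mul_le_mul_right (ENNReal.rpow_le_rpow ?_ zero_le_two) _
    refine mul_le_of_le_one_left' (ENNReal.ofReal_le_one.2 ?_)
    simpa using ht.1.le
  simp only [hP, hQ] at hX hT hM hI
  simp only [Pi.mul_apply] at hY hZ
  -- From here on the integrals are treated as unknown extended reals; only the inequalities among
  -- them matter.
  generalize (∫⁻ q, ENNReal.ofReal (bdryDist Ω q.1) *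
      (ENNReal.ofReal (1 - q.2) * ‖fderiv ℝ v (coneMap Ω q)‖ₑ) ^ (2 : ℝ) ∂(coneMeasure Ω)) = DB' at *
  generalize (∫⁻ q, ENNReal.ofReal (bdryDist Ω q.1) *
      (ENNReal.ofReal (1 - q.2) * ‖v (coneMap Ω q)‖ₑ) ^ (2 : ℝ) ∂(coneMeasure Ω)) = S at *
  generalize (∫⁻ x in Ω, ‖v (x, 0)‖ₑ ^ p) = T at *
  generalize (∫⁻ q, ENNReal.ofReal (bdryDist Ω q.1) *
      ((ENNReal.ofReal (1 - q.2) * ‖v (coneMap Ω q)‖ₑ) ^ (p - 1)) ^ (2 : ℝ) ∂(coneMeasure Ω)) = I at *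
  generalize (∫⁻ q, (ENNReal.ofReal (1 - q.2) * ‖v (coneMap Ω q)‖ₑ) ^ p ∂(coneMeasure Ω)) = X at *
  generalize (∫⁻ q, (ENNReal.ofReal (1 - q.2) * ‖v (coneMap Ω q)‖ₑ) ^ (p - 1) *
        ‖v (coneMap Ω q)‖ₑ ∂(coneMeasure Ω)) = M at *
  generalize (∫⁻ q, ENNReal.ofReal (bdryDist Ω q.1) *
        ((ENNReal.ofReal (1 - q.2) * ‖fderiv ℝ v (coneMap Ω q)‖ₑ) *
          (ENNReal.ofReal (1 - q.2) * ‖v (coneMap Ω q)‖ₑ) ^ (p - 1)) ∂(coneMeasure Ω)) = Y at *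
  generalize (∫⁻ q, ENNReal.ofReal (bdryDist Ω q.1) *
        ((ENNReal.ofReal (1 - q.2) * ‖v (coneMap Ω q)‖ₑ) *
          (ENNReal.ofReal (1 - q.2) * ‖v (coneMap Ω q)‖ₑ) ^ (p - 1)) ∂(coneMeasure Ω)) = Z at *
  generalize (∫⁻ x in Ω, ENNReal.ofReal (bdryDist Ω x) * ‖v (x, 0)‖ₑ ^ (2 : ℝ)) = H at *
  generalize (∫⁻ q, ENNReal.ofReal (bdryDist Ω q.1) *
        ‖fderiv ℝ v (coneMap Ω q)‖ₑ ^ (2 : ℝ) ∂(coneMeasure Ω)) = DB at *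
  set e := (H + DB) ^ (1 / 2 : ℝ) * I ^ (1 / 2 : ℝ) with he
  have hYe : Y ≤ e := hY.trans (mul_le_mul_left
    (ENNReal.rpow_le_rpow (hB.trans le_add_self) (by norm_num)) _)
  have hZe : Z ≤ K * e := by
    refine hZ.trans ((mul_le_mul_left (ENNReal.rpow_le_rpow hS (by norm_num)) _).trans ?_)
    rw [ENNReal.mul_rpow_of_nonneg _ _ (by norm_num), hK,
      ENNReal.coe_rpow_of_nonneg _ (by norm_num), mul_assoc]
  have hTe : T ≤ a * e := by
    calc T ≤ Q * (C1 * (K * e + P * e)) + P * e := by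
          refine hT.trans (add_le_add (mul_le_mul_right (hX.trans ?_) _) ?_) <;> gcongr
      _ = a * e := by rw [ha]; push_cast; ring
  have hIe : I ≤ b * e ^ (((n : ℝ) + 1) / n) := by
    calc I ≤ C2 * (P * e + 2 * (a * e + P * e)) ^ (((n : ℝ) + 1) / n) := by
          refine hI.trans ?_
          have : P * M ≤ a * e + P * e := hM.trans (by gcongr)
          gcongr
      _ = C2 * (((P + 2 * (a + P) : ℝ≥0) : ENNReal) * e) ^ (((n : ℝ) + 1) / n) := by
          congr 2; push_cast; ring
      _ = _ := by
          rw [ENNReal.mul_rpow_of_nonneg _ _ hr0, hb, ENNReal.coe_mul,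
            ENNReal.coe_rpow_of_nonneg _ hr0, mul_assoc]
  exact ENNReal.rpow_le_of_le_mul_rpow hs0 hr0 hrs hTe hIe he hItop

end coneTrace

/-! ### The harmonic profile -/

section traceProfile

open Real

/-- The harmonic profile `1 - (2/π) arctan (sinh (a y) / sin (a s))`, `z = (s, y)`. -/
noncomputable def traceProfile (a : ℝ) (z : ℝ × ℝ) : ℝ :=
  1 - 2 / π * arctan (sinh (a * z.2) / sin (a * z.1))

/-- The derivative of `traceProfile` in the first variable. -/
noncomputable def traceProfileFst (a : ℝ) (z : ℝ × ℝ) : ℝ :=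
  2 / π * (a * (sinh (a * z.2) * cos (a * z.1)) / (sin (a * z.1) ^ 2 + sinh (a * z.2) ^ 2))

/-- The derivative of `traceProfile` in the second variable. -/
noncomputable def traceProfileSnd (a : ℝ) (z : ℝ × ℝ) : ℝ :=
  -(2 / π * (a * (cosh (a * z.2) * sin (a * z.1)) / (sin (a * z.1) ^ 2 + sinh (a * z.2) ^ 2)))

variable {a s y : ℝ}

theorem traceProfile_denom_pos (hs : 0 < sin (a * s)) (y : ℝ) :
    0 < sin (a * s) ^ 2 + sinh (a * y) ^ 2 := by positivity

theorem traceProfile_pos (a : ℝ) (z : ℝ × ℝ) : 0 < traceProfile a z := by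
  have h1 := arctan_lt_pi_div_two (sinh (a * z.2) / sin (a * z.1))
  have h2 : 2 / π * arctan (sinh (a * z.2) / sin (a * z.1)) < 2 / π * (π / 2) := by gcongr
  have h3 : 2 / π * (π / 2) = 1 := by field_simp
  unfold traceProfile
  linarith

theorem traceProfile_zero (a s : ℝ) : traceProfile a (s, 0) = 1 := by
  simp [traceProfile]

theorem traceProfileSnd_zero (hs : sin (a * s) ≠ 0) :
    traceProfileSnd a (s, 0) = -(2 / π * (a / sin (a * s))) := by
  simp only [traceProfileSnd, mul_zero, cosh_zero, sinh_zero]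
  field_simp
  ring

theorem hasDerivAt_traceProfile_fst (hs : 0 < sin (a * s)) (y : ℝ) :
    HasDerivAt (fun s' => traceProfile a (s', y)) (traceProfileFst a (s, y)) s := by
  have h1 : HasDerivAt (fun s' : ℝ => sin (a * s')) (cos (a * s) * (a * 1)) s :=
    ((hasDerivAt_id s).const_mul a).sin
  have h2 := ((((hasDerivAt_const s (sinh (a * y))).div h1 hs.ne').arctan).const_mul (2 / π)).const_sub 1
  refine h2.congr_deriv ?_
  have hQ := (traceProfile_denom_pos hs y).ne'
  simp only [traceProfileFst]
  have h3 : 1 + (sinh (a * y) / sin (a * s)) ^ 2 =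
      (sin (a * s) ^ 2 + sinh (a * y) ^ 2) / sin (a * s) ^ 2 := by field_simp
  rw [Pi.div_apply, h3]
  field_simp
  ring

theorem hasDerivAt_traceProfile_snd (hs : 0 < sin (a * s)) (y : ℝ) :
    HasDerivAt (fun y' => traceProfile a (s, y')) (traceProfileSnd a (s, y)) y := by
  have h1 : HasDerivAt (fun y' : ℝ => sinh (a * y')) (cosh (a * y) * (a * 1)) y :=
    ((hasDerivAt_id y).const_mul a).sinh
  have h2 := (((h1.div_const (sin (a * s))).arctan).const_mul (2 / π)).const_sub 1
  refine h2.congr_deriv ?_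
  have hQ := (traceProfile_denom_pos hs y).ne'
  simp only [traceProfileSnd]
  have h3 : 1 + (sinh (a * y) / sin (a * s)) ^ 2 =
      (sin (a * s) ^ 2 + sinh (a * y) ^ 2) / sin (a * s) ^ 2 := by field_simp
  rw [h3]
  field_simp

/-- The profile is harmonic. -/
theorem exists_hasDerivAt_traceProfile (hs : 0 < sin (a * s)) (y : ℝ) : ∃ M : ℝ,
    HasDerivAt (fun s' => traceProfileFst a (s', y)) M s ∧
    HasDerivAt (fun y' => traceProfileSnd a (s, y')) (-M) y := by
  have hQ := (traceProfile_denom_pos hs y).ne'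
  refine ⟨-(2 / π * (a ^ 2 * (sinh (a * y) * sin (a * s)) * (sin (a * s) ^ 2 + sinh (a * y) ^ 2 +
    2 * cos (a * s) ^ 2) / (sin (a * s) ^ 2 + sinh (a * y) ^ 2) ^ 2)), ?_, ?_⟩
  · have h1 : HasDerivAt (fun s' : ℝ => sin (a * s')) (cos (a * s) * (a * 1)) s :=
      ((hasDerivAt_id s).const_mul a).sin
    have h2 : HasDerivAt (fun s' : ℝ => cos (a * s')) (-sin (a * s) * (a * 1)) s :=
      ((hasDerivAt_id s).const_mul a).cos
    have h3 := (((h2.const_mul (sinh (a * y))).const_mul a).div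
      ((h1.fun_pow 2).add_const (sinh (a * y) ^ 2)) hQ).const_mul (2 / π)
    refine h3.congr_deriv ?_
    field_simp
    push_cast
    ring
  · have h1 : HasDerivAt (fun y' : ℝ => sinh (a * y')) (cosh (a * y) * (a * 1)) y :=
      ((hasDerivAt_id y).const_mul a).sinh
    have h2 : HasDerivAt (fun y' : ℝ => cosh (a * y')) (sinh (a * y) * (a * 1)) y :=
      ((hasDerivAt_id y).const_mul a).cosh
    have h3 := ((((h2.mul_const (sin (a * s))).const_mul a).div
      ((h1.fun_pow 2).const_add (sin (a * s) ^ 2)) hQ).const_mul (2 / π)).neg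
    refine h3.congr_deriv ?_
    have h4 : cosh (a * y) ^ 2 = 1 + sinh (a * y) ^ 2 := by rw [cosh_sq]; ring
    have h5 : cos (a * s) ^ 2 = 1 - sin (a * s) ^ 2 := by rw [cos_sq']
    rw [h5]
    field_simp
    push_cast
    rw [h4]
    ring

theorem contDiffAt_traceProfile {z : ℝ × ℝ} (hs : 0 < sin (a * z.1)) :
    ContDiffAt ℝ ∞ (traceProfile a) z := by
  unfold traceProfile
  have h1 : ContDiffAt ℝ ∞ (fun z : ℝ × ℝ => sinh (a * z.2)) z :=
    (contDiff_const.mul contDiff_snd).sinh.contDiffAt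
  have h2 : ContDiffAt ℝ ∞ (fun z : ℝ × ℝ => sin (a * z.1)) z :=
    (contDiff_const.mul contDiff_fst).sin.contDiffAt
  exact contDiffAt_const.sub (contDiffAt_const.mul (h1.div h2 hs.ne').arctan)

theorem contDiffAt_traceProfileFst {z : ℝ × ℝ} (hs : 0 < sin (a * z.1)) :
    ContDiffAt ℝ ∞ (traceProfileFst a) z := by
  unfold traceProfileFst
  have h1 : ContDiff ℝ ∞ (fun z : ℝ × ℝ => sinh (a * z.2)) := (contDiff_const.mul contDiff_snd).sinh
  have h2 : ContDiff ℝ ∞ (fun z : ℝ × ℝ => sin (a * z.1)) := (contDiff_const.mul contDiff_fst).sin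
  have h3 : ContDiff ℝ ∞ (fun z : ℝ × ℝ => cos (a * z.1)) := (contDiff_const.mul contDiff_fst).cos
  exact contDiffAt_const.mul (((contDiff_const.mul (h1.mul h3)).contDiffAt).div
    ((h2.pow 2).add (h1.pow 2)).contDiffAt (traceProfile_denom_pos hs z.2).ne')

theorem contDiffAt_traceProfileSnd {z : ℝ × ℝ} (hs : 0 < sin (a * z.1)) :
    ContDiffAt ℝ ∞ (traceProfileSnd a) z := by
  unfold traceProfileSnd
  have h1 : ContDiff ℝ ∞ (fun z : ℝ × ℝ => sinh (a * z.2)) := (contDiff_const.mul contDiff_snd).sinh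
  have h2 : ContDiff ℝ ∞ (fun z : ℝ × ℝ => sin (a * z.1)) := (contDiff_const.mul contDiff_fst).sin
  have h3 : ContDiff ℝ ∞ (fun z : ℝ × ℝ => cosh (a * z.2)) := (contDiff_const.mul contDiff_snd).cosh
  exact (contDiffAt_const.mul (((contDiff_const.mul (h3.mul h2)).contDiffAt).div
    ((h2.pow 2).add (h1.pow 2)).contDiffAt (traceProfile_denom_pos hs z.2).ne')).neg

theorem sin_pos_of_mem_Ioc {t : ℝ} (ht : t ∈ Ioc (0 : ℝ) 1) : 0 < sin t :=
  sin_pos_of_pos_of_lt_pi ht.1 (by linarith [ht.2, pi_gt_three])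

theorem traceProfileFst_nonneg (ha : 0 ≤ a) (hs : a * s ∈ Ioc (0 : ℝ) 1) (hy : 0 ≤ y) :
    0 ≤ traceProfileFst a (s, y) := by
  have h1 : 0 ≤ cos (a * s) :=
    cos_nonneg_of_neg_pi_div_two_le_of_le (by linarith [hs.1, pi_gt_three])
      (by linarith [hs.2, pi_gt_three])
  have h2 : 0 ≤ sinh (a * y) := sinh_nonneg_iff.2 (by positivity)
  simp only [traceProfileFst]
  positivity

theorem half_le_sin {t : ℝ} (ht : t ∈ Ioc (0 : ℝ) 1) : t / 2 ≤ sin t := by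
  have h1 := mul_le_sin ht.1.le (by linarith [ht.2, pi_gt_three])
  have h2 : 1 / 2 ≤ 2 / π := by
    rw [div_le_div_iff₀ (by norm_num) pi_pos]; linarith [pi_le_four]
  nlinarith [ht.1]

theorem sinh_le_two_mul {t : ℝ} (ht : t ∈ Icc (0 : ℝ) 1) : sinh t ≤ 2 * t := by
  have h1 := abs_exp_sub_one_le (x := t) (by rw [abs_of_nonneg ht.1]; exact ht.2)
  have h2 := abs_exp_sub_one_le (x := -t) (by rw [abs_neg, abs_of_nonneg ht.1]; exact ht.2)
  rw [abs_neg] at h2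
  rw [abs_of_nonneg ht.1] at h1 h2
  rw [sinh_eq]
  linarith [(abs_le.1 h1).2, (abs_le.1 h2).1]

/-- On the cone `sinh (a y) ≤ sinh (a s) ≤ 2 a s`, while `sin (a s) ≥ a s / 2`, so the quotient is
at most `4`. Positivity of the resulting constant is what allows the weight `P²` to be dropped
there. -/
theorem traceProfile_lower_bound (ha : 0 < a) (hs : a * s ∈ Ioc (0 : ℝ) 1) (hys : y ≤ s) :
    1 - 2 / π * arctan 4 ≤ traceProfile a (s, y) := by
  unfold traceProfile
  have hsin := sin_pos_of_mem_Ioc hs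
  have h1 : sinh (a * y) / sin (a * s) ≤ 4 := by
    rw [div_le_iff₀ hsin]
    have h2 : sinh (a * y) ≤ sinh (a * s) := sinh_le_sinh.2 (by gcongr)
    linarith [half_le_sin hs, sinh_le_two_mul ⟨hs.1.le, hs.2⟩]
  have := arctan_mono h1
  change _ ≤ 1 - 2 / π * arctan (sinh (a * y) / sin (a * s))
  gcongr

theorem traceProfile_le_one (ha : 0 ≤ a) (hs : 0 < sin (a * s)) (hy : 0 ≤ y) :
    traceProfile a (s, y) ≤ 1 := by
  have h2 : 0 ≤ sinh (a * y) := sinh_nonneg_iff.2 (by positivity)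
  have h3 : 0 ≤ arctan (sinh (a * y) / sin (a * s)) := arctan_nonneg.2 (by positivity)
  have : 0 ≤ 2 / π * arctan (sinh (a * y) / sin (a * s)) := by positivity
  simp only [traceProfile]
  linarith

/-- By the complementary angle formula the profile is `(2/π) arctan (sin s / sinh y)`. This decay
makes the boundary layer in the sharpness proof cost only bounded energy. -/
theorem traceProfile_le_div (hs : s ∈ Ioc (0 : ℝ) 1) (hy : 0 < y) :
    traceProfile 1 (s, y) ≤ s / y := by
  have hsin := sin_pos_of_mem_Ioc hs
  have h2 : 0 < sinh y := sinh_pos_iff.2 hy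
  have h3 : y ≤ sinh y := self_le_sinh_iff.2 hy.le
  have h4 : arctan (sin s / sinh y) = π / 2 - arctan (sinh y / sin s) := by
    rw [← arctan_inv_of_pos (by positivity), inv_div]
  have h5 : arctan (sin s / sinh y) ≤ s / y := by
    calc arctan (sin s / sinh y) ≤ sin s / sinh y := by
          have h6 : 0 ≤ arctan (sin s / sinh y) := arctan_nonneg.2 (by positivity)
          have := le_tan h6 (arctan_lt_pi_div_two _)
          rwa [tan_arctan] at this
      _ ≤ s / y := by
          have := sin_le hs.1.le
          have := hs.1
          gcongr
  have h6 : traceProfile 1 (s, y) = 2 / π * arctan (sin s / sinh y) := by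
    simp only [traceProfile, one_mul]
    rw [h4]; field_simp
  rw [h6]
  have h7 : 2 / π ≤ 1 := by rw [div_le_one pi_pos]; linarith [pi_gt_three]
  have h8 : 0 ≤ arctan (sin s / sinh y) := arctan_nonneg.2 (by positivity)
  nlinarith

/-- The gain of `a / sin (a s)` over `1 / s`. -/
theorem inv_add_mul_le_div_sin (ha : 0 < a) (hs : a * s ∈ Ioc (0 : ℝ) 1) :
    1 / s + a ^ 2 / 12 * s ≤ a / sin (a * s) := by
  have hs0 : 0 < s := pos_of_mul_pos_right hs.1 ha.le
  have hsin := sin_pos_of_mem_Ioc hs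
  set t := a * s with ht
  have h0 := hs.1
  have h1 := sin_le hs.1.le
  have hb := sin_bound (x := t) (by rw [abs_of_pos hs.1]; exact hs.2)
  rw [abs_of_pos hs.1] at hb
  have h2 : sin t ≤ t - t ^ 3 / 6 + t ^ 5 / 100 := by linarith [(abs_le.1 hb).2]
  have h3 : t ^ 5 ≤ t ^ 3 := pow_le_pow_of_le_one hs.1.le hs.2 (by norm_num)
  have h4 : (1 + t ^ 2 / 12) * sin t ≤ t := by
    -- Any coefficient between `1/12` and `1/6 - 1/100` would serve: the upper limit comes from the
    -- Taylor bound with `t⁵ ≤ t³`, the lower one from the product with `1 + t²/12`.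
    have h5 : sin t ≤ t - t ^ 3 * (11 / 96) := by linarith
    have h6 : (1 + t ^ 2 / 12) * sin t ≤ (1 + t ^ 2 / 12) * (t - t ^ 3 * (11 / 96)) := by gcongr
    have h7 : 0 ≤ t ^ 5 := by positivity
    have h8 : 0 ≤ t ^ 3 := by positivity
    nlinarith
  rw [le_div_iff₀ hsin]
  have h5 : 1 / s + a ^ 2 / 12 * s = (1 + t ^ 2 / 12) / s := by rw [ht]; field_simp
  rw [h5, div_mul_eq_mul_div, div_le_iff₀ hs0]
  exact h4

/-- The loss of `1 / sin s` over `1 / s`. -/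
theorem inv_sin_le_inv_add_one {s : ℝ} (hs : s ∈ Ioc (0 : ℝ) 1) : 1 / sin s ≤ 1 / s + 1 := by
  have hsin := sin_pos_of_mem_Ioc hs
  have h0 := hs.1
  have hb := sin_bound (x := s) (by rw [abs_of_pos hs.1]; exact hs.2)
  rw [abs_of_pos hs.1] at hb
  have h2 : s - s ^ 3 / 6 - s ^ 5 / 100 ≤ sin s := by linarith [(abs_le.1 hb).1]
  have h3 : s ^ 5 ≤ s ^ 2 := pow_le_pow_of_le_one hs.1.le hs.2 (by norm_num)
  have h4 : s ^ 3 ≤ s ^ 2 := pow_le_pow_of_le_one hs.1.le hs.2 (by norm_num)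
  rw [div_le_iff₀ hsin]
  have h5 : (1 / s + 1) * sin s = ((1 + s) * sin s) / s := by field_simp
  rw [h5, le_div_iff₀ h0]
  have h6 : (1 + s) * (s - s ^ 2 / 2) ≤ (1 + s) * sin s := by gcongr; nlinarith [sq_nonneg s]
  nlinarith [hs.2, mul_nonneg h0.le h0.le, mul_nonneg (sq_nonneg s) (sub_nonneg.2 hs.2)]

end traceProfile

/-! ### The ground state substitution, pointwise -/

section gradientCalculus

variable {F : Type*} [NormedAddCommGroup F] [InnerProductSpace ℝ F] [CompleteSpace F]

theorem HasFDerivAt.gradient_eq_smul_add_smul {f g h : F → ℝ} {x : F} {c d : ℝ}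
    (hf : HasFDerivAt f (c • fderiv ℝ g x + d • fderiv ℝ h x) x) :
    gradient f x = c • gradient g x + d • gradient h x := by
  refine ext_inner_right ℝ fun w => ?_
  rw [inner_gradient_eq_fderiv, hf.fderiv, inner_add_left, real_inner_smul_left,
    real_inner_smul_left, inner_gradient_eq_fderiv, inner_gradient_eq_fderiv]
  rfl

theorem gradient_comp_mul {f δ : F → ℝ} {x : F} {J : ℝ → ℝ} {J' : ℝ}
    (hJ : HasDerivAt J J' (δ x)) (hδ : DifferentiableAt ℝ δ x) (hf : DifferentiableAt ℝ f x) :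
    gradient (fun x' => J (δ x') * f x') x = J (δ x) • gradient f x + (f x * J') • gradient δ x := by
  refine HasFDerivAt.gradient_eq_smul_add_smul ?_
  have h1 := (hJ.comp_hasFDerivAt x hδ.hasFDerivAt).mul hf.hasFDerivAt
  rw [smul_smul] at h1
  exact h1

theorem gradient_sq {f : F → ℝ} {x : F} (hf : DifferentiableAt ℝ f x) :
    gradient (fun x' => f x' ^ 2) x = (2 * f x) • gradient f x := by
  refine ext_inner_right ℝ fun w => ?_
  have h1 := hf.hasFDerivAt.pow 2
  have h2 : fderiv ℝ (fun x' => f x' ^ 2) x = (2 * f x) • fderiv ℝ f x := by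
    refine HasFDerivAt.fderiv (h1.congr_fderiv ?_)
    simp
  rw [inner_gradient_eq_fderiv, h2, real_inner_smul_left, inner_gradient_eq_fderiv]
  rfl

/-- The factor `2` compares norms: the product carries the sup norm, so the operator norm is at most
the sum of the two partial norms, whereas `gradSq` is Euclidean. -/
theorem norm_fderiv_prod_sq_le {v : F × ℝ → ℝ} {x : F} {y : ℝ} (hv : DifferentiableAt ℝ v (x, y)) :
    ‖fderiv ℝ v (x, y)‖ ^ 2 ≤
      2 * (‖gradient (fun x' => v (x', y)) x‖ ^ 2 + (deriv (fun y' => v (x, y')) y) ^ 2) := by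
  have h1 : HasFDerivAt (fun x' => v (x', y))
      ((fderiv ℝ v (x, y)).comp (ContinuousLinearMap.inl ℝ F ℝ)) x :=
    HasFDerivAt.comp (g := v) x hv.hasFDerivAt (hasFDerivAt_prodMk_left x y)
  have h2 : HasDerivAt (fun y' => v (x, y')) (fderiv ℝ v (x, y) (0, 1)) y := by
    have := (HasFDerivAt.comp (g := v) y hv.hasFDerivAt (hasFDerivAt_prodMk_right x y)).hasDerivAt
    exact this.congr_deriv (by simp)
  rw [norm_gradient_eq_norm_fderiv, h1.fderiv, h2.deriv]
  set L := fderiv ℝ v (x, y)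
  have h3 : ‖L‖ ≤ ‖L.comp (ContinuousLinearMap.inl ℝ F ℝ)‖ + |L (0, 1)| := by
    refine L.opNorm_le_bound (by positivity) fun q => ?_
    have hq : L q = L.comp (ContinuousLinearMap.inl ℝ F ℝ) q.1 + q.2 * L (0, 1) := by
      have : q = (q.1, 0) + q.2 • ((0 : F), (1 : ℝ)) := by ext <;> simp
      conv_lhs => rw [this]
      rw [map_add, map_smul]; rfl
    rw [hq]
    refine (norm_add_le _ _).trans ?_
    rw [add_mul]
    refine add_le_add ((ContinuousLinearMap.le_opNorm _ _).trans ?_) ?_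
    · gcongr; exact norm_fst_le q
    · rw [norm_mul, mul_comm]
      exact mul_le_mul_of_nonneg_left (norm_snd_le q) (abs_nonneg _)
  calc ‖L‖ ^ 2 ≤ (‖L.comp (ContinuousLinearMap.inl ℝ F ℝ)‖ + |L (0, 1)|) ^ 2 := by gcongr
    _ ≤ _ := by
      rw [← sq_abs (L (0, 1))]
      nlinarith [sq_nonneg (‖L.comp (ContinuousLinearMap.inl ℝ F ℝ)‖ - |L (0, 1)|)]

end gradientCalculus

section groundState

variable {n : ℕ} {a : ℝ} {δ : EuclideanSpace ℝ (Fin n) → ℝ}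
  {u : EuclideanSpace ℝ (Fin n) × ℝ → ℝ}

/-- The quotient of `u` by the harmonic profile. -/
noncomputable def profileQuotient (a : ℝ) (δ : EuclideanSpace ℝ (Fin n) → ℝ)
    (u : EuclideanSpace ℝ (Fin n) × ℝ → ℝ) (q : EuclideanSpace ℝ (Fin n) × ℝ) : ℝ :=
  (traceProfile a (δ q.1, q.2))⁻¹ * u q

/-- The horizontal flux density of the ground state identity. -/
noncomputable def profileFluxFst (a : ℝ) (δ : EuclideanSpace ℝ (Fin n) → ℝ)
    (u : EuclideanSpace ℝ (Fin n) × ℝ → ℝ) (q : EuclideanSpace ℝ (Fin n) × ℝ) : ℝ :=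
  traceProfileFst a (δ q.1, q.2) / traceProfile a (δ q.1, q.2) * u q ^ 2

/-- The vertical flux density of the ground state identity. -/
noncomputable def profileFluxSnd (a : ℝ) (δ : EuclideanSpace ℝ (Fin n) → ℝ)
    (u : EuclideanSpace ℝ (Fin n) × ℝ → ℝ) (q : EuclideanSpace ℝ (Fin n) × ℝ) : ℝ :=
  traceProfileSnd a (δ q.1, q.2) / traceProfile a (δ q.1, q.2) * u q ^ 2

/-- Expand both fluxes by the product rule. The second derivatives of the profile cancel by
harmonicity, and `|∇δ| = 1` makes the squares of first derivatives match. No `Δδ` occurs, since the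
horizontal flux enters as `∇δ · ∇F` and not as a divergence; so a `δ` that is merely Lipschitz is
admissible. -/
theorem gradSq_eq_profile {x : EuclideanSpace ℝ (Fin n)} (hs : 0 < Real.sin (a * δ x))
    (hδ : DifferentiableAt ℝ δ x) (hN : ‖gradient δ x‖ = 1) {y : ℝ}
    (hu : DifferentiableAt ℝ u (x, y)) :
    gradSq u x y = traceProfile a (δ x, y) ^ 2 * gradSq (profileQuotient a δ u) x y +
      inner ℝ (gradient δ x) (gradient (fun x' => profileFluxFst a δ u (x', y)) x) +
      deriv (fun y' => profileFluxSnd a δ u (x, y')) y := by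
  have hu1 : DifferentiableAt ℝ (fun x' => u (x', y)) x :=
    DifferentiableAt.comp (g := u) x hu (hasFDerivAt_prodMk_left x y).differentiableAt
  have hu2 : HasDerivAt (fun y' => u (x, y')) (deriv (fun y' => u (x, y')) y) y :=
    (DifferentiableAt.comp (g := u) y hu
      (hasFDerivAt_prodMk_right x y).differentiableAt).hasDerivAt
  obtain ⟨M, hM1, hM2⟩ := exists_hasDerivAt_traceProfile hs y
  have hp := (traceProfile_pos a (δ x, y)).ne'
  have hP1 := hasDerivAt_traceProfile_fst hs y
  have hP2 := hasDerivAt_traceProfile_snd hs y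
  have e1 : gradient (fun x' => profileQuotient a δ u (x', y)) x = _ :=
    gradient_comp_mul (J := fun s => (traceProfile a (s, y))⁻¹) (f := fun x' => u (x', y)) (hP1.fun_inv hp) hδ hu1
  have e2 : gradient (fun x' => profileFluxFst a δ u (x', y)) x = _ :=
    gradient_comp_mul (J := fun s => traceProfileFst a (s, y) / traceProfile a (s, y))
      (f := fun x' => u (x', y) ^ 2) (hM1.fun_div hP1 hp) hδ (hu1.pow 2)
  have e3 : deriv (fun y' => profileQuotient a δ u (x, y')) y = _ :=
    ((hP2.fun_inv hp).mul hu2).deriv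
  have e4 : deriv (fun y' => profileFluxSnd a δ u (x, y')) y = _ :=
    ((hM2.fun_div hP2 hp).mul (hu2.fun_pow 2)).deriv
  rw [gradient_sq hu1] at e2
  rw [gradSq, gradSq, e1, e2, e3, e4]
  set p := traceProfile a (δ x, y)
  set N := gradient δ x
  set g := gradient (fun x' => u (x', y)) x
  set b := deriv (fun y' => u (x, y')) y
  set c := u (x, y)
  rw [norm_add_sq_real, norm_smul, norm_smul, hN, inner_add_right]
  simp only [real_inner_smul_left, real_inner_smul_right, real_inner_self_eq_norm_sq, hN,
    real_inner_comm N g, mul_pow, Real.norm_eq_abs, sq_abs]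
  push_cast
  field_simp
  ring

end groundState

theorem MeasureTheory.Integrable.of_bound_of_eq_zero_of_isCompact {X : Type*} [TopologicalSpace X]
    [T2Space X] [MeasurableSpace X] [BorelSpace X] {μ : Measure X} [IsFiniteMeasureOnCompacts μ]
    {f : X → ℝ} {K : Set X} {M : ℝ} (hK : IsCompact K) (hf : AEStronglyMeasurable f μ)
    (hM : ∀ x, ‖f x‖ ≤ M) (h0 : ∀ x, x ∉ K → f x = 0) : Integrable f μ := by
  have h1 : IntegrableOn f K μ :=
    Measure.integrableOn_of_bounded hK.measure_lt_top.ne hf (ae_of_all _ hM)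
  exact (integrableOn_iff_integrable_of_support_subset fun x hx => by
    by_contra h; exact hx (h0 x h)).1 h1

section slices

variable {E : Type*} [NormedAddCommGroup E] {u : E × ℝ → ℝ}

theorem HasCompactSupport.slice_snd (hc : HasCompactSupport u) (x : E) :
    HasCompactSupport fun y => u (x, y) :=
  HasCompactSupport.intro (hc.isCompact.image continuous_snd) fun y hy => by
    by_contra h
    exact hy ⟨_, subset_tsupport _ h, rfl⟩

theorem HasCompactSupport.slice_fst (hc : HasCompactSupport u) (y : ℝ) :
    HasCompactSupport fun x => u (x, y) :=
  HasCompactSupport.intro (hc.isCompact.image continuous_fst) fun x hx => by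
    by_contra h
    exact hx ⟨_, subset_tsupport _ h, rfl⟩

theorem tsupport_slice_fst_subset (u : E × ℝ → ℝ) (y : ℝ) :
    tsupport (fun x => u (x, y)) ⊆ (fun x => (x, y)) ⁻¹' tsupport u := by
  refine closure_minimal (fun x hx => subset_tsupport u hx) ?_
  exact (isClosed_tsupport u).preimage (by fun_prop)

end slices

theorem contDiffAt_inv_traceProfile {a : ℝ} (z : ℝ × ℝ) (hs : 0 < Real.sin (a * z.1)) :
    ContDiffAt ℝ ∞ (fun z => (traceProfile a z)⁻¹) z :=
  (contDiffAt_traceProfile hs).inv (traceProfile_pos _ _).ne'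

theorem contDiffAt_traceProfileFst_div {a : ℝ} (z : ℝ × ℝ) (hs : 0 < Real.sin (a * z.1)) :
    ContDiffAt ℝ ∞ (fun z => traceProfileFst a z / traceProfile a z) z :=
  (contDiffAt_traceProfileFst hs).div (contDiffAt_traceProfile hs) (traceProfile_pos _ _).ne'

theorem contDiffAt_traceProfileSnd_div {a : ℝ} (z : ℝ × ℝ) (hs : 0 < Real.sin (a * z.1)) :
    ContDiffAt ℝ ∞ (fun z => traceProfileSnd a z / traceProfile a z) z :=
  (contDiffAt_traceProfileSnd hs).div (contDiffAt_traceProfile hs) (traceProfile_pos _ _).ne'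

/-! ### The integrated ground state identity -/

section groundState

variable {n : ℕ} {a : ℝ} {O : Set (EuclideanSpace ℝ (Fin n))}
  {δ : EuclideanSpace ℝ (Fin n) → ℝ} {u : EuclideanSpace ℝ (Fin n) × ℝ → ℝ}

/-- The factor `J(δ(x), y)` may blow up towards the boundary of `O`, but `h` is supported compactly
inside, so local Lipschitz bounds on `O` are enough. -/
theorem exists_lipschitzWith_comp_mul (hO : IsOpen O) {D : ℝ≥0} (hδ : LipschitzWith D δ)
    {h : EuclideanSpace ℝ (Fin n) × ℝ → ℝ} (hh : ContDiff ℝ ∞ h) (hc : HasCompactSupport h)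
    (hs : tsupport h ⊆ O ×ˢ univ) {J : ℝ × ℝ → ℝ}
    (hJ : ∀ x ∈ O, ∀ y, ContDiffAt ℝ ∞ J (δ x, y)) :
    ∃ D', LipschitzWith D' fun q => J (δ q.1, q.2) * h q := by
  refine LocallyLipschitzOn.exists_lipschitzWith_of_hasCompactSupport (hO.prod isOpen_univ)
    ?_ hc.mul_left ((tsupport_mul_subset_right).trans hs)
  have h1 : LocallyLipschitzOn (O ×ˢ (univ : Set ℝ))
      fun q : EuclideanSpace ℝ (Fin n) × ℝ => (δ q.1, q.2) :=
    ((((hδ.comp LipschitzWith.prod_fst).locallyLipschitz.prodMk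
      LipschitzWith.prod_snd.locallyLipschitz)).locallyLipschitzOn)
  have h2 : LocallyLipschitzOn (O ×ˢ (univ : Set ℝ)) (J ∘ fun q => (δ q.1, q.2)) :=
    h1.comp_of_forall fun q hq => ((hJ q.1 hq.1 q.2).of_le (by simp)).exists_lipschitzOnWith
  have h3 := h2.prodMk ((hh.of_le (by simp)).locallyLipschitz.locallyLipschitzOn
    (s := O ×ˢ (univ : Set ℝ)))
  have h5 : LocallyLipschitz fun z : ℝ × ℝ => z.1 * z.2 :=
    (contDiff_fst.mul contDiff_snd : ContDiff ℝ 1 fun z : ℝ × ℝ => z.1 * z.2).locallyLipschitz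
  exact h3.comp_of_forall (G := fun z : ℝ × ℝ => z.1 * z.2) fun q _ => h5 _

/-- The hypotheses on a distance-like function `δ` on `O`. -/
structure IsProfileDistance (a : ℝ) (O : Set (EuclideanSpace ℝ (Fin n)))
    (δ : EuclideanSpace ℝ (Fin n) → ℝ) : Prop where
  isOpen : IsOpen O
  lipschitz : LipschitzWith 1 δ
  mul_mem : ∀ x ∈ O, a * δ x ∈ Ioc (0 : ℝ) 1
  norm_gradient : ∀ᵐ x ∂(volume.restrict O), DifferentiableAt ℝ δ x ∧ ‖gradient δ x‖ = 1

namespace IsProfileDistance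

theorem sin_pos (hδ : IsProfileDistance a O δ) {x : EuclideanSpace ℝ (Fin n)} (hx : x ∈ O) :
    0 < Real.sin (a * δ x) :=
  sin_pos_of_mem_Ioc (hδ.mul_mem x hx)

theorem exists_lipschitzWith_quotient (hδ : IsProfileDistance a O δ)
    (hu : IsTestFunction (O ×ˢ (univ : Set ℝ)) u) :
    ∃ D, LipschitzWith D (profileQuotient a δ u) :=
  exists_lipschitzWith_comp_mul (J := fun z => (traceProfile a z)⁻¹) hδ.isOpen hδ.lipschitz
    hu.1 hu.2.1 hu.2.2 fun x hx y =>
      contDiffAt_inv_traceProfile (δ x, y) (hδ.sin_pos hx)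

theorem exists_lipschitzWith_fluxFst (hδ : IsProfileDistance a O δ)
    (hu : IsTestFunction (O ×ˢ (univ : Set ℝ)) u) :
    ∃ D, LipschitzWith D (profileFluxFst a δ u) := by
  refine exists_lipschitzWith_comp_mul (J := fun z => traceProfileFst a z / traceProfile a z)
    (h := fun q => u q ^ 2) hδ.isOpen hδ.lipschitz (hu.1.pow 2)
    (hu.2.1.comp_left (g := fun t => t ^ 2) (by simp)) ?_ fun x hx y =>
      contDiffAt_traceProfileFst_div (δ x, y) (hδ.sin_pos hx)
  exact (show tsupport (fun q => u q ^ 2) ⊆ tsupport u from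
    closure_mono fun q (hq : u q ^ 2 ≠ 0) (h : u q = 0) => hq (by simp [h])).trans hu.2.2

theorem exists_lipschitzWith_fluxSnd (hδ : IsProfileDistance a O δ)
    (hu : IsTestFunction (O ×ˢ (univ : Set ℝ)) u) :
    ∃ D, LipschitzWith D (profileFluxSnd a δ u) := by
  refine exists_lipschitzWith_comp_mul (J := fun z => traceProfileSnd a z / traceProfile a z)
    (h := fun q => u q ^ 2) hδ.isOpen hδ.lipschitz (hu.1.pow 2)
    (hu.2.1.comp_left (g := fun t => t ^ 2) (by simp)) ?_ fun x hx y =>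
      contDiffAt_traceProfileSnd_div (δ x, y) (hδ.sin_pos hx)
  exact (show tsupport (fun q => u q ^ 2) ⊆ tsupport u from
    closure_mono fun q (hq : u q ^ 2 ≠ 0) (h : u q = 0) => hq (by simp [h])).trans hu.2.2

/-- Differentiability can fail only through `δ`, which depends on `x` alone. Hence the exceptional
set consists of full vertical fibres, and almost every fibre is entirely good. -/
theorem ae_differentiableAt_comp (hδ : IsProfileDistance a O δ)
    (hu : ContDiff ℝ ∞ u) {J : ℝ × ℝ → ℝ}
    (hJ : ∀ x ∈ O, ∀ y, ContDiffAt ℝ ∞ J (δ x, y)) :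
    ∀ᵐ x ∂(volume.restrict O), ∀ y,
      DifferentiableAt ℝ (fun q : EuclideanSpace ℝ (Fin n) × ℝ => J (δ q.1, q.2) * u q) (x, y) := by
  filter_upwards [hδ.norm_gradient, ae_restrict_mem hδ.isOpen.measurableSet] with x hx hxO y
  have h1 : DifferentiableAt ℝ (fun q : EuclideanSpace ℝ (Fin n) × ℝ => (δ q.1, q.2)) (x, y) :=
    (DifferentiableAt.comp (g := δ) (x, y) hx.1 differentiableAt_fst).prodMk differentiableAt_snd
  exact (DifferentiableAt.comp (g := J) (x, y)
    ((hJ x hxO y).differentiableAt (by simp)) h1).mul (hu.differentiable (by simp) _)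

theorem ae_differentiableAt_quotient (hδ : IsProfileDistance a O δ) (hu : ContDiff ℝ ∞ u) :
    ∀ᵐ x ∂(volume.restrict O), ∀ y, DifferentiableAt ℝ (profileQuotient a δ u) (x, y) :=
  hδ.ae_differentiableAt_comp (J := fun z => (traceProfile a z)⁻¹) hu fun x hx y =>
      contDiffAt_inv_traceProfile (δ x, y) (hδ.sin_pos hx)

theorem ae_differentiableAt_fluxFst (hδ : IsProfileDistance a O δ) (hu : ContDiff ℝ ∞ u) :
    ∀ᵐ x ∂(volume.restrict O), ∀ y, DifferentiableAt ℝ (profileFluxFst a δ u) (x, y) :=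
  hδ.ae_differentiableAt_comp (J := fun z => traceProfileFst a z / traceProfile a z)
    (hu.pow 2) fun x hx y =>
      contDiffAt_traceProfileFst_div (δ x, y) (hδ.sin_pos hx)

theorem ae_differentiableAt_fluxSnd (hδ : IsProfileDistance a O δ) (hu : ContDiff ℝ ∞ u) :
    ∀ᵐ x ∂(volume.restrict O), ∀ y, DifferentiableAt ℝ (profileFluxSnd a δ u) (x, y) :=
  hδ.ae_differentiableAt_comp (J := fun z => traceProfileSnd a z / traceProfile a z)
    (hu.pow 2) fun x hx y =>
      contDiffAt_traceProfileSnd_div (δ x, y) (hδ.sin_pos hx)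

end IsProfileDistance

theorem gradSq_eq_fderiv {x : EuclideanSpace ℝ (Fin n)} {y : ℝ}
    (hu : DifferentiableAt ℝ u (x, y)) :
    gradSq u x y = ‖(fderiv ℝ u (x, y)).comp (ContinuousLinearMap.inl ℝ _ ℝ)‖ ^ 2 +
      (fderiv ℝ u (x, y) (0, 1)) ^ 2 := by
  have h1 : HasFDerivAt (fun x' => u (x', y))
      ((fderiv ℝ u (x, y)).comp (ContinuousLinearMap.inl ℝ _ ℝ)) x :=
    HasFDerivAt.comp (g := u) x hu.hasFDerivAt (hasFDerivAt_prodMk_left x y)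
  have h2 : HasDerivAt (fun y' => u (x, y')) (fderiv ℝ u (x, y) (0, 1)) y := by
    have := (HasFDerivAt.comp (g := u) y hu.hasFDerivAt (hasFDerivAt_prodMk_right x y)).hasDerivAt
    exact this.congr_deriv (by simp)
  rw [gradSq, norm_gradient_eq_norm_fderiv, h1.fderiv, h2.deriv]

theorem continuous_gradSq (hu : ContDiff ℝ ∞ u) :
    Continuous fun q : EuclideanSpace ℝ (Fin n) × ℝ => gradSq u q.1 q.2 := by
  have h1 : Continuous (fderiv ℝ u) := hu.continuous_fderiv (by simp)
  have h2 : (fun q : EuclideanSpace ℝ (Fin n) × ℝ => gradSq u q.1 q.2) = fun q =>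
      ‖(fderiv ℝ u q).comp (ContinuousLinearMap.inl ℝ _ ℝ)‖ ^ 2 + (fderiv ℝ u q (0, 1)) ^ 2 :=
    funext fun q => gradSq_eq_fderiv (hu.differentiable (by simp) _)
  rw [h2]
  exact ((h1.clm_comp continuous_const).norm.pow 2).add ((h1.clm_apply continuous_const).pow 2)

theorem gradSq_eq_zero_of_notMem_tsupport {q : EuclideanSpace ℝ (Fin n) × ℝ}
    (hq : q ∉ tsupport u) : gradSq u q.1 q.2 = 0 := by
  have h0 : u =ᶠ[nhds q] 0 := notMem_tsupport_iff_eventuallyEq.1 hq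
  have hd : DifferentiableAt ℝ u (q.1, q.2) := (differentiableAt_const 0).congr_of_eventuallyEq h0
  rw [gradSq_eq_fderiv hd]
  have : fderiv ℝ u (q.1, q.2) = 0 := by
    rw [show (q.1, q.2) = q from rfl, h0.fderiv_eq]; simp
  simp [this]

theorem integrable_gradSq (hu : ContDiff ℝ ∞ u) (hc : HasCompactSupport u) :
    Integrable (fun q : EuclideanSpace ℝ (Fin n) × ℝ => gradSq u q.1 q.2)
      (volume.prod volume) :=
  (continuous_gradSq hu).integrable_of_hasCompactSupport
    (HasCompactSupport.intro hc.isCompact fun _ hq => gradSq_eq_zero_of_notMem_tsupport hq)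

theorem prod_restrict_Ioi_eq (O : Set (EuclideanSpace ℝ (Fin n))) :
    (volume.restrict O).prod (volume.restrict (Ioi (0 : ℝ))) =
      ((volume : Measure (EuclideanSpace ℝ (Fin n))).prod (volume : Measure ℝ)).restrict
        (O ×ˢ Ioi 0) :=
  Measure.prod_restrict _ _

theorem dirichletEnergy_eq_integral_prod (hu : ContDiff ℝ ∞ u) (hc : HasCompactSupport u) :
    dirichletEnergy O u =
      ∫ q, gradSq u q.1 q.2 ∂((volume.restrict O).prod (volume.restrict (Ioi 0))) := by
  rw [integral_prod_symm, dirichletEnergy]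
  rw [prod_restrict_Ioi_eq]
  exact (integrable_gradSq hu hc).restrict

theorem integrable_fderiv_apply {F : EuclideanSpace ℝ (Fin n) × ℝ → ℝ} {D : ℝ≥0}
    (hF : LipschitzWith D F) (hc : HasCompactSupport F)
    {w : EuclideanSpace ℝ (Fin n) × ℝ → EuclideanSpace ℝ (Fin n) × ℝ} (hw : Measurable w)
    {M : ℝ} (hM : ∀ q, ‖w q‖ ≤ M) :
    Integrable (fun q => fderiv ℝ F q (w q)) (volume.prod volume) := by
  refine Integrable.of_bound_of_eq_zero_of_isCompact (M := D * M) hc.isCompact ?_ (fun q => ?_)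
    fun q hq => ?_
  · exact (isBoundedBilinearMap_apply.continuous.measurable.comp
      ((measurable_fderiv ℝ F).prodMk hw)).aestronglyMeasurable
  · refine ((fderiv ℝ F q).le_opNorm _).trans ?_
    exact mul_le_mul (norm_fderiv_le_of_lipschitz ℝ hF) (hM q) (norm_nonneg _) D.2
  · have : fderiv ℝ F q = 0 := by
      by_contra h
      exact hq (support_fderiv_subset ℝ h)
    simp [this]

namespace IsProfileDistance

/-- Integrate the pointwise identity. The vertical flux is integrated first in `y`, and its value at
`y = 0` gives the boundary weight `(2/π) a / sin (a δ)`. The horizontal flux is left untouched: its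
sign comes from superharmonicity of `d` in one application, and it vanishes by linearity of `δ` in
the other. -/
theorem ground_state_identity (hδ : IsProfileDistance a O δ)
    (hu : IsTestFunction (O ×ˢ (univ : Set ℝ)) u) :
    Integrable (fun q => traceProfile a (δ q.1, q.2) ^ 2 *
      gradSq (profileQuotient a δ u) q.1 q.2)
      ((volume.restrict O).prod (volume.restrict (Ioi 0))) ∧
    Integrable (fun x => 2 / Real.pi * (a / Real.sin (a * δ x)) * u (x, 0) ^ 2)
      (volume.restrict O) ∧
    dirichletEnergy O u =
      (∫ q, traceProfile a (δ q.1, q.2) ^ 2 * gradSq (profileQuotient a δ u) q.1 q.2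
        ∂((volume.restrict O).prod (volume.restrict (Ioi 0)))) +
      (∫ y in Ioi (0 : ℝ), ∫ x in O,
        inner ℝ (gradient δ x) (gradient (fun x' => profileFluxFst a δ u (x', y)) x)) +
      ∫ x in O, 2 / Real.pi * (a / Real.sin (a * δ x)) * u (x, 0) ^ 2 := by
  obtain ⟨D1, hF⟩ := hδ.exists_lipschitzWith_fluxFst hu
  obtain ⟨D2, hG⟩ := hδ.exists_lipschitzWith_fluxSnd hu
  have hsq : HasCompactSupport fun q => u q ^ 2 := hu.2.1.comp_left (g := fun t => t ^ 2) (by simp)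
  have hFc : HasCompactSupport (profileFluxFst a δ u) := hsq.mul_left
  have hGc : HasCompactSupport (profileFluxSnd a δ u) := hsq.mul_left
  set μ := (volume.restrict O).prod (volume.restrict (Ioi (0 : ℝ))) with hμ
  have hrestr : ∀ {f : EuclideanSpace ℝ (Fin n) × ℝ → ℝ}, Integrable f (volume.prod volume) →
      Integrable f μ := fun hf => by
    rw [hμ, prod_restrict_Ioi_eq]; exact hf.restrict
  have hgδ : ∀ x, ‖gradient δ x‖ ≤ 1 := fun x => by
    rw [norm_gradient_eq_norm_fderiv]; exact norm_fderiv_le_of_lipschitz ℝ hδ.lipschitz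
  have hI1 := hrestr (integrable_fderiv_apply hF hFc (w := fun q => (gradient δ q.1, 0)) (M := 1)
    (((measurable_gradient δ).comp measurable_fst).prodMk measurable_const)
    fun q => by simpa [Prod.norm_def] using hgδ q.1)
  have hI2 := hrestr (integrable_fderiv_apply hG hGc (w := fun _ => (0, 1)) (M := 1)
    measurable_const fun q => by simp [Prod.norm_def])
  have hI0 := hrestr (integrable_gradSq hu.1 hu.2.1)
  have hFd := hδ.ae_differentiableAt_fluxFst hu.1
  have hGd := hδ.ae_differentiableAt_fluxSnd hu.1
  have hF1 : ∀ {x y}, DifferentiableAt ℝ (profileFluxFst a δ u) (x, y) →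
      inner ℝ (gradient δ x) (gradient (fun x' => profileFluxFst a δ u (x', y)) x) =
        fderiv ℝ (profileFluxFst a δ u) (x, y) (gradient δ x, 0) := fun {x y} h => by
    rw [real_inner_comm, inner_gradient_eq_fderiv]
    have : HasFDerivAt (fun x' => profileFluxFst a δ u (x', y)) _ x :=
      HasFDerivAt.comp (g := profileFluxFst a δ u) x h.hasFDerivAt (hasFDerivAt_prodMk_left x y)
    rw [this.fderiv]; rfl
  have hG1 : ∀ {x y}, DifferentiableAt ℝ (profileFluxSnd a δ u) (x, y) →
      deriv (fun y' => profileFluxSnd a δ u (x, y')) y =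
        fderiv ℝ (profileFluxSnd a δ u) (x, y) (0, 1) := fun {x y} h => by
    have := (HasFDerivAt.comp (g := profileFluxSnd a δ u) y h.hasFDerivAt
      (hasFDerivAt_prodMk_right x y)).hasDerivAt
    exact (this.congr_deriv (by simp)).deriv
  have hident : ∀ᵐ x ∂(volume.restrict O), ∀ y,
      gradSq u x y = traceProfile a (δ x, y) ^ 2 * gradSq (profileQuotient a δ u) x y +
        fderiv ℝ (profileFluxFst a δ u) (x, y) (gradient δ x, 0) +
        fderiv ℝ (profileFluxSnd a δ u) (x, y) (0, 1) := by
    filter_upwards [hδ.norm_gradient, hFd, hGd, ae_restrict_mem hδ.isOpen.measurableSet]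
      with x hx hx1 hx2 hxO y
    rw [gradSq_eq_profile (hδ.sin_pos hxO) hx.1 hx.2 (hu.1.differentiable (by simp) _),
      hF1 (hx1 y), hG1 (hx2 y)]
  have hident' : ∀ᵐ q ∂μ,
      gradSq u q.1 q.2 = traceProfile a (δ q.1, q.2) ^ 2 * gradSq (profileQuotient a δ u) q.1 q.2 +
        fderiv ℝ (profileFluxFst a δ u) q (gradient δ q.1, 0) +
        fderiv ℝ (profileFluxSnd a δ u) q (0, 1) := by
    filter_upwards [Measure.quasiMeasurePreserving_fst.ae hident] with q hq
    exact hq q.2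
  -- Integrability is read off from the identity, the three other terms being bounded with compact
  -- support.
  have hI3 : Integrable (fun q => traceProfile a (δ q.1, q.2) ^ 2 *
      gradSq (profileQuotient a δ u) q.1 q.2) μ := by
    refine ((hI0.sub hI1).sub hI2).congr ?_
    filter_upwards [hident'] with q hq
    simp only [Pi.sub_apply]
    rw [hq]; ring
  have hslice : ∀ x ∈ O, ∫ y in Ioi (0 : ℝ), deriv (fun y' => profileFluxSnd a δ u (x, y')) y =
      2 / Real.pi * (a / Real.sin (a * δ x)) * u (x, 0) ^ 2 := by
    intro x hx
    have hs := hδ.sin_pos hx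
    rw [(hGc.slice_snd x).integral_Ioi_deriv_eq]
    · simp only [profileFluxSnd]
      rw [traceProfileSnd_zero hs.ne', traceProfile_zero]
      ring
    · refine ContDiff.mul ?_ ?_
      · refine contDiff_iff_contDiffAt.2 fun y => ?_
        have h1 : ContDiffAt ℝ ∞ (fun y : ℝ => (δ x, y)) y :=
          contDiffAt_const.prodMk contDiffAt_id
        have h2 := ((contDiffAt_traceProfileSnd (a := a) (z := (δ x, y)) hs).comp y h1).div
          ((contDiffAt_traceProfile (a := a) (z := (δ x, y)) hs).comp y h1)
          (traceProfile_pos _ _).ne'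
        exact h2.of_le (by simp)
      · exact ((hu.1.comp (contDiff_const.prodMk contDiff_id)).pow 2).of_le (by simp)
  have hJ2 : ∀ᵐ x ∂(volume.restrict O),
      ∫ y in Ioi (0 : ℝ), fderiv ℝ (profileFluxSnd a δ u) (x, y) (0, 1) =
      2 / Real.pi * (a / Real.sin (a * δ x)) * u (x, 0) ^ 2 := by
    filter_upwards [hGd, ae_restrict_mem hδ.isOpen.measurableSet] with x hx hxO
    rw [← hslice x hxO]
    exact integral_congr_ae (ae_of_all _ fun y => (hG1 (hx y)).symm)
  refine ⟨hI3, hI2.integral_prod_left.congr hJ2, ?_⟩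
  rw [dirichletEnergy_eq_integral_prod hu.1 hu.2.1, ← hμ, integral_congr_ae hident',
    integral_add (by exact hI3.add hI1) hI2, integral_add hI3 hI1]
  congr 1
  · congr 1
    rw [hμ, integral_prod_symm _ hI1]
    refine integral_congr_ae (ae_of_all _ fun y => integral_congr_ae ?_)
    filter_upwards [hFd] with x hx
    exact (hF1 (hx y)).symm
  · rw [hμ, integral_prod _ hI2]
    exact integral_congr_ae hJ2

end IsProfileDistance

end groundState

/-! ### The Hardy inequality with remainder, and the Hardy–Sobolev inequality -/

section bdryDist

variable {n : ℕ} {Ω : Set (EuclideanSpace ℝ (Fin n))}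

/-- Along the segment towards a nearest boundary point the distance decreases linearly at unit
speed, so the derivative in that direction has the largest size the Lipschitz bound permits. A
one-sided derivative at the start of the segment suffices. -/
theorem norm_gradient_bdryDist (hne : (frontier Ω).Nonempty) {x : EuclideanSpace ℝ (Fin n)}
    (hx : 0 < bdryDist Ω x) (hd : DifferentiableAt ℝ (bdryDist Ω) x) :
    ‖gradient (bdryDist Ω) x‖ = 1 := by
  obtain ⟨z, hz, hzx⟩ := isClosed_frontier.exists_infDist_eq_dist hne x
  have hlip := lipschitzWith_bdryDist Ω
  set w := z - x with hw
  have hwn : ‖w‖ = bdryDist Ω x := by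
    rw [hw, ← dist_eq_norm, dist_comm]; exact hzx.symm
  have hline : ∀ t ∈ Icc (0 : ℝ) 1, bdryDist Ω (x + t • w) = (1 - t) * bdryDist Ω x := by
    intro t ht
    refine le_antisymm ?_ ?_
    · refine (Metric.infDist_le_dist_of_mem hz).trans (le_of_eq ?_)
      have : x + t • w - z = -((1 - t) • w) := by rw [hw]; module
      rw [dist_eq_norm, this, norm_neg, norm_smul, Real.norm_of_nonneg (by linarith [ht.2]), hwn]
    · have h1 := hlip.dist_le_mul x (x + t • w)
      rw [dist_eq_norm x, show x - (x + t • w) = -(t • w) by abel, norm_neg, norm_smul,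
        Real.norm_of_nonneg ht.1, hwn, Real.dist_eq] at h1
      have h2 := (abs_le.1 h1).2
      simp only [NNReal.coe_one, one_mul] at h2
      linarith
  have h1 : HasDerivAt (fun t : ℝ => bdryDist Ω (x + t • w)) (fderiv ℝ (bdryDist Ω) x w) 0 := by
    have h2 : HasDerivAt (fun t : ℝ => x + t • w) w 0 := by
      simpa using ((hasDerivAt_id (0 : ℝ)).smul_const w).const_add x
    refine HasFDerivAt.comp_hasDerivAt (l := bdryDist Ω) 0 ?_ h2
    simpa using hd.hasFDerivAt
  have h3 : HasDerivWithinAt (fun t : ℝ => bdryDist Ω (x + t • w)) (-bdryDist Ω x)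
      (Icc 0 1) 0 := by
    have h4 : HasDerivAt (fun t : ℝ => (1 - t) * bdryDist Ω x) (-bdryDist Ω x) 0 := by
      simpa using ((hasDerivAt_id (0 : ℝ)).const_sub 1).mul_const (bdryDist Ω x)
    exact h4.hasDerivWithinAt.congr hline (hline 0 ⟨le_rfl, zero_le_one⟩)
  have h5 : fderiv ℝ (bdryDist Ω) x w = -bdryDist Ω x :=
    (uniqueDiffOn_Icc (zero_lt_one' ℝ) 0 ⟨le_rfl, zero_le_one⟩).eq_deriv _
      h1.hasDerivWithinAt h3
  rw [norm_gradient_eq_norm_fderiv]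
  refine le_antisymm (norm_fderiv_le_of_lipschitz ℝ hlip) ?_
  have h6 := (fderiv ℝ (bdryDist Ω) x).le_opNorm w
  rw [h5, norm_neg, Real.norm_of_nonneg hx.le, hwn] at h6
  exact le_of_mul_le_mul_right (by linarith) hx

theorem isProfileDistance_bdryDist (hΩ : IsOpen Ω) (hne : (frontier Ω).Nonempty) {R : ℝ}
    (hR0 : 0 < R) (hR : ∀ x ∈ Ω, bdryDist Ω x ≤ R) : IsProfileDistance (1 / R) Ω (bdryDist Ω) where
  isOpen := hΩ
  lipschitz := lipschitzWith_bdryDist Ω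
  mul_mem x hx := by
    have := bdryDist_pos hΩ hne hx
    refine ⟨by positivity, ?_⟩
    rw [one_div, inv_mul_le_iff₀ hR0, mul_one]
    exact hR x hx
  norm_gradient := by
    filter_upwards [ae_restrict_mem hΩ.measurableSet,
      ae_restrict_of_ae ((lipschitzWith_bdryDist Ω).ae_differentiableAt (μ := volume))] with x hx hd
    exact ⟨hd, norm_gradient_bdryDist hne (bdryDist_pos hΩ hne hx) hd⟩

variable {u : EuclideanSpace ℝ (Fin n) × ℝ → ℝ} {a : ℝ}

/-- For each `y > 0` the flux density is a nonnegative Lipschitz function of `x` with compact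
support in `Ω`, because the profile increases in its first variable. It can therefore be tested
against `-Δd ≥ 0`. -/
theorem integral_fluxFst_nonneg (ha : 0 ≤ a) (hδ : IsProfileDistance a Ω (bdryDist Ω))
    (hmc : IsWeaklyMeanConvex Ω) (hu : IsTestFunction (Ω ×ˢ (univ : Set ℝ)) u) :
    0 ≤ ∫ y in Ioi (0 : ℝ), ∫ x in Ω, inner ℝ (gradient (bdryDist Ω) x)
      (gradient (fun x' => profileFluxFst a (bdryDist Ω) u (x', y)) x) := by
  refine setIntegral_nonneg measurableSet_Ioi fun y hy => ?_
  obtain ⟨D, hF⟩ := hδ.exists_lipschitzWith_fluxFst hu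
  have hsq : HasCompactSupport fun q => u q ^ 2 := hu.2.1.comp_left (g := fun t => t ^ 2) (by simp)
  have hFc : HasCompactSupport (profileFluxFst a (bdryDist Ω) u) := hsq.mul_left
  have h1 : tsupport (profileFluxFst a (bdryDist Ω) u) ⊆ tsupport u :=
    closure_mono fun q hq (h : u q = 0) => hq (by simp [profileFluxFst, h])
  have hs : tsupport (fun x => profileFluxFst a (bdryDist Ω) u (x, y)) ⊆ Ω := fun x hx =>
    (hu.2.2 (h1 (tsupport_slice_fst_subset _ y hx))).1
  have hlip : LipschitzWith (D * 1) fun x => profileFluxFst a (bdryDist Ω) u (x, y) :=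
    hF.comp (LipschitzWith.prodMk_right y)
  have h2 := hmc.integral_inner_gradient_nonneg hδ.isOpen hlip (hFc.slice_fst y) hs fun x => by
    by_cases hx : x ∈ Ω
    · refine mul_nonneg (div_nonneg ?_ (traceProfile_pos _ _).le) (sq_nonneg _)
      exact traceProfileFst_nonneg ha (hδ.mul_mem x hx) (le_of_lt hy)
    · have : u (x, y) = 0 := by
        by_contra h
        exact hx (hu.2.2 (subset_tsupport u h)).1
      simp [profileFluxFst, this]
  rwa [setIntegral_eq_integral_of_forall_compl_eq_zero]
  intro x hx
  rw [gradient_eq_zero_of_notMem_tsupport fun h => hx (hs h), inner_zero_right]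

theorem traceHardyTerm_add_le (ha : 0 < a) (hδ : IsProfileDistance a Ω (bdryDist Ω))
    (hmc : IsWeaklyMeanConvex Ω) (hu : IsTestFunction (Ω ×ˢ (univ : Set ℝ)) u) :
    2 / Real.pi * traceHardyTerm Ω u +
      2 / Real.pi * (a ^ 2 / 12) * (∫ x in Ω, bdryDist Ω x * u (x, 0) ^ 2) +
      (∫ q, traceProfile a (bdryDist Ω q.1, q.2) ^ 2 *
        gradSq (profileQuotient a (bdryDist Ω) u) q.1 q.2
        ∂((volume.restrict Ω).prod (volume.restrict (Ioi 0)))) ≤ dirichletEnergy Ω u := by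
  obtain ⟨-, hI, hE⟩ := hδ.ground_state_identity hu
  have hflux := integral_fluxFst_nonneg ha.le hδ hmc hu
  have hu0 : Continuous fun x => u (x, 0) := hu.1.continuous.comp (by fun_prop)
  have hpt : ∀ x ∈ Ω, 2 / Real.pi * (u (x, 0) ^ 2 / bdryDist Ω x) +
      2 / Real.pi * (a ^ 2 / 12) * (bdryDist Ω x * u (x, 0) ^ 2) ≤
      2 / Real.pi * (a / Real.sin (a * bdryDist Ω x)) * u (x, 0) ^ 2 := fun x hx => by
    have h1 := inv_add_mul_le_div_sin ha (hδ.mul_mem x hx)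
    calc _ = 2 / Real.pi * (1 / bdryDist Ω x + a ^ 2 / 12 * bdryDist Ω x) * u (x, 0) ^ 2 := by ring
      _ ≤ _ := by gcongr
  have hmem := ae_restrict_mem (μ := volume) hδ.isOpen.measurableSet
  have hd0 : ∀ x, 0 ≤ bdryDist Ω x := fun x => bdryDist_nonneg x
  have hI1 : Integrable (fun x => 2 / Real.pi * (u (x, 0) ^ 2 / bdryDist Ω x))
      (volume.restrict Ω) := by
    refine hI.mono' (((hu0.pow 2).measurable.div
      (continuous_bdryDist Ω).measurable).const_mul _).aestronglyMeasurable ?_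
    filter_upwards [hmem] with x hx
    have := hd0 x
    rw [Real.norm_of_nonneg (by positivity)]
    have h2 : 0 ≤ 2 / Real.pi * (a ^ 2 / 12) * (bdryDist Ω x * u (x, 0) ^ 2) := by positivity
    linarith [hpt x hx]
  have hI2 : Integrable (fun x => 2 / Real.pi * (a ^ 2 / 12) * (bdryDist Ω x * u (x, 0) ^ 2))
      (volume.restrict Ω) := by
    refine hI.mono' (((continuous_bdryDist Ω).mul (hu0.pow 2)).measurable.const_mul
      _).aestronglyMeasurable ?_
    filter_upwards [hmem] with x hx
    have := hd0 x
    rw [Real.norm_of_nonneg (by positivity)]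
    have h2 : 0 ≤ 2 / Real.pi * (u (x, 0) ^ 2 / bdryDist Ω x) := by positivity
    linarith [hpt x hx]
  have h3 := integral_mono_ae (hI1.add hI2) hI (by
    filter_upwards [hmem] with x hx using hpt x hx)
  simp only [Pi.add_apply] at h3
  rw [integral_add hI1 hI2, integral_const_mul, integral_const_mul] at h3
  rw [hE, traceHardyTerm]
  linarith

/-- Undo the substitution `y = t d(x)`, whose Jacobian is the weight `d`, and use the lower bound
for the profile on the cone; extending the `y` integral to the whole half-line only adds nonnegative
terms. -/
theorem lintegral_cone_fderiv_le {R : ℝ} (hΩ : IsOpen Ω) (hne : (frontier Ω).Nonempty)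
    (hR0 : 0 < R) (hR : ∀ x ∈ Ω, bdryDist Ω x ≤ R)
    (hu : IsTestFunction (Ω ×ˢ (univ : Set ℝ)) u) :
    ∫⁻ q, ENNReal.ofReal (bdryDist Ω q.1) *
        ‖fderiv ℝ (profileQuotient (1 / R) (bdryDist Ω) u) (coneMap Ω q)‖ₑ ^ (2 : ℝ)
          ∂(coneMeasure Ω) ≤
      ENNReal.ofReal (2 / (1 - 2 / Real.pi * Real.arctan 4) ^ 2 *
        ∫ q, traceProfile (1 / R) (bdryDist Ω q.1, q.2) ^ 2 *
          gradSq (profileQuotient (1 / R) (bdryDist Ω) u) q.1 q.2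
          ∂((volume.restrict Ω).prod (volume.restrict (Ioi 0)))) := by
  have hδ := isProfileDistance_bdryDist hΩ hne hR0 hR
  set v := profileQuotient (1 / R) (bdryDist Ω) u with hv
  set c0 := 1 - 2 / Real.pi * Real.arctan 4 with hc0
  have hc0pos : 0 < c0 := by
    have h1 := Real.arctan_lt_pi_div_two 4
    have h2 : 2 / Real.pi * Real.arctan 4 < 2 / Real.pi * (Real.pi / 2) := by gcongr
    have h3 : 2 / Real.pi * (Real.pi / 2) = 1 := by field_simp
    rw [hc0]; linarith
  obtain ⟨hI, -, -⟩ := hδ.ground_state_identity hu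
  have hmd := measurable_ofReal_bdryDist_fst (Ω := Ω)
  have hmB := measurable_enorm_fderiv_comp_coneMap (Ω := Ω) (v := v)
  have hdiff := hδ.ae_differentiableAt_quotient hu.1
  have hg0 : ∀ x y, 0 ≤ gradSq v x y := fun x y => by unfold gradSq; positivity
  rw [← integral_const_mul, ofReal_integral_eq_lintegral_ofReal (hI.const_mul _)
    (ae_of_all _ fun q => by have := hg0 q.1 q.2; positivity),
    lintegral_prod _ (hI.const_mul _).1.aemeasurable.ennreal_ofReal,
    lintegral_coneMeasure (by exact hmd.mul (hmB.pow_const _))]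
  refine lintegral_mono_ae ?_
  filter_upwards [hdiff, ae_restrict_mem hΩ.measurableSet] with x hx hxΩ
  have hd0 := bdryDist_pos hΩ hne hxΩ
  rw [lintegral_const_mul' _ _ ENNReal.ofReal_ne_top]
  refine (le_of_eq (setLIntegral_Ioc_eq_mul hd0
    (fun y => ‖fderiv ℝ v (x, y)‖ₑ ^ (2 : ℝ))).symm).trans ?_
  refine le_trans ?_ (lintegral_mono_set (fun y hy => hy.1 : Ioc 0 (bdryDist Ω x) ⊆ Ioi 0))
  refine setLIntegral_mono' measurableSet_Ioc fun y hy => ?_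
  rw [← ofReal_norm, ENNReal.ofReal_rpow_of_nonneg (norm_nonneg _) (by norm_num)]
  refine ENNReal.ofReal_le_ofReal ?_
  rw [Real.rpow_two]
  have h1 : c0 ≤ traceProfile (1 / R) (bdryDist Ω x, y) :=
    traceProfile_lower_bound (by positivity) (hδ.mul_mem x hxΩ) hy.2
  have h2 := hg0 x y
  calc ‖fderiv ℝ v (x, y)‖ ^ 2 ≤ 2 * gradSq v x y := norm_fderiv_prod_sq_le (hx y)
    _ = 2 / c0 ^ 2 * (c0 ^ 2 * gradSq v x y) := by field_simp
    _ ≤ _ := by gcongr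

theorem lintegral_bdryDist_mul_sq {f : EuclideanSpace ℝ (Fin n) → ℝ} (hf : Continuous f)
    (hc : HasCompactSupport f) :
    ∫⁻ x in Ω, ENNReal.ofReal (bdryDist Ω x) * ‖f x‖ₑ ^ (2 : ℝ) =
      ENNReal.ofReal (∫ x in Ω, bdryDist Ω x * f x ^ 2) := by
  have h1 : Continuous fun x => bdryDist Ω x * f x ^ 2 := (continuous_bdryDist Ω).mul (hf.pow 2)
  have h2 : HasCompactSupport fun x => bdryDist Ω x * f x ^ 2 :=
    (hc.comp_left (g := fun t => t ^ 2) (by simp)).mul_left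
  rw [ofReal_integral_eq_lintegral_ofReal (h1.integrable_of_hasCompactSupport h2).restrict
    (ae_of_all _ fun x => mul_nonneg (bdryDist_nonneg x) (sq_nonneg _))]
  refine lintegral_congr fun x => ?_
  rw [← ofReal_norm, ENNReal.ofReal_rpow_of_nonneg (norm_nonneg _) (by norm_num),
    ← ENNReal.ofReal_mul (bdryDist_nonneg x), Real.rpow_two, Real.norm_eq_abs, sq_abs]

theorem integral_abs_rpow_eq_toReal {f : EuclideanSpace ℝ (Fin n) → ℝ} (hf : Continuous f)
    {p : ℝ} (hp : 0 ≤ p) :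
    ∫ x in Ω, |f x| ^ p = (∫⁻ x in Ω, ‖f x‖ₑ ^ p).toReal := by
  rw [integral_eq_lintegral_of_nonneg_ae (ae_of_all _ fun x => by positivity)
    ((hf.abs.rpow_const fun _ => Or.inr hp).aestronglyMeasurable)]
  congr 1
  refine lintegral_congr fun x => ?_
  rw [← ofReal_norm, ENNReal.ofReal_rpow_of_nonneg (norm_nonneg _) hp, Real.norm_eq_abs]

theorem exists_traceSobolev_le (hn : 2 ≤ n) (hΩ : IsDomainSet Ω) (hne : Ω ≠ univ)
    (hLip : IsUniformlyLipschitz Ω) (hR : HasFiniteInnerRadius Ω) (hmc : IsWeaklyMeanConvex Ω) :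
    ∃ c : ℝ, 0 < c ∧ ∀ u : EuclideanSpace ℝ (Fin n) × ℝ → ℝ,
      IsTestFunction (Ω ×ˢ (univ : Set ℝ)) u →
        2 / Real.pi * traceHardyTerm Ω u + c * traceSobolevTerm Ω u ≤ dirichletEnergy Ω u := by
  have hfr : (frontier Ω).Nonempty := nonempty_frontier_iff.2 ⟨hΩ.2.nonempty, hne⟩
  have hn' : (2 : ℝ) ≤ n := by exact_mod_cast hn
  have hn1 : (0 : ℝ) < (n : ℝ) - 1 := by linarith
  set p : ℝ := 2 * (n : ℝ) / ((n : ℝ) - 1) with hp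
  have hp0 : 0 < p := by positivity
  have hs0 : (0 : ℝ) < ((n : ℝ) - 1) / n := by positivity
  obtain ⟨C, hC0, hC⟩ := exists_lintegral_trace_rpow_le hn hΩ.1 hfr hLip hR hp
  obtain ⟨R, hR0, hR⟩ : ∃ R : ℝ, 0 < R ∧ ∀ x ∈ Ω, bdryDist Ω x ≤ R := by
    obtain ⟨R, hR⟩ := hR
    exact ⟨max R 1, by positivity, fun x hx => (hR ⟨x, hx, rfl⟩).trans (le_max_left _ _)⟩
  have hδ := isProfileDistance_bdryDist hΩ.1 hfr hR0 hR
  set c1 : ℝ := 2 / Real.pi * ((1 / R) ^ 2 / 12) with hc1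
  set c2 : ℝ := 2 / (1 - 2 / Real.pi * Real.arctan 4) ^ 2 with hc2
  have hc1pos : 0 < c1 := by positivity
  have hc2nn : 0 ≤ c2 := by positivity
  have hC0' : (0 : ℝ) < C := hC0
  set m : ℝ := C * (1 / c1 + c2) with hm
  have hmpos : 0 < m := by positivity
  -- The constant `m` is taken so that `C (H + c2 Q) ≤ m (c1 H + Q)`, where `c1 H + Q` is the
  -- remainder left by the Hardy inequality.
  refine ⟨1 / m, by positivity, fun u hu => ?_⟩
  set v := profileQuotient (1 / R) (bdryDist Ω) u with hv
  have hmain := traceHardyTerm_add_le (a := 1 / R) (by positivity) hδ hmc hu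
  have hcone := lintegral_cone_fderiv_le hΩ.1 hfr hR0 hR hu
  obtain ⟨D, hD⟩ := hδ.exists_lipschitzWith_quotient hu
  have hvc : HasCompactSupport v := hu.2.1.mul_left
  have hvs : tsupport v ⊆ Ω ×ˢ univ := tsupport_mul_subset_right.trans hu.2.2
  have key := hC v D hD hvc hvs (hδ.ae_differentiableAt_quotient hu.1)
  have hv0 : ∀ x, v (x, 0) = u (x, 0) := fun x => by
    simp [hv, profileQuotient, traceProfile_zero]
  simp only [hv0] at key
  set H : ℝ := ∫ x in Ω, bdryDist Ω x * u (x, 0) ^ 2 with hH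
  set Q : ℝ := ∫ q, traceProfile (1 / R) (bdryDist Ω q.1, q.2) ^ 2 * gradSq v q.1 q.2
    ∂((volume.restrict Ω).prod (volume.restrict (Ioi 0))) with hQ
  have hg0 : ∀ x y, 0 ≤ gradSq v x y := fun x y => by unfold gradSq; positivity
  have hQ0 : 0 ≤ Q := integral_nonneg fun q => by have := hg0 q.1 q.2; positivity
  have hH0 : 0 ≤ H := integral_nonneg fun x => by
    have := bdryDist_nonneg (Ω := Ω) x; positivity
  have hu0 : Continuous fun x => u (x, 0) := hu.1.continuous.comp (by fun_prop)
  have hHe := lintegral_bdryDist_mul_sq (Ω := Ω) hu0 (hu.2.1.slice_fst 0)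
  have hle : (∫⁻ x in Ω, ‖u (x, 0)‖ₑ ^ p) ^ (((n : ℝ) - 1) / n) ≤
      ENNReal.ofReal (C * (H + c2 * Q)) := by
    refine key.trans ?_
    rw [ENNReal.ofReal_mul hC0'.le, ENNReal.ofReal_add hH0 (by positivity),
      ENNReal.ofReal_coe_nnreal, hHe]
    gcongr
  have hS : traceSobolevTerm Ω u ≤ C * (H + c2 * Q) := by
    have h1 := integral_abs_rpow_eq_toReal (Ω := Ω) hu0 hp0.le
    rw [traceSobolevTerm, ← hp, h1, ENNReal.toReal_rpow]
    exact ENNReal.toReal_le_of_le_ofReal (by positivity) hle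
  have hfin : traceSobolevTerm Ω u ≤ m * (c1 * H + Q) := by
    refine hS.trans ?_
    have h2 : m * (c1 * H + Q) = C * (H + c2 * Q) + C * (c1 * c2 * H + 1 / c1 * Q) := by
      rw [hm]; field_simp; ring
    have h3 : 0 ≤ C * (c1 * c2 * H + 1 / c1 * Q) := by positivity
    linarith
  have h4 : 1 / m * traceSobolevTerm Ω u ≤ c1 * H + Q := by
    rw [one_div, inv_mul_le_iff₀ hmpos]; exact hfin
  rw [← hc1] at hmain
  linarith

end bdryDist

/-! ### Blow-up at a differentiability point of the boundary -/

section blowup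

open Topology

variable {n : ℕ} {Ω U : Set (EuclideanSpace ℝ (Fin n))} {ν : EuclideanSpace ℝ (Fin n)}
  {g : ((ℝ ∙ ν)ᗮ : Submodule ℝ (EuclideanSpace ℝ (Fin n))) → ℝ}

theorem orthogonalProjectionOnto_add_inner_smul (hν : ‖ν‖ = 1) (x : EuclideanSpace ℝ (Fin n)) :
    (((ℝ ∙ ν)ᗮ.orthogonalProjectionOnto x : ((ℝ ∙ ν)ᗮ : Submodule ℝ _)) :
      EuclideanSpace ℝ (Fin n)) + inner ℝ ν x • ν = x := by
  have h1 := (ℝ ∙ ν).starProjection_add_starProjection_orthogonal x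
  rw [Submodule.starProjection_unit_singleton ℝ hν, add_comm] at h1
  exact h1

theorem orthogonalProjectionOnto_orthogonal_self :
    (ℝ ∙ ν)ᗮ.orthogonalProjectionOnto ν = 0 := by
  rw [Submodule.orthogonalProjectionOnto_eq_zero_iff]
  exact Submodule.le_orthogonal_orthogonal _ (Submodule.mem_span_singleton_self ν)

theorem orthogonalProjectionOnto_coe_add_smul (p : ((ℝ ∙ ν)ᗮ : Submodule ℝ _)) (t : ℝ) :
    (ℝ ∙ ν)ᗮ.orthogonalProjectionOnto ((p : EuclideanSpace ℝ (Fin n)) + t • ν) = p := by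
  rw [map_add, map_smul, orthogonalProjectionOnto_orthogonal_self, smul_zero, add_zero,
    Submodule.orthogonalProjectionOnto_mem_subspace_eq_self]

theorem inner_coe_add_smul (hν : ‖ν‖ = 1) (p : ((ℝ ∙ ν)ᗮ : Submodule ℝ _)) (t : ℝ) :
    inner ℝ ν ((p : EuclideanSpace ℝ (Fin n)) + t • ν) = t := by
  have h1 : inner ℝ ν (p : EuclideanSpace ℝ (Fin n)) = 0 :=
    Submodule.mem_orthogonal_singleton_iff_inner_right.1 p.2
  rw [inner_add_right, h1, real_inner_smul_right, real_inner_self_eq_norm_sq, hν]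
  ring

theorem coe_add_smul_mem_epigraphAlong (hν : ‖ν‖ = 1) (p : ((ℝ ∙ ν)ᗮ : Submodule ℝ _)) (t : ℝ) :
    (p : EuclideanSpace ℝ (Fin n)) + t • ν ∈ epigraphAlong ν g ↔ g p < t := by
  rw [epigraphAlong, mem_ofPred_eq, orthogonalProjectionOnto_coe_add_smul, inner_coe_add_smul hν]

/-- Inside the chart, the line in direction `ν` over `p` enters `Ω` precisely at height `g p`. The
graph point is thus a limit of points of `Ω` without belonging to it. -/
theorem graph_mem_frontier (hΩ : IsOpen Ω) (hU : IsOpen U) (hν : ‖ν‖ = 1)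
    (h : Ω ∩ U = epigraphAlong ν g ∩ U) (p : ((ℝ ∙ ν)ᗮ : Submodule ℝ _))
    (hp : (p : EuclideanSpace ℝ (Fin n)) + g p • ν ∈ U) :
    (p : EuclideanSpace ℝ (Fin n)) + g p • ν ∈ frontier Ω := by
  have hmem : ∀ t : ℝ, (p : EuclideanSpace ℝ (Fin n)) + t • ν ∈ U →
      ((p : EuclideanSpace ℝ (Fin n)) + t • ν ∈ Ω ↔ g p < t) := fun t ht => by
    have := Set.ext_iff.1 h ((p : EuclideanSpace ℝ (Fin n)) + t • ν)
    rw [mem_inter_iff, mem_inter_iff, coe_add_smul_mem_epigraphAlong hν] at this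
    tauto
  rw [hΩ.frontier_eq]
  refine ⟨?_, fun hm => lt_irrefl _ ((hmem _ hp).1 hm)⟩
  have hc : Continuous fun t : ℝ => (p : EuclideanSpace ℝ (Fin n)) + t • ν := by fun_prop
  have h1 : ∀ᶠ t in 𝓝[>] (g p), (p : EuclideanSpace ℝ (Fin n)) + t • ν ∈ Ω := by
    filter_upwards [(hc.continuousAt.eventually (hU.mem_nhds hp)).filter_mono nhdsWithin_le_nhds,
      self_mem_nhdsWithin] with t ht1 ht2
    exact (hmem t ht1).2 ht2
  exact mem_closure_of_tendsto (hc.continuousAt.mono_left nhdsWithin_le_nhds) h1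

theorem inner_eq_of_mem_frontier (hΩ : IsOpen Ω) (hU : IsOpen U) (hg : Continuous g)
    (h : Ω ∩ U = epigraphAlong ν g ∩ U) {z : EuclideanSpace ℝ (Fin n)} (hz : z ∈ frontier Ω)
    (hzU : z ∈ U) : inner ℝ ν z = g ((ℝ ∙ ν)ᗮ.orthogonalProjectionOnto z) := by
  rw [hΩ.frontier_eq] at hz
  refine le_antisymm ?_ ?_
  · by_contra! hlt
    have : z ∈ Ω ∩ U := by rw [h]; exact ⟨hlt, hzU⟩
    exact hz.2 this.1
  · have h1 : z ∈ closure (Ω ∩ U) := by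
      rw [inter_comm]
      exact hU.inter_closure ⟨hzU, hz.1⟩
    rw [h] at h1
    refine closure_minimal (fun x hx => ?_) (isClosed_le
      (hg.comp (ℝ ∙ ν)ᗮ.orthogonalProjectionOnto.continuous) (by fun_prop)) h1
    exact (show g ((ℝ ∙ ν)ᗮ.orthogonalProjectionOnto x) < inner ℝ ν x from hx.1).le

/-- Near a suitable boundary point a uniformly Lipschitz set looks like a half-space. -/
theorem IsUniformlyLipschitz.exists_blowup (hLip : IsUniformlyLipschitz Ω) (hΩ : IsOpen Ω)
    (hne : (frontier Ω).Nonempty) : ∃ z N : EuclideanSpace ℝ (Fin n), ‖N‖ = 1 ∧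
      ∀ K : Set (EuclideanSpace ℝ (Fin n)), IsCompact K → (∀ w ∈ K, 0 < inner ℝ N w) →
        ∀ τ : ℝ, 0 < τ → ∃ ρ : ℝ, 0 < ρ ∧ ∀ w ∈ K,
          z + ρ • w ∈ Ω ∧ bdryDist Ω (z + ρ • w) ≤ ρ * (inner ℝ N w + τ) := by
  obtain ⟨ε, L, -, U, hε, hU, hcov, -, hgraph⟩ := hLip
  obtain ⟨z1, hz1⟩ := hne
  obtain ⟨i, hi⟩ := hcov z1 hz1
  obtain ⟨ν, g, hν, hg, hgr⟩ := hgraph i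
  have hz1U : z1 ∈ U i := hi (Metric.mem_ball_self hε)
  have hz1g := inner_eq_of_mem_frontier hΩ (hU i) hg.continuous hgr hz1 hz1U
  set Pr := (ℝ ∙ ν)ᗮ.orthogonalProjectionOnto with hPr
  have hdec : ∀ x, ((Pr x : ((ℝ ∙ ν)ᗮ : Submodule ℝ (EuclideanSpace ℝ (Fin n)))) : EuclideanSpace ℝ (Fin n)) + inner ℝ ν x • ν = x :=
    orthogonalProjectionOnto_add_inner_smul hν
  set φ : ((ℝ ∙ ν)ᗮ : Submodule ℝ (EuclideanSpace ℝ (Fin n))) → EuclideanSpace ℝ (Fin n) := fun p => (p : EuclideanSpace ℝ (Fin n)) + g p • ν with hφ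
  have hφc : Continuous φ := by
    have := hg.continuous
    fun_prop
  have hφz : φ (Pr z1) = z1 := by
    have := hdec z1
    rw [hz1g] at this
    exact this
  -- By Rademacher's theorem the points of differentiability are dense, so one exists whose graph
  -- point still lies in the open chart.
  obtain ⟨p, hpd, hpU⟩ : ∃ p, DifferentiableAt ℝ g p ∧ φ p ∈ U i := by
    have hdense : Dense {p | DifferentiableAt ℝ g p} :=
      Measure.dense_of_ae (hg.ae_differentiableAt (μ := (volume : Measure ((ℝ ∙ ν)ᗮ : Submodule ℝ (EuclideanSpace ℝ (Fin n))))))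
    obtain ⟨p, hp1, hp2⟩ := hdense.inter_open_nonempty (φ ⁻¹' U i) ((hU i).preimage hφc)
      ⟨Pr z1, by rw [mem_preimage, hφz]; exact hz1U⟩
    exact ⟨p, hp2, hp1⟩
  obtain ⟨r0, hr0, hball⟩ := Metric.isOpen_iff.1 (hU i) _ hpU
  set l := fderiv ℝ g p with hl
  -- `A` is the linearised height above the graph. Its kernel is the tangent hyperplane, and it is
  -- nonzero because `A ν = 1`; normalising its representing vector gives the inner normal `N`.
  set A : EuclideanSpace ℝ (Fin n) →L[ℝ] ℝ := innerSL ℝ ν - l.comp Pr with hA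
  have hAapp : ∀ w, A w = inner ℝ ν w - l (Pr w) := fun w => by
    simp [hA]
  have hPrν : Pr ν = 0 := orthogonalProjectionOnto_orthogonal_self
  set N' := (InnerProductSpace.toDual ℝ (EuclideanSpace ℝ (Fin n))).symm A with hN'
  have hAN : ∀ w, A w = inner ℝ N' w := fun w => by simp [hN']
  have hN0 : N' ≠ 0 := by
    intro h0
    have h1 := hAapp ν
    rw [hAN, h0, inner_zero_left, hPrν, map_zero, real_inner_self_eq_norm_sq, hν] at h1
    norm_num at h1
  have hlam : 0 < ‖N'‖ := norm_pos_iff.2 hN0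
  set N := ‖N'‖⁻¹ • N' with hN
  have hN1 : ‖N‖ = 1 := by rw [hN, norm_smul, norm_inv, norm_norm, inv_mul_cancel₀ hlam.ne']
  have hAN2 : ∀ w, A w = ‖N'‖ * inner ℝ N w := fun w => by
    rw [hAN, hN, real_inner_smul_left, mul_inv_cancel_left₀ hlam.ne']
  refine ⟨φ p, N, hN1, fun K hK hKpos τ hτ => ?_⟩
  rcases K.eq_empty_or_nonempty with hKe | hKne
  · exact ⟨1, one_pos, fun w hw => by simp [hKe] at hw⟩
  obtain ⟨M, hM1, hM⟩ : ∃ M : ℝ, 1 ≤ M ∧ ∀ w ∈ K, ‖w‖ ≤ M := by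
    obtain ⟨M, hM⟩ := hK.isBounded.exists_norm_le
    exact ⟨max M 1, le_max_right _ _, fun w hw => (hM w hw).trans (le_max_left _ _)⟩
  obtain ⟨w0, hw0, hmin⟩ := hK.exists_isMinOn hKne
    (f := fun w => inner ℝ N w) (by fun_prop)
  set c0 := inner ℝ N w0 with hc0
  have hc0pos : 0 < c0 := hKpos w0 hw0
  -- The bound `1` keeps the comparison boundary point inside the chart, the second bound keeps the
  -- rescaled compact set above the graph, and the third makes the error in the distance at most `ρ
  -- τ`.
  set τ' : ℝ := min 1 (min (‖N'‖ * c0 / (2 * M)) (τ / (2 * M))) with hτ'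
  have hM0 : 0 < M := by linarith
  have hτ'pos : 0 < τ' := by positivity
  have hτ1 : τ' ≤ 1 := min_le_left _ _
  have hτ2 : τ' * (2 * M) ≤ ‖N'‖ * c0 := by
    rw [← le_div_iff₀ (by positivity)]
    exact (min_le_right _ _).trans (min_le_left _ _)
  have hτ3 : τ' * (2 * M) ≤ τ := by
    rw [← le_div_iff₀ (by positivity)]
    exact (min_le_right _ _).trans (min_le_right _ _)
  obtain ⟨r1, hr1, hlo⟩ : ∃ r1 > 0, ∀ h : ((ℝ ∙ ν)ᗮ : Submodule ℝ (EuclideanSpace ℝ (Fin n))), ‖h‖ < r1 → |g (p + h) - g p - l h| ≤ τ' * ‖h‖ := by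
    have h1 := (hasFDerivAt_iff_isLittleO_nhds_zero.1 hpd.hasFDerivAt).bound hτ'pos
    obtain ⟨r1, hr1, h2⟩ := Metric.eventually_nhds_iff.1 h1
    exact ⟨r1, hr1, fun h hh => h2 (by simpa using hh)⟩
  have hPrle : ∀ w, ‖Pr w‖ ≤ ‖w‖ := fun w => (ℝ ∙ ν)ᗮ.norm_orthogonalProjectionOnto_apply_le w
  set ρ : ℝ := min (r0 / (8 * M)) (r1 / (4 * M)) with hρ
  have hρ0 : 0 < ρ := by positivity
  have hρr0 : ρ * (8 * M) ≤ r0 := by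
    rw [← le_div_iff₀ (by positivity)]; exact min_le_left _ _
  have hρr1 : ρ * (4 * M) ≤ r1 := by
    rw [← le_div_iff₀ (by positivity)]; exact min_le_right _ _
  have hρM : 0 < ρ * M := by positivity
  have hshift : ∀ w, φ p + ρ • w =
      ((p + ρ • Pr w : ((ℝ ∙ ν)ᗮ : Submodule ℝ (EuclideanSpace ℝ (Fin n)))) : EuclideanSpace ℝ (Fin n)) + (g p + ρ * inner ℝ ν w) • ν := fun w => by
    conv_lhs => rw [← hdec w]
    simp only [hφ, Submodule.coe_add, Submodule.coe_smul]
    module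
  have hlo' : ∀ w, ‖w‖ ≤ 2 * M →
      |g (p + ρ • Pr w) - g p - ρ * l (Pr w)| ≤ ρ * (τ' * (2 * M)) := fun w hw => by
    have h1 : ‖ρ • Pr w‖ ≤ ρ * (2 * M) := by
      rw [norm_smul, Real.norm_of_nonneg hρ0.le]
      exact mul_le_mul_of_nonneg_left ((hPrle w).trans hw) hρ0.le
    have h2 := hlo (ρ • Pr w) (by linarith)
    rw [map_smul, smul_eq_mul] at h2
    calc _ ≤ _ := h2
      _ ≤ τ' * (ρ * (2 * M)) := by gcongr
      _ = _ := by ring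
  refine ⟨ρ, hρ0, fun w hw => ⟨?_, ?_⟩⟩
  · have hwM := hM w hw
    have hdist : φ p + ρ • w ∈ U i := by
      refine hball ?_
      rw [Metric.mem_ball, dist_self_add_left, norm_smul, Real.norm_of_nonneg hρ0.le]
      have : ρ * ‖w‖ ≤ ρ * M := by gcongr
      linarith
    have : φ p + ρ • w ∈ epigraphAlong ν g := by
      rw [hshift, coe_add_smul_mem_epigraphAlong hν]
      have h1 : |g (p + ρ • Pr w) - g p - ρ * l (Pr w)| ≤ ρ * (τ' * M) := by
        have h3 : ‖ρ • Pr w‖ ≤ ρ * M := by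
          rw [norm_smul, Real.norm_of_nonneg hρ0.le]
          exact mul_le_mul_of_nonneg_left ((hPrle w).trans hwM) hρ0.le
        have h2 := hlo (ρ • Pr w) (by linarith)
        rw [map_smul, smul_eq_mul] at h2
        calc _ ≤ _ := h2
          _ ≤ τ' * (ρ * M) := by gcongr
          _ = _ := by ring
      have h2 := (abs_le.1 h1).2
      have h3 : ‖N'‖ * c0 ≤ inner ℝ ν w - l (Pr w) := by
        rw [← hAapp, hAN2]
        exact mul_le_mul_of_nonneg_left (hmin hw) hlam.le
      have h4 : τ' * M < ‖N'‖ * c0 := by nlinarith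
      have h5 : ρ * (τ' * M) < ρ * (inner ℝ ν w - l (Pr w)) :=
        mul_lt_mul_of_pos_left (by linarith) hρ0
      linarith
    have h6 : φ p + ρ • w ∈ Ω ∩ U i := by rw [hgr]; exact ⟨this, hdist⟩
    exact h6.1
  · have hwM := hM w hw
    set s := inner ℝ N w with hs
    have hs0 : 0 < s := hKpos w hw
    -- The graph point over the tangential part of `w` is the competitor that bounds the distance
    -- from above; `φ p + ρ w'` lies on the tangent hyperplane and hence within `ρ τ` of that graph
    -- point.
    set w' := w - s • N with hw'
    have hsle : s ≤ M := by
      have := real_inner_le_norm N w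
      rw [hN1, one_mul] at this
      linarith
    have hw'M : ‖w'‖ ≤ 2 * M := by
      refine (norm_sub_le _ _).trans ?_
      rw [norm_smul, hN1, Real.norm_of_nonneg hs0.le]
      linarith
    have hA' : inner ℝ ν w' = l (Pr w') := by
      have h1 : A w' = 0 := by
        rw [hAN2, hw', inner_sub_right, real_inner_smul_right, real_inner_self_eq_norm_sq, hN1, ← hs]
        ring
      rw [hAapp] at h1
      linarith
    have hq : ‖φ (p + ρ • Pr w') - (φ p + ρ • w')‖ ≤ ρ * (τ' * (2 * M)) := by
      rw [hshift]
      have : φ (p + ρ • Pr w') - (((p + ρ • Pr w' : ((ℝ ∙ ν)ᗮ : Submodule ℝ (EuclideanSpace ℝ (Fin n)))) : EuclideanSpace ℝ (Fin n)) +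
          (g p + ρ * inner ℝ ν w') • ν) =
          (g (p + ρ • Pr w') - g p - ρ * l (Pr w')) • ν := by
        rw [hA']
        simp only [hφ]
        module
      rw [this, norm_smul, hν, mul_one]
      exact hlo' w' hw'M
    have hqU : φ (p + ρ • Pr w') ∈ U i := by
      refine hball ?_
      rw [Metric.mem_ball, dist_eq_norm]
      have h1 : φ (p + ρ • Pr w') - φ p = (φ (p + ρ • Pr w') - (φ p + ρ • w')) + ρ • w' := by abel
      rw [h1]
      refine (norm_add_le _ _).trans_lt ?_
      rw [norm_smul, Real.norm_of_nonneg hρ0.le]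
      have h2 : ρ * ‖w'‖ ≤ ρ * (2 * M) := by gcongr
      have h3 : ρ * (τ' * (2 * M)) ≤ ρ * (1 * (2 * M)) := by gcongr
      linarith
    have hqf : φ (p + ρ • Pr w') ∈ frontier Ω := graph_mem_frontier hΩ (hU i) hν hgr (p + ρ • Pr w') hqU
    have h1 : φ p + ρ • w - φ (p + ρ • Pr w') =
        (ρ * s) • N - (φ (p + ρ • Pr w') - (φ p + ρ • w')) := by
      rw [hw']; module
    have h3 : bdryDist Ω (φ p + ρ • w) ≤ dist (φ p + ρ • w) (φ (p + ρ • Pr w')) :=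
      Metric.infDist_le_dist_of_mem hqf
    rw [dist_eq_norm, h1] at h3
    refine h3.trans ?_
    refine (norm_sub_le _ _).trans ?_
    rw [norm_smul, hN1, mul_one, Real.norm_of_nonneg (by positivity)]
    have h2 : ρ * (τ' * (2 * M)) ≤ ρ * τ := by gcongr
    linarith

end blowup

/-! ### Transfer of half-space test functions to the domain -/

section rescaling

variable {n : ℕ} {Ω : Set (EuclideanSpace ℝ (Fin n))}
  {u : EuclideanSpace ℝ (Fin n) × ℝ → ℝ}

theorem integrable_div_of_pos {X : Type*} [TopologicalSpace X] [T2Space X] [MeasurableSpace X]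
    [OpensMeasurableSpace X] {μ : Measure X} [IsFiniteMeasureOnCompacts μ] {f g : X → ℝ}
    (hf : Continuous f) (hc : HasCompactSupport f) (hg : Continuous g)
    (h0 : ∀ x ∈ tsupport f, 0 < g x) : Integrable (fun x => f x / g x) μ := by
  have h1 : IntegrableOn (fun x => f x / g x) (tsupport f) μ :=
    (hf.continuousOn.div hg.continuousOn fun x hx => (h0 x hx).ne').integrableOn_compact hc.isCompact
  refine (integrableOn_iff_integrable_of_support_subset fun x hx => ?_).1 h1
  exact subset_tsupport f fun h => hx (by simp [h])

theorem dirichletEnergy_eq_univ (hs : tsupport u ⊆ Ω ×ˢ univ) :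
    dirichletEnergy Ω u = dirichletEnergy univ u := by
  unfold dirichletEnergy
  refine integral_congr_ae (ae_of_all _ fun y => ?_)
  beta_reduce
  rw [Measure.restrict_univ, setIntegral_eq_integral_of_forall_compl_eq_zero]
  intro x hx
  exact gradSq_eq_zero_of_notMem_tsupport (q := (x, y)) fun h => hx (hs h).1

/-- The rescaled function `u ((x - z) / ρ, y / ρ)`, `σ = 1 / ρ`. -/
def rescale (σ : ℝ) (z : EuclideanSpace ℝ (Fin n)) (u : EuclideanSpace ℝ (Fin n) × ℝ → ℝ)
    (q : EuclideanSpace ℝ (Fin n) × ℝ) : ℝ :=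
  u (σ • (q.1 - z), σ * q.2)

theorem gradSq_rescale (σ : ℝ) (z : EuclideanSpace ℝ (Fin n)) (hu : ContDiff ℝ ∞ u)
    (x : EuclideanSpace ℝ (Fin n)) (y : ℝ) :
    gradSq (rescale σ z u) x y = σ ^ 2 * gradSq u (σ • (x - z)) (σ * y) := by
  have hd : Differentiable ℝ u := hu.differentiable (by simp)
  have h1 : gradient (fun x' => rescale σ z u (x', y)) x =
      σ • gradient (fun x' => u (x', σ * y)) (σ • (x - z)) := by
    have hu1 : DifferentiableAt ℝ (fun x' => u (x', σ * y)) (σ • (x - z)) :=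
      DifferentiableAt.comp (g := u) _ (hd _) (hasFDerivAt_prodMk_left _ _).differentiableAt
    have h2 : HasFDerivAt (fun x' : EuclideanSpace ℝ (Fin n) => σ • (x' - z))
        (σ • ContinuousLinearMap.id ℝ _) x := ((hasFDerivAt_id x).sub_const z).const_smul σ
    have h3 : HasFDerivAt (fun x' => rescale σ z u (x', y)) _ x :=
      HasFDerivAt.comp (g := fun x' => u (x', σ * y)) x hu1.hasFDerivAt h2
    refine ext_inner_right ℝ fun w => ?_
    rw [real_inner_smul_left, inner_gradient_eq_fderiv, inner_gradient_eq_fderiv, h3.fderiv]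
    simp
  have h2 : deriv (fun y' => rescale σ z u (x, y')) y =
      σ * deriv (fun y' => u (σ • (x - z), y')) (σ * y) :=
    deriv_comp_mul_left σ (fun y' => u (σ • (x - z), y')) y
  rw [gradSq, gradSq, h1, h2, norm_smul, mul_pow, mul_pow, Real.norm_eq_abs, sq_abs]
  ring

theorem integral_comp_smul_sub (z : EuclideanSpace ℝ (Fin n)) {σ : ℝ} (hσ : 0 < σ)
    (f : EuclideanSpace ℝ (Fin n) → ℝ) :
    ∫ x, f (σ • (x - z)) = (σ ^ n)⁻¹ * ∫ x, f x := by
  rw [integral_sub_right_eq_self (fun x => f (σ • x)) z, Measure.integral_comp_smul]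
  simp [abs_of_pos hσ]

theorem dirichletEnergy_rescale {σ : ℝ} (hσ : 0 < σ) (z : EuclideanSpace ℝ (Fin n))
    (hu : ContDiff ℝ ∞ u) :
    dirichletEnergy univ (rescale σ z u) = (σ ^ n)⁻¹ * σ * dirichletEnergy univ u := by
  unfold dirichletEnergy
  simp only [gradSq_rescale σ z hu, Measure.restrict_univ, integral_const_mul]
  have h1 : ∀ y : ℝ, ∫ x, gradSq u (σ • (x - z)) (σ * y) =
      (σ ^ n)⁻¹ * ∫ x, gradSq u x (σ * y) := fun y =>
    integral_comp_smul_sub z hσ fun x => gradSq u x (σ * y)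
  simp only [h1, integral_const_mul]
  rw [integral_comp_mul_left_Ioi (fun y => ∫ x, gradSq u x y) 0 hσ, mul_zero, smul_eq_mul]
  field_simp

/-- The energy and the Hardy term both scale by `ρ^(n-1)`, so a strict inequality in the half-space
survives the small error in the distance. An upper bound for `d` suffices, since `d` stands in the
denominator on the larger side. -/
theorem exists_isTestFunction_rescale {z N : EuclideanSpace ℝ (Fin n)}
    (hΩ : IsOpen Ω) (hne : (frontier Ω).Nonempty)
    (hblow : ∀ A : Set (EuclideanSpace ℝ (Fin n)), IsCompact A → (∀ w ∈ A, 0 < inner ℝ N w) →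
        ∀ τ : ℝ, 0 < τ → ∃ ρ : ℝ, 0 < ρ ∧ ∀ w ∈ A,
          z + ρ • w ∈ Ω ∧ bdryDist Ω (z + ρ • w) ≤ ρ * (inner ℝ N w + τ))
    {K : ℝ} (hK : 0 < K)
    (hu : IsTestFunction ({x | 0 < inner ℝ N x} ×ˢ (univ : Set ℝ)) u)
    (hE : dirichletEnergy univ u < K * ∫ x, u (x, 0) ^ 2 / inner ℝ N x) :
    ∃ w : EuclideanSpace ℝ (Fin n) × ℝ → ℝ, IsTestFunction (Ω ×ˢ (univ : Set ℝ)) w ∧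
      dirichletEnergy Ω w < K * traceHardyTerm Ω w := by
  set A := Prod.fst '' tsupport u with hA
  have hAc : IsCompact A := hu.2.1.isCompact.image continuous_fst
  have hApos : ∀ w ∈ A, 0 < inner ℝ N w := by
    rintro _ ⟨q, hq, rfl⟩
    exact (hu.2.2 hq).1
  obtain ⟨c0, hc0, hmin⟩ : ∃ c0 : ℝ, 0 < c0 ∧ ∀ w ∈ A, c0 ≤ inner ℝ N w := by
    rcases A.eq_empty_or_nonempty with hAe | hAne
    · exact ⟨1, one_pos, fun w hw => by simp [hAe] at hw⟩
    · obtain ⟨w0, hw0, hmin⟩ := hAc.exists_isMinOn hAne (f := fun w => inner ℝ N w) (by fun_prop)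
      exact ⟨_, hApos w0 hw0, fun w hw => hmin hw⟩
  have hE0 : 0 ≤ dirichletEnergy univ u := by
    refine setIntegral_nonneg measurableSet_Ioi fun y _ => integral_nonneg fun x => ?_
    unfold gradSq; positivity
  set J := ∫ x, u (x, 0) ^ 2 / inner ℝ N x with hJ
  have hJpos : 0 < J := by
    by_contra! h
    have := mul_nonpos_of_nonneg_of_nonpos hK.le h
    linarith
  -- With this choice `K (1 - τ/c0) J` is the midpoint of the energy and `K J`. The factor `1 -
  -- τ/c0` is the loss in passing from `1/s` to `1/(s + τ)` for `s ≥ c0`.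
  set τ : ℝ := c0 * ((K * J - dirichletEnergy univ u) / (2 * (K * J))) with hτ
  have hτ0 : 0 < τ := by
    have : 0 < K * J - dirichletEnergy univ u := by linarith
    positivity
  have hEτ : dirichletEnergy univ u < K * ((1 - τ / c0) * J) := by
    have : K * ((1 - τ / c0) * J) = (K * J + dirichletEnergy univ u) / 2 := by
      rw [hτ]; field_simp; ring
    rw [this]; linarith
  obtain ⟨ρ, hρ, hρA⟩ := hblow A hAc hApos τ hτ0
  have hσ : 0 < ρ⁻¹ := by positivity
  have hTc : Continuous fun q : EuclideanSpace ℝ (Fin n) × ℝ => (z + ρ • q.1, ρ * q.2) := by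
    fun_prop
  have hTK := hu.2.1.isCompact.image hTc
  have hsupp : Function.support (rescale ρ⁻¹ z u) ⊆
      (fun q : EuclideanSpace ℝ (Fin n) × ℝ => (z + ρ • q.1, ρ * q.2)) '' tsupport u := by
    intro q hq
    refine ⟨(ρ⁻¹ • (q.1 - z), ρ⁻¹ * q.2), subset_tsupport u hq, ?_⟩
    ext1
    · simp [smul_smul, mul_inv_cancel₀ hρ.ne']
    · simp [mul_inv_cancel_left₀ hρ.ne']
  have htsupp := closure_minimal hsupp hTK.isClosed
  have htest : IsTestFunction (Ω ×ˢ (univ : Set ℝ)) (rescale ρ⁻¹ z u) := by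
    refine ⟨hu.1.comp (by fun_prop), hTK.of_isClosed_subset (isClosed_tsupport _) htsupp, ?_⟩
    refine htsupp.trans ?_
    rintro _ ⟨q, hq, rfl⟩
    exact ⟨(hρA q.1 ⟨q, hq, rfl⟩).1, mem_univ _⟩
  refine ⟨_, htest, ?_⟩
  rw [dirichletEnergy_eq_univ htest.2.2, dirichletEnergy_rescale hσ z hu.1]
  have hu0 : Continuous fun x => u (x, 0) ^ 2 := (hu.1.continuous.comp (by fun_prop)).pow 2
  have hu0c : HasCompactSupport fun x => u (x, 0) ^ 2 :=
    (hu.2.1.slice_fst 0).comp_left (g := fun t => t ^ 2) (by simp)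
  have hu0s : tsupport (fun x => u (x, 0) ^ 2) ⊆ A := fun x hx => by
    refine ⟨(x, 0), tsupport_slice_fst_subset u 0 (closure_mono ?_ hx), rfl⟩
    intro w (hw : u (w, 0) ^ 2 ≠ 0) (h : u (w, 0) = 0)
    exact hw (by simp [h])
  have hcd : Continuous fun w => bdryDist Ω (z + ρ • w) :=
    (continuous_bdryDist Ω).comp (by fun_prop)
  have hI1 : Integrable fun w => u (w, 0) ^ 2 / bdryDist Ω (z + ρ • w) :=
    integrable_div_of_pos hu0 hu0c hcd fun w hw => bdryDist_pos hΩ hne (hρA w (hu0s hw)).1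
  have hI2 : Integrable fun w => u (w, 0) ^ 2 / inner ℝ N w :=
    integrable_div_of_pos hu0 hu0c (by fun_prop) fun w hw => hApos w (hu0s hw)
  have hH : traceHardyTerm Ω (rescale ρ⁻¹ z u) =
      (ρ⁻¹ ^ n)⁻¹ * ∫ w, u (w, 0) ^ 2 / bdryDist Ω (z + ρ • w) := by
    rw [← integral_comp_smul_sub z hσ, traceHardyTerm,
      setIntegral_eq_integral_of_forall_compl_eq_zero]
    · refine integral_congr_ae (ae_of_all _ fun x => ?_)
      simp [rescale, smul_smul, mul_inv_cancel₀ hρ.ne']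
    · intro x hx
      have : rescale ρ⁻¹ z u (x, 0) = 0 := by
        by_contra h
        exact hx (htest.2.2 (subset_tsupport _ h)).1
      simp [this]
  have hmono : ρ⁻¹ * ((1 - τ / c0) * J) ≤ ∫ w, u (w, 0) ^ 2 / bdryDist Ω (z + ρ • w) := by
    rw [hJ, ← integral_const_mul, ← integral_const_mul]
    refine integral_mono ((hI2.const_mul _).const_mul _) hI1 fun w => ?_
    beta_reduce
    by_cases hw : w ∈ A
    · have h1 := hmin w hw
      have h2 := hApos w hw
      obtain ⟨h3, h4⟩ := hρA w hw
      have h5 := bdryDist_pos hΩ hne h3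
      set s := inner ℝ N w
      have h6 : (1 - τ / c0) / s ≤ 1 / (s + τ) := by
        rw [div_le_div_iff₀ h2 (by positivity)]
        have h7 : τ ≤ τ / c0 * s := by
          rw [div_mul_eq_mul_div, le_div_iff₀ hc0]; gcongr
        have h8 : 0 ≤ τ / c0 * τ := by positivity
        nlinarith
      calc ρ⁻¹ * ((1 - τ / c0) * (u (w, 0) ^ 2 / s))
          = u (w, 0) ^ 2 * (ρ⁻¹ * ((1 - τ / c0) / s)) := by ring
        _ ≤ u (w, 0) ^ 2 * (ρ⁻¹ * (1 / (s + τ))) := by gcongr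
        _ = u (w, 0) ^ 2 / (ρ * (s + τ)) := by field_simp
        _ ≤ _ := by gcongr
    · have : u (w, 0) = 0 := by
        by_contra h
        exact hw ⟨(w, 0), subset_tsupport u h, rfl⟩
      simp [this]
  rw [hH]
  calc (ρ⁻¹ ^ n)⁻¹ * ρ⁻¹ * dirichletEnergy univ u
      < (ρ⁻¹ ^ n)⁻¹ * ρ⁻¹ * (K * ((1 - τ / c0) * J)) := by gcongr
    _ = K * ((ρ⁻¹ ^ n)⁻¹ * (ρ⁻¹ * ((1 - τ / c0) * J))) := by ring
    _ ≤ _ := by gcongr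

end rescaling

/-! ### Integrals of functions of one linear coordinate -/

section slab

variable {n : ℕ} {N : EuclideanSpace ℝ (Fin n)}

/-- Averaging over translations by `σ N` with `σ ∈ (0, 1]` converts dependence on the coordinate
`⟨N, x⟩` into a one-dimensional integral, at the price of enlarging the ball by `1`. No rotated
coordinates are needed. -/
theorem lintegral_closedBall_comp_inner_le (hN : ‖N‖ = 1) (r : ℝ) {h : ℝ → ENNReal}
    (hh : Measurable h) :
    ∫⁻ x in Metric.closedBall (0 : EuclideanSpace ℝ (Fin n)) r, h (inner ℝ N x) ≤
      volume (Metric.closedBall (0 : EuclideanSpace ℝ (Fin n)) (r + 1)) * ∫⁻ t, h t := by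
  set B := Metric.closedBall (0 : EuclideanSpace ℝ (Fin n)) r with hB
  set B' := Metric.closedBall (0 : EuclideanSpace ℝ (Fin n)) (r + 1) with hB'
  have hBm : MeasurableSet B := Metric.isClosed_closedBall.measurableSet
  have hBm' : MeasurableSet B' := Metric.isClosed_closedBall.measurableSet
  have hstep : ∀ σ ∈ Ioc (0 : ℝ) 1, ∫⁻ x in B, h (inner ℝ N x) ≤
      ∫⁻ x in B', h (inner ℝ N x + σ) := by
    intro σ hσ
    rw [← lintegral_indicator hBm, ← lintegral_indicator hBm',
      ← lintegral_add_right_eq_self _ (σ • N)]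
    refine lintegral_mono fun x => ?_
    by_cases hx : x + σ • N ∈ B
    · have hx' : x ∈ B' := by
        rw [hB, mem_closedBall_zero_iff] at hx
        rw [hB', mem_closedBall_zero_iff]
        calc ‖x‖ = ‖(x + σ • N) - σ • N‖ := by rw [add_sub_cancel_right]
          _ ≤ ‖x + σ • N‖ + ‖σ • N‖ := norm_sub_le _ _
          _ ≤ r + 1 := by
            rw [norm_smul, hN, mul_one, Real.norm_of_nonneg hσ.1.le]
            linarith [hσ.2]
      rw [indicator_of_mem hx, indicator_of_mem hx', inner_add_right, real_inner_smul_right,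
        real_inner_self_eq_norm_sq, hN]
      simp
    · rw [indicator_of_notMem hx]; exact zero_le
  have hmeas : Measurable fun q : EuclideanSpace ℝ (Fin n) × ℝ => h (inner ℝ N q.1 + q.2) :=
    hh.comp (by fun_prop)
  calc ∫⁻ x in B, h (inner ℝ N x)
      = ∫⁻ _ in Ioc (0 : ℝ) 1, (∫⁻ x in B, h (inner ℝ N x)) := by simp
    _ ≤ ∫⁻ σ in Ioc (0 : ℝ) 1, ∫⁻ x in B', h (inner ℝ N x + σ) :=
        setLIntegral_mono' measurableSet_Ioc hstep
    _ = ∫⁻ x in B', ∫⁻ σ in Ioc (0 : ℝ) 1, h (inner ℝ N x + σ) :=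
        lintegral_lintegral_swap (hmeas.comp measurable_swap).aemeasurable
    _ ≤ ∫⁻ _ in B', ∫⁻ t, h t := by
        refine lintegral_mono fun x => (setLIntegral_le_lintegral _ _).trans (le_of_eq ?_)
        exact lintegral_add_left_eq_self h _
    _ = _ := by rw [lintegral_const, Measure.restrict_apply_univ, mul_comm]

theorem exists_le_lintegral_closedBall_comp_inner (hN : ‖N‖ = 1) {r : ℝ} (hr : 0 < r) :
    ∃ c : ℝ, 0 < c ∧ ∀ h : ℝ → ENNReal, Measurable h →
      ENNReal.ofReal c * ∫⁻ t in Ioc 0 (r / 2), h t ≤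
        ∫⁻ x in Metric.closedBall (0 : EuclideanSpace ℝ (Fin n)) r, h (inner ℝ N x) := by
  -- From a base point in this half-ball, translations of length up to `3r/4` stay in the ball of
  -- radius `r`, and the coordinate sweeps through all of `(0, r/2]`.
  set V : Set (EuclideanSpace ℝ (Fin n)) := Metric.ball 0 (r / 4) ∩ {x | inner ℝ N x < 0} with hV
  have hVo : IsOpen V := Metric.isOpen_ball.inter (isOpen_lt (by fun_prop) continuous_const)
  have hVne : V.Nonempty := by
    refine ⟨-((r / 8) • N), ?_, ?_⟩
    · rw [Metric.mem_ball, dist_zero_right, norm_neg, norm_smul, hN, Real.norm_of_nonneg (by positivity)]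
      linarith
    · change inner ℝ N (-((r / 8) • N)) < 0
      rw [inner_neg_right, real_inner_smul_right, real_inner_self_eq_norm_sq, hN]
      linarith
  have hVpos : 0 < volume V := hVo.measure_pos _ hVne
  have hVtop : volume V ≠ ⊤ := ((measure_mono inter_subset_left).trans_lt
    Metric.isBounded_ball.measure_lt_top).ne
  have hVr : 0 < (volume V).toReal := ENNReal.toReal_pos hVpos.ne' hVtop
  refine ⟨(volume V).toReal / (3 * r / 4), by positivity, fun h hh => ?_⟩
  have key := lintegral_lintegral_translate_le (μ := volume) (V := V)
    (W := Metric.closedBall (0 : EuclideanSpace ℝ (Fin n)) r) hVo.measurableSet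
    Metric.isClosed_closedBall.measurableSet (s := 3 * r / 4) (ν := N) (m := fun _ => 3 * r / 4)
    (fun x hx σ hσ => ⟨by
      have h1 : ‖x‖ < r / 4 := by simpa using hx.1
      rw [mem_closedBall_zero_iff]
      refine (norm_add_le _ _).trans ?_
      rw [norm_smul, hN, mul_one, Real.norm_of_nonneg hσ.1.le]
      linarith [hσ.2], hσ.2⟩) (h := fun x => h (inner ℝ N x)) (hh.comp (by fun_prop))
  rw [lintegral_const_mul' _ _ ENNReal.ofReal_ne_top] at key
  have hlow : volume V * ∫⁻ t in Ioc 0 (r / 2), h t ≤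
      ∫⁻ x in V, (∫⁻ σ in Ioc 0 (3 * r / 4), h (inner ℝ N (x + σ • N))) := by
    calc volume V * ∫⁻ t in Ioc 0 (r / 2), h t = ∫⁻ _ in V, (∫⁻ t in Ioc 0 (r / 2), h t) := by
          rw [lintegral_const, Measure.restrict_apply_univ, mul_comm]
      _ ≤ _ := by
          refine setLIntegral_mono' hVo.measurableSet fun x hx => ?_
          have hx1 : ‖x‖ < r / 4 := by simpa using hx.1
          have hx2 : inner ℝ N x < 0 := hx.2
          have hx3 := abs_le.1 (abs_real_inner_le_norm N x)
          rw [hN, one_mul] at hx3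
          rw [← lintegral_indicator measurableSet_Ioc, ← lintegral_indicator measurableSet_Ioc,
            ← lintegral_add_left_eq_self _ (inner ℝ N x)]
          refine lintegral_mono fun σ => ?_
          by_cases hσ : inner ℝ N x + σ ∈ Ioc 0 (r / 2)
          · have hσ' : σ ∈ Ioc 0 (3 * r / 4) := ⟨by linarith [hσ.1], by linarith [hσ.2, hx3.1]⟩
            rw [indicator_of_mem hσ, indicator_of_mem hσ',
              inner_add_right, real_inner_smul_right, real_inner_self_eq_norm_sq, hN]
            simp
          · rw [indicator_of_notMem hσ]; exact zero_le
  have h34 : ENNReal.ofReal (3 * r / 4) ≠ 0 := by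
    rw [Ne, ENNReal.ofReal_eq_zero, not_le]; positivity
  rw [ENNReal.ofReal_div_of_pos (by positivity), ENNReal.ofReal_toReal hVtop, div_eq_mul_inv,
    mul_right_comm]
  rw [← div_eq_mul_inv, ENNReal.div_le_iff h34 ENNReal.ofReal_ne_top]
  exact (hlow.trans key).trans (le_of_eq (mul_comm _ _))

/-- Each of the ranges `y ≤ b` and `y > b` contributes at most `b`. -/
theorem lintegral_Ioi_min_one_div_sq_le {b : ℝ} (hb : 0 < b) :
    ∫⁻ y in Ioi (0 : ℝ), ENNReal.ofReal (min 1 (b / y) ^ 2) ≤ ENNReal.ofReal (2 * b) := by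
  rw [← Ioc_union_Ioi_eq_Ioi hb.le]
  refine (lintegral_union_le _ _ _).trans ?_
  rw [two_mul, ENNReal.ofReal_add hb.le hb.le]
  refine add_le_add ?_ ?_
  · calc ∫⁻ y in Ioc 0 b, ENNReal.ofReal (min 1 (b / y) ^ 2) ≤ ∫⁻ _ in Ioc 0 b, 1 := by
          refine setLIntegral_mono' measurableSet_Ioc fun y hy => ENNReal.ofReal_le_one.2 ?_
          have := hy.1
          exact pow_le_one₀ (by positivity) (min_le_left _ _)
      _ = _ := by simp
  · have h1 : IntegrableOn (fun y : ℝ => b ^ 2 * y ^ (-2 : ℝ)) (Ioi b) :=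
      (integrableOn_Ioi_rpow_of_lt (by norm_num) hb).const_mul _
    calc ∫⁻ y in Ioi b, ENNReal.ofReal (min 1 (b / y) ^ 2)
        ≤ ∫⁻ y in Ioi b, ENNReal.ofReal (b ^ 2 * y ^ (-2 : ℝ)) := by
          refine setLIntegral_mono' measurableSet_Ioi fun y hy => ENNReal.ofReal_le_ofReal ?_
          have hy0 : 0 < y := hb.trans hy
          have h2 : y ^ (-2 : ℝ) = (y ^ 2)⁻¹ := by
            rw [Real.rpow_neg hy0.le, Real.rpow_two]
          rw [h2, ← div_eq_mul_inv, ← div_pow]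
          gcongr
          exact min_le_right _ _
      _ = ENNReal.ofReal (∫ y in Ioi b, b ^ 2 * y ^ (-2 : ℝ)) := by
          refine (ofReal_integral_eq_lintegral_ofReal h1 ?_).symm
          filter_upwards [ae_restrict_mem measurableSet_Ioi] with y hy
          have hy0 : 0 < y := hb.trans hy
          positivity
      _ ≤ ENNReal.ofReal b := by
          rw [integral_const_mul, integral_Ioi_rpow_of_lt (by norm_num) hb]
          refine ENNReal.ofReal_le_ofReal (le_of_eq ?_)
          norm_num
          rw [Real.rpow_neg_one]
          field_simp

/-- The logarithmic divergence of `∫ dt/t`, with the lower cutoff chosen to make the integral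
exactly `T`. -/
theorem lintegral_Ioc_inv_ge {b : ℝ} (hb : 0 < b) {T : ℝ} (hT : 0 ≤ T) :
    ENNReal.ofReal T ≤ ∫⁻ t in Ioc 0 b,
      (Ici (b * Real.exp (-T))).indicator (fun t => ENNReal.ofReal (1 / t)) t := by
  set a := b * Real.exp (-T) with ha
  have ha0 : 0 < a := by positivity
  have hab : a ≤ b := mul_le_of_le_one_right hb.le (Real.exp_le_one_iff.2 (by linarith))
  have hI : IntervalIntegrable (fun t : ℝ => 1 / t) volume a b := by
    refine intervalIntegral.intervalIntegrable_one_div (fun t ht => ?_) continuousOn_id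
    rw [uIcc_of_le hab] at ht
    exact (ha0.trans_le ht.1).ne'
  have h1 : ∫ t in a..b, 1 / t = T := by
    rw [integral_one_div_of_pos ha0 hb, ha, div_mul_cancel_left₀ hb.ne', ← Real.exp_neg, neg_neg,
      Real.log_exp]
  rw [intervalIntegral.integral_of_le hab] at h1
  rw [← h1, ofReal_integral_eq_lintegral_ofReal
    ((intervalIntegrable_iff_integrableOn_Ioc_of_le hab).1 hI)
    (by filter_upwards [ae_restrict_mem measurableSet_Ioc] with t ht
        have := ha0.trans ht.1
        positivity)]
  refine le_trans ?_ (lintegral_mono_set (fun t ht => ⟨ha0.trans ht.1, ht.2⟩ : Ioc a b ⊆ Ioc 0 b))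
  refine setLIntegral_mono' measurableSet_Ioc fun t ht => ?_
  rw [indicator_of_mem (show t ∈ Ici a from ht.1.le)]

theorem integral_inner_gradient_eq_zero {F : EuclideanSpace ℝ (Fin n) → ℝ} {D : ℝ≥0}
    (hF : LipschitzWith D F) (hc : HasCompactSupport F) (w : EuclideanSpace ℝ (Fin n)) :
    ∫ x, inner ℝ w (gradient F x) = 0 := by
  have h1 := LipschitzWith.integral_lineDeriv_mul_eq (μ := volume)
    (LipschitzWith.const (1 : ℝ) : LipschitzWith 0 fun _ : EuclideanSpace ℝ (Fin n) => (1 : ℝ))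
    hF hc (-w)
  rw [neg_neg] at h1
  have h2 : ∀ x, lineDeriv ℝ (fun _ : EuclideanSpace ℝ (Fin n) => (1 : ℝ)) x (-w) = 0 := fun x => by
    simp [lineDeriv]
  simp only [h2, zero_mul, integral_zero, mul_one] at h1
  rw [h1]
  refine integral_congr_ae ?_
  filter_upwards [hF.ae_differentiableAt (μ := volume)] with x hx
  rw [real_inner_comm, inner_gradient_eq_fderiv, hx.lineDeriv_eq_fderiv]

end slab

/-! ### The ground state identity in a slab along the hyperplane -/

section halfSpace

variable {n : ℕ} {N : EuclideanSpace ℝ (Fin n)}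

/-- A slab of width `1` replaces the half-space because the profile with `a = 1` requires its first
variable to lie in `(0, 1]`. -/
theorem isProfileDistance_inner (hN : ‖N‖ = 1) :
    IsProfileDistance 1 {x | inner ℝ N x ∈ Ioo (0 : ℝ) 1} fun x => inner ℝ N x := by
  have hf : ∀ x, HasFDerivAt (fun x : EuclideanSpace ℝ (Fin n) => inner ℝ N x) (innerSL ℝ N) x :=
    fun x => (innerSL ℝ N).hasFDerivAt
  refine ⟨isOpen_Ioo.preimage (by fun_prop), ?_, fun x hx => ?_, ae_of_all _ fun x => ?_⟩
  · have := (innerSL ℝ N).lipschitz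
    rwa [show ‖innerSL ℝ N‖₊ = 1 from by ext; simp [hN]] at this
  · rw [one_mul]; exact ⟨hx.1, hx.2.le⟩
  · refine ⟨(hf x).differentiableAt, ?_⟩
    rw [norm_gradient_eq_norm_fderiv, (hf x).fderiv, innerSL_apply_norm, hN]

theorem gradient_inner_left (N x : EuclideanSpace ℝ (Fin n)) :
    gradient (fun x => inner ℝ N x) x = N := by
  refine ext_inner_right ℝ fun w => ?_
  rw [inner_gradient_eq_fderiv, show fderiv ℝ (fun x => inner ℝ N x) x = innerSL ℝ N from
    (innerSL ℝ N).hasFDerivAt.fderiv, innerSL_apply_apply]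

/-- Here the distance function is linear, so multiplication by the profile preserves smoothness and
the substitution yields genuine test functions. -/
theorem isTestFunction_profile_mul {O : Set (EuclideanSpace ℝ (Fin n))} {v : EuclideanSpace ℝ (Fin n) × ℝ → ℝ}
    (hδ : IsProfileDistance 1 O fun x => inner ℝ N x) (hv : IsTestFunction (O ×ˢ (univ : Set ℝ)) v) :
    IsTestFunction (O ×ˢ (univ : Set ℝ)) fun q => traceProfile 1 (inner ℝ N q.1, q.2) * v q := by
  refine ⟨contDiff_iff_contDiffAt.2 fun q => ?_, hv.2.1.mul_left,
    tsupport_mul_subset_right.trans hv.2.2⟩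
  by_cases hq : q ∈ tsupport v
  · have h1 : ContDiffAt ℝ ∞ (fun q : EuclideanSpace ℝ (Fin n) × ℝ => (inner ℝ N q.1, q.2)) q :=
      ((contDiff_const.inner ℝ contDiff_fst).prodMk contDiff_snd).contDiffAt
    exact (ContDiffAt.comp (g := traceProfile 1) q
      (contDiffAt_traceProfile (a := 1) (z := (inner ℝ N q.1, q.2)) (hδ.sin_pos (hv.2.2 hq).1)) h1).mul hv.1.contDiffAt
  · have h0 : (fun q => traceProfile 1 (inner ℝ N q.1, q.2) * v q) =ᶠ[nhds q] fun _ => 0 := by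
      filter_upwards [notMem_tsupport_iff_eventuallyEq.1 hq] with z hz
      simp [hz]
    exact contDiffAt_const.congr_of_eventuallyEq h0

/-- For linear `δ` the horizontal flux integrates to zero, being the integral of a directional
derivative. The bound `1/sin s ≤ 1/s + 1` then isolates the Hardy term, with an `L²` error. -/
theorem dirichletEnergy_profile_mul (hN : ‖N‖ = 1) {v : EuclideanSpace ℝ (Fin n) × ℝ → ℝ}
    (hv : IsTestFunction ({x | inner ℝ N x ∈ Ioo (0 : ℝ) 1} ×ˢ (univ : Set ℝ)) v) :
    Integrable (fun q => traceProfile 1 (inner ℝ N q.1, q.2) ^ 2 * gradSq v q.1 q.2)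
      ((volume.restrict {x | inner ℝ N x ∈ Ioo (0 : ℝ) 1}).prod (volume.restrict (Ioi 0))) ∧
    dirichletEnergy univ (fun q => traceProfile 1 (inner ℝ N q.1, q.2) * v q) ≤
      (∫ q, traceProfile 1 (inner ℝ N q.1, q.2) ^ 2 * gradSq v q.1 q.2
        ∂((volume.restrict {x | inner ℝ N x ∈ Ioo (0 : ℝ) 1}).prod (volume.restrict (Ioi 0)))) +
      2 / Real.pi * (∫ x, v (x, 0) ^ 2 / inner ℝ N x) + 2 / Real.pi * ∫ x, v (x, 0) ^ 2 := by
  set O : Set (EuclideanSpace ℝ (Fin n)) := {x | inner ℝ N x ∈ Ioo (0 : ℝ) 1} with hO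
  have hδ : IsProfileDistance 1 O fun x => inner ℝ N x := isProfileDistance_inner hN
  set u : EuclideanSpace ℝ (Fin n) × ℝ → ℝ :=
    fun q => traceProfile 1 (inner ℝ N q.1, q.2) * v q with hu
  have hut : IsTestFunction (O ×ˢ (univ : Set ℝ)) u := isTestFunction_profile_mul hδ hv
  have hquot : profileQuotient 1 (fun x => inner ℝ N x) u = v := by
    funext q
    simp only [profileQuotient, hu]
    rw [inv_mul_cancel_left₀ (traceProfile_pos _ _).ne']
  obtain ⟨h1, h2, h3⟩ := hδ.ground_state_identity hut
  rw [hquot] at h1 h3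
  refine ⟨h1, ?_⟩
  have hflux : (∫ y in Ioi (0 : ℝ), ∫ x in O, inner ℝ (gradient (fun x => inner ℝ N x) x)
      (gradient (fun x' => profileFluxFst 1 (fun x => inner ℝ N x) u (x', y)) x)) = 0 := by
    refine integral_eq_zero_of_ae (ae_of_all _ fun y => ?_)
    change ∫ x in O, inner ℝ (gradient (fun x => inner ℝ N x) x)
      (gradient (fun x' => profileFluxFst 1 (fun x => inner ℝ N x) u (x', y)) x) = 0
    obtain ⟨D, hF⟩ := hδ.exists_lipschitzWith_fluxFst hut
    have hsq : HasCompactSupport fun q => u q ^ 2 :=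
      hut.2.1.comp_left (g := fun t => t ^ 2) (by simp)
    have hFc : HasCompactSupport (profileFluxFst 1 (fun x => inner ℝ N x) u) := hsq.mul_left
    have hs1 : tsupport (profileFluxFst 1 (fun x => inner ℝ N x) u) ⊆ tsupport u :=
      closure_mono fun q hq (h : u q = 0) => hq (by simp [profileFluxFst, h])
    have hs : tsupport (fun x => profileFluxFst 1 (fun x => inner ℝ N x) u (x, y)) ⊆ O :=
      fun x hx => (hut.2.2 (hs1 (tsupport_slice_fst_subset _ y hx))).1
    rw [setIntegral_eq_integral_of_forall_compl_eq_zero]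
    · simp only [gradient_inner_left]
      exact integral_inner_gradient_eq_zero (hF.comp (LipschitzWith.prodMk_right y))
        (hFc.slice_fst y) N
    · intro x hx
      rw [gradient_eq_zero_of_notMem_tsupport fun h => hx (hs h), inner_zero_right]
  rw [hflux, add_zero] at h3
  rw [← dirichletEnergy_eq_univ hut.2.2, h3, add_assoc]
  refine add_le_add le_rfl ?_
  have hu0 : ∀ x, u (x, 0) = v (x, 0) := fun x => by simp [hu, traceProfile_zero]
  have hv0 : Continuous fun x => v (x, 0) ^ 2 := (hv.1.continuous.comp (by fun_prop)).pow 2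
  have hv0c : HasCompactSupport fun x => v (x, 0) ^ 2 :=
    (hv.2.1.slice_fst 0).comp_left (g := fun t => t ^ 2) (by simp)
  have hv0s : tsupport (fun x => v (x, 0) ^ 2) ⊆ O := fun x hx => by
    refine (hv.2.2 (tsupport_slice_fst_subset v 0 (closure_mono ?_ hx))).1
    intro w (hw : v (w, 0) ^ 2 ≠ 0) (h : v (w, 0) = 0)
    exact hw (by simp [h])
  have hI1 : Integrable fun x => v (x, 0) ^ 2 / inner ℝ N x :=
    integrable_div_of_pos hv0 hv0c (by fun_prop) fun x hx => (hv0s hx).1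
  have hI2 : Integrable fun x => v (x, 0) ^ 2 := hv0.integrable_of_hasCompactSupport hv0c
  rw [← integral_const_mul, ← integral_const_mul, ← integral_add (hI1.const_mul _) (hI2.const_mul _)]
  have hI3 : Integrable fun x => 2 / Real.pi * (v (x, 0) ^ 2 / inner ℝ N x) +
      2 / Real.pi * v (x, 0) ^ 2 := (hI1.const_mul _).add (hI2.const_mul _)
  refine (setIntegral_mono_on h2 hI3.integrableOn hδ.isOpen.measurableSet
    fun x hx => ?_).trans (setIntegral_le_integral hI3 (ae_of_all _ fun x => ?_))
  · have h4 := inv_sin_le_inv_add_one (s := inner ℝ N x) ⟨hx.1, hx.2.le⟩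
    simp only [hu0, one_mul]
    calc _ ≤ 2 / Real.pi * (1 / inner ℝ N x + 1) * v (x, 0) ^ 2 := by gcongr
      _ = _ := by ring
  · simp only [Pi.zero_apply]
    by_cases hx : x ∈ O
    · have : 0 < inner ℝ N x := hx.1
      positivity
    · have : v (x, 0) = 0 := by
        by_contra h
        exact hx (hv.2.2 (subset_tsupport v h)).1
      simp [this]

end halfSpace

/-! ### Energy of the boundary layer -/

section boundaryLayer

variable {n : ℕ}

/-- A smooth cutoff at distance `ε` from the hyperplane orthogonal to `N`. -/
noncomputable def layerCutoff (ζ : EuclideanSpace ℝ (Fin n) → ℝ) (N : EuclideanSpace ℝ (Fin n))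
    (ε : ℝ) (x : EuclideanSpace ℝ (Fin n)) : ℝ :=
  ζ x * Real.smoothTransition (inner ℝ N x / ε - 1)

variable {ζ : EuclideanSpace ℝ (Fin n) → ℝ} {N : EuclideanSpace ℝ (Fin n)} {ε : ℝ}

theorem exists_norm_deriv_smoothTransition_le : ∃ M : ℝ, ∀ t,
    ‖deriv Real.smoothTransition t‖ ≤ (Icc (0 : ℝ) 1).indicator (fun _ => M) t := by
  have hc : Continuous (deriv Real.smoothTransition) :=
    (Real.smoothTransition.contDiff (n := 1)).continuous_deriv (by simp)
  have h0 : ∀ t, t ∉ Icc (0 : ℝ) 1 → deriv Real.smoothTransition t = 0 := fun t ht => by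
    rw [mem_Icc, not_and_or, not_le, not_le] at ht
    rcases ht with ht | ht
    · have : Real.smoothTransition =ᶠ[nhds t] fun _ => 0 := by
        filter_upwards [gt_mem_nhds ht] with s hs using Real.smoothTransition.zero_of_nonpos hs.le
      rw [this.deriv_eq, deriv_const]
    · have : Real.smoothTransition =ᶠ[nhds t] fun _ => 1 := by
        filter_upwards [lt_mem_nhds ht] with s hs using Real.smoothTransition.one_of_one_le hs.le
      rw [this.deriv_eq, deriv_const]
  obtain ⟨M, hM⟩ := hc.bounded_above_of_compact_support (HasCompactSupport.intro isCompact_Icc h0)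
  refine ⟨M, fun t => ?_⟩
  by_cases ht : t ∈ Icc (0 : ℝ) 1
  · rw [indicator_of_mem ht]; exact hM t
  · rw [indicator_of_notMem ht, h0 t ht, norm_zero]

theorem contDiff_layerCutoff (hζ : ContDiff ℝ ∞ ζ) : ContDiff ℝ ∞ (layerCutoff ζ N ε) :=
  hζ.mul ((Real.smoothTransition.contDiff (n := ⊤)).comp
    (((contDiff_const.inner ℝ contDiff_id).div_const ε).sub contDiff_const))

theorem norm_fderiv_layerCutoff_le (hN : ‖N‖ = 1) (hζ : ContDiff ℝ ∞ ζ) {C : ℝ≥0}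
    (hC : LipschitzWith C ζ) (h1 : ∀ x, |ζ x| ≤ 1) {M : ℝ}
    (hM : ∀ t, ‖deriv Real.smoothTransition t‖ ≤ (Icc (0 : ℝ) 1).indicator (fun _ => M) t)
    (hε : 0 < ε) (x : EuclideanSpace ℝ (Fin n)) :
    ‖fderiv ℝ (layerCutoff ζ N ε) x‖ ≤
      C + M / ε * (Icc ε (2 * ε)).indicator (fun _ => 1) (inner ℝ N x) := by
  have hin : HasFDerivAt (fun x : EuclideanSpace ℝ (Fin n) => inner ℝ N x / ε - 1)
      (ε⁻¹ • innerSL ℝ N) x := by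
    have := ((innerSL ℝ N).hasFDerivAt (x := x)).const_mul ε⁻¹ |>.sub_const 1
    refine this.congr_of_eventuallyEq (Filter.Eventually.of_forall fun y => ?_)
    simp [div_eq_inv_mul]
  have hst : HasDerivAt Real.smoothTransition (deriv Real.smoothTransition (inner ℝ N x / ε - 1))
      (inner ℝ N x / ε - 1) :=
    ((Real.smoothTransition.contDiff (n := 1)).differentiable (by simp) _).hasDerivAt
  have hst2 : HasFDerivAt (fun x => Real.smoothTransition (inner ℝ N x / ε - 1))
      (deriv Real.smoothTransition (inner ℝ N x / ε - 1) • ε⁻¹ • innerSL ℝ N) x := by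
    have := HasDerivAt.comp_hasFDerivAt (f := fun x => inner ℝ N x / ε - 1) x hst hin
    exact this
  have hprod : HasFDerivAt (layerCutoff ζ N ε) _ x :=
    (hζ.differentiable (by simp) x).hasFDerivAt.mul hst2
  rw [hprod.fderiv]
  refine (norm_add_le _ _).trans ?_
  rw [norm_smul, norm_smul, norm_smul, norm_smul, innerSL_apply_norm, hN, mul_one, add_comm]
  refine add_le_add ?_ ?_
  · have h2 : ‖Real.smoothTransition (inner ℝ N x / ε - 1)‖ ≤ 1 := by
      rw [Real.norm_eq_abs, abs_le]
      have h3 := Real.smoothTransition.nonneg (inner ℝ N x / ε - 1)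
      have h4 := Real.smoothTransition.le_one (inner ℝ N x / ε - 1)
      exact ⟨by linarith, h4⟩
    calc _ ≤ 1 * (C : ℝ) := mul_le_mul h2 (norm_fderiv_le_of_lipschitz ℝ hC) (norm_nonneg _) zero_le_one
      _ = C := one_mul _
  · have h3 := hM (inner ℝ N x / ε - 1)
    have hmem : inner ℝ N x / ε - 1 ∈ Icc (0 : ℝ) 1 ↔ inner ℝ N x ∈ Icc ε (2 * ε) := by
      rw [mem_Icc, mem_Icc, sub_nonneg, le_div_iff₀ hε, one_mul, sub_le_iff_le_add, div_le_iff₀ hε]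
      norm_num
    have hε' : ‖ε⁻¹‖ = ε⁻¹ := Real.norm_of_nonneg (by positivity)
    rw [hε']
    have h4 : ‖ζ x‖ * (‖deriv Real.smoothTransition (inner ℝ N x / ε - 1)‖ * ε⁻¹) ≤
        ‖deriv Real.smoothTransition (inner ℝ N x / ε - 1)‖ * ε⁻¹ :=
      mul_le_of_le_one_left (by positivity) (h1 x)
    refine h4.trans ?_
    by_cases h : inner ℝ N x ∈ Icc ε (2 * ε)
    · rw [indicator_of_mem (hmem.2 h)] at h3
      rw [indicator_of_mem h, mul_one, div_eq_mul_inv]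
      exact mul_le_mul_of_nonneg_right h3 (by positivity)
    · rw [indicator_of_notMem fun h' => h (hmem.1 h')] at h3
      rw [indicator_of_notMem h, mul_zero]
      have : ‖deriv Real.smoothTransition (inner ℝ N x / ε - 1)‖ = 0 :=
        le_antisymm h3 (norm_nonneg _)
      rw [this, zero_mul]

theorem gradSq_prod_eq {θ : EuclideanSpace ℝ (Fin n) → ℝ} {η : ℝ → ℝ}
    {x : EuclideanSpace ℝ (Fin n)} (hθ : DifferentiableAt ℝ θ x) {y : ℝ} :
    gradSq (fun q => θ q.1 * η q.2) x y =
      (η y * ‖fderiv ℝ θ x‖) ^ 2 + (θ x * deriv η y) ^ 2 := by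
  rw [gradSq, norm_gradient_eq_norm_fderiv]
  dsimp only
  rw [fderiv_mul_const hθ, norm_smul, mul_pow, mul_pow, Real.norm_eq_abs, sq_abs, deriv_const_mul_field]

/-- The energy of the boundary layer stays bounded as its width tends to zero. -/
theorem lintegral_profile_layer_le (hN : ‖N‖ = 1) {η : ℝ → ℝ} {r M : ℝ}
    (hθ : Differentiable ℝ (layerCutoff ζ N ε))
    (hζr : ∀ x, r < ‖x‖ → layerCutoff ζ N ε x = 0 ∧ fderiv ℝ (layerCutoff ζ N ε) x = 0)
    (hη2 : ∀ y, 2 < y → η y = 0 ∧ deriv η y = 0)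
    (hη1 : ∀ y, |η y| ≤ 1) (hηM : ∀ y, |deriv η y| ≤ M) (hθ1 : ∀ x, |layerCutoff ζ N ε x| ≤ 1)
    (hθM : ∀ x, ‖fderiv ℝ (layerCutoff ζ N ε) x‖ ≤
      M + M / ε * (Icc ε (2 * ε)).indicator (fun _ => 1) (inner ℝ N x))
    (hε : 0 < ε) :
    ∫⁻ x in {x | inner ℝ N x ∈ Ioo (0 : ℝ) 1}, ∫⁻ y in Ioi (0 : ℝ),
      ENNReal.ofReal (traceProfile 1 (inner ℝ N x, y) ^ 2 *
        gradSq (fun q => layerCutoff ζ N ε q.1 * η q.2) x y) ≤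
      ENNReal.ofReal (6 * M ^ 2) * volume (Metric.closedBall (0 : EuclideanSpace ℝ (Fin n)) r) +
      ENNReal.ofReal (8 * M ^ 2) *
        volume (Metric.closedBall (0 : EuclideanSpace ℝ (Fin n)) (r + 1)) := by
  have hδ := isProfileDistance_inner hN
  set O : Set (EuclideanSpace ℝ (Fin n)) := {x | inner ℝ N x ∈ Ioo (0 : ℝ) 1} with hO
  set B := Metric.closedBall (0 : EuclideanSpace ℝ (Fin n)) r with hB
  have hBm : MeasurableSet B := Metric.isClosed_closedBall.measurableSet
  set h : ℝ → ENNReal := (Icc ε (2 * ε)).indicator (fun _ => 1) with hh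
  have hhm : Measurable h := measurable_const.indicator measurableSet_Icc
  have hinner : ∀ x ∈ O, ∫⁻ y in Ioi (0 : ℝ),
      ENNReal.ofReal (traceProfile 1 (inner ℝ N x, y) ^ 2 *
        gradSq (fun q => layerCutoff ζ N ε q.1 * η q.2) x y) ≤
      B.indicator (fun x => ENNReal.ofReal (6 * M ^ 2) +
        ENNReal.ofReal (8 * M ^ 2 / ε) * h (inner ℝ N x)) x := by
    intro x hx
    by_cases hxB : x ∈ B
    swap
    · have hr : r < ‖x‖ := by simpa [hB] using hxB
      obtain ⟨h1, h2⟩ := hζr x hr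
      simp [gradSq_prod_eq (hθ x), h1, h2]
    rw [indicator_of_mem hxB]
    have hpt : ∀ y ∈ Ioi (0 : ℝ), ENNReal.ofReal (traceProfile 1 (inner ℝ N x, y) ^ 2 *
        gradSq (fun q => layerCutoff ζ N ε q.1 * η q.2) x y) ≤
        (Ioc (0 : ℝ) 2).indicator (fun _ => ENNReal.ofReal (3 * M ^ 2)) y +
        ENNReal.ofReal (2 * M ^ 2 / ε ^ 2) * h (inner ℝ N x) *
          ENNReal.ofReal (min 1 (2 * ε / y) ^ 2) := by
      intro y hy
      rw [gradSq_prod_eq (hθ x)]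
      by_cases hy2 : y ∈ Ioc (0 : ℝ) 2
      swap
      · obtain ⟨h1, h2⟩ := hη2 y (by
          by_contra! h'
          exact hy2 ⟨hy, h'⟩)
        simp [h1, h2]
      rw [indicator_of_mem hy2]
      have hP0 := (traceProfile_pos 1 (inner ℝ N x, y)).le
      have hP1 := traceProfile_le_one (a := 1) zero_le_one (hδ.sin_pos hx) (le_of_lt hy)
      have hP2 := traceProfile_le_div (s := inner ℝ N x) ⟨hx.1, hx.2.le⟩ hy
      set P := traceProfile 1 (inner ℝ N x, y)
      have ha : (η y * ‖fderiv ℝ (layerCutoff ζ N ε) x‖) ^ 2 ≤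
          ‖fderiv ℝ (layerCutoff ζ N ε) x‖ ^ 2 := by
        rw [mul_pow, ← sq_abs]
        exact mul_le_of_le_one_left (sq_nonneg _) (pow_le_one₀ (abs_nonneg _) (hη1 y))
      have hb : (layerCutoff ζ N ε x * deriv η y) ^ 2 ≤ M ^ 2 := by
        rw [mul_pow, ← sq_abs, ← sq_abs (deriv η y)]
        calc _ ≤ 1 * M ^ 2 := by
              gcongr
              · exact pow_le_one₀ (abs_nonneg _) (hθ1 x)
              · exact hηM y
          _ = _ := one_mul _
      have hPsq : P ^ 2 ≤ 1 := pow_le_one₀ hP0 hP1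
      by_cases hs : inner ℝ N x ∈ Icc ε (2 * ε)
      · have hg := hθM x
        rw [indicator_of_mem hs, mul_one] at hg
        rw [hh, indicator_of_mem hs, mul_one, ← ENNReal.ofReal_mul (by positivity),
          ← ENNReal.ofReal_add (by positivity) (by positivity)]
        refine ENNReal.ofReal_le_ofReal ?_
        -- In the layer `ε ≤ s ≤ 2ε` the integral of `P²` over `y` is at most `4ε`. Together with
        -- the layer's thickness `ε`, this compensates the squared cutoff gradient, of order `1/ε²`.
        have hP3 : P ≤ min 1 (2 * ε / y) := le_min hP1 (hP2.trans (by
          have := hs.2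
          have : (0 : ℝ) < y := hy
          gcongr))
        have hP4 : P ^ 2 ≤ min 1 (2 * ε / y) ^ 2 := by gcongr
        have hg2 : ‖fderiv ℝ (layerCutoff ζ N ε) x‖ ^ 2 ≤ 2 * M ^ 2 + 2 * M ^ 2 / ε ^ 2 := by
          calc _ ≤ (M + M / ε) ^ 2 := by gcongr
            _ ≤ 2 * M ^ 2 + 2 * (M / ε) ^ 2 := by nlinarith [sq_nonneg (M - M / ε)]
            _ = _ := by ring
        calc _ ≤ P ^ 2 * (2 * M ^ 2 + 2 * M ^ 2 / ε ^ 2 + M ^ 2) := by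
              gcongr; linarith
          _ = P ^ 2 * (3 * M ^ 2) + 2 * M ^ 2 / ε ^ 2 * P ^ 2 := by ring
          _ ≤ 1 * (3 * M ^ 2) + 2 * M ^ 2 / ε ^ 2 * min 1 (2 * ε / y) ^ 2 := by gcongr
          _ = _ := by ring
      · have hg := hθM x
        rw [indicator_of_notMem hs, mul_zero, add_zero] at hg
        rw [hh, indicator_of_notMem hs, mul_zero, zero_mul, add_zero]
        refine ENNReal.ofReal_le_ofReal ?_
        have hg2 : ‖fderiv ℝ (layerCutoff ζ N ε) x‖ ^ 2 ≤ M ^ 2 := by gcongr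
        calc _ ≤ 1 * (M ^ 2 + M ^ 2) :=
              mul_le_mul hPsq (add_le_add (ha.trans hg2) hb) (by positivity) zero_le_one
          _ ≤ _ := by nlinarith [sq_nonneg M]
    have hkm : Measurable fun y : ℝ => ENNReal.ofReal (min 1 (2 * ε / y) ^ 2) := by fun_prop
    calc _ ≤ _ := setLIntegral_mono' measurableSet_Ioi hpt
      _ = (∫⁻ y in Ioi (0 : ℝ), (Ioc (0 : ℝ) 2).indicator (fun _ => ENNReal.ofReal (3 * M ^ 2)) y) +
          ENNReal.ofReal (2 * M ^ 2 / ε ^ 2) * h (inner ℝ N x) *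
          ∫⁻ y in Ioi (0 : ℝ), ENNReal.ofReal (min 1 (2 * ε / y) ^ 2) := by
        rw [lintegral_add_left (measurable_const.indicator measurableSet_Ioc),
          lintegral_const_mul _ hkm]
      _ ≤ ENNReal.ofReal (3 * M ^ 2) * ENNReal.ofReal 2 +
          ENNReal.ofReal (2 * M ^ 2 / ε ^ 2) * h (inner ℝ N x) * ENNReal.ofReal (2 * (2 * ε)) := by
        refine add_le_add ?_ (mul_le_mul_right (lintegral_Ioi_min_one_div_sq_le (by positivity)) _)
        refine (setLIntegral_le_lintegral _ _).trans (le_of_eq ?_)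
        rw [lintegral_indicator measurableSet_Ioc, lintegral_const, Measure.restrict_apply_univ,
          Real.volume_Ioc, sub_zero]
      _ = _ := by
        rw [mul_right_comm, ← ENNReal.ofReal_mul (by positivity), ← ENNReal.ofReal_mul (by positivity)]
        congr 2
        · ring_nf
        · congr 1; field_simp; ring
  calc _ ≤ ∫⁻ x in O, B.indicator (fun x => ENNReal.ofReal (6 * M ^ 2) +
        ENNReal.ofReal (8 * M ^ 2 / ε) * h (inner ℝ N x)) x :=
        setLIntegral_mono' hδ.isOpen.measurableSet hinner
    _ ≤ ∫⁻ x, B.indicator (fun x => ENNReal.ofReal (6 * M ^ 2) +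
        ENNReal.ofReal (8 * M ^ 2 / ε) * h (inner ℝ N x)) x := setLIntegral_le_lintegral _ _
    _ = ENNReal.ofReal (6 * M ^ 2) * volume B +
        ENNReal.ofReal (8 * M ^ 2 / ε) * ∫⁻ x in B, h (inner ℝ N x) := by
      rw [lintegral_indicator hBm, lintegral_add_left measurable_const, lintegral_const,
        Measure.restrict_apply_univ, lintegral_const_mul' _ _ ENNReal.ofReal_ne_top]
    _ ≤ ENNReal.ofReal (6 * M ^ 2) * volume B + ENNReal.ofReal (8 * M ^ 2 / ε) *
        (volume (Metric.closedBall (0 : EuclideanSpace ℝ (Fin n)) (r + 1)) * ENNReal.ofReal ε) := by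
      refine add_le_add le_rfl (mul_le_mul_right
        ((lintegral_closedBall_comp_inner_le hN r hhm).trans (le_of_eq ?_)) _)
      rw [hh, lintegral_indicator measurableSet_Icc, lintegral_const, Measure.restrict_apply_univ,
        Real.volume_Icc, one_mul, two_mul, add_sub_cancel_right]
    _ = _ := by
      rw [mul_comm (volume _) (ENNReal.ofReal ε), ← mul_assoc, ← ENNReal.ofReal_mul (by positivity),
        div_mul_cancel₀ _ hε.ne']

end boundaryLayer

/-! ### Sharpness in the half-space -/

section halfSpaceSharp

variable {n : ℕ} {N : EuclideanSpace ℝ (Fin n)}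

theorem isTestFunction_layer (hN : ‖N‖ = 1) (ζ : ContDiffBump (0 : EuclideanSpace ℝ (Fin n)))
    (hζ : ζ.rOut < 1) (η : ContDiffBump (0 : ℝ)) {ε : ℝ} (hε : 0 < ε) :
    IsTestFunction ({x | inner ℝ N x ∈ Ioo (0 : ℝ) 1} ×ˢ (univ : Set ℝ))
      fun q => layerCutoff ζ N ε q.1 * η q.2 := by
  set S : Set (EuclideanSpace ℝ (Fin n) × ℝ) :=
    (Metric.closedBall 0 ζ.rOut ∩ {x | ε ≤ inner ℝ N x}) ×ˢ Metric.closedBall 0 η.rOut with hS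
  have hSc : IsCompact S :=
    ((isCompact_closedBall _ _).inter_right (isClosed_le continuous_const (by fun_prop))).prod
      (isCompact_closedBall _ _)
  have hsub : tsupport (fun q : EuclideanSpace ℝ (Fin n) × ℝ => layerCutoff ζ N ε q.1 * η q.2) ⊆ S := by
    refine closure_minimal (fun q hq => ?_) hSc.isClosed
    have h1 : layerCutoff ζ N ε q.1 ≠ 0 := left_ne_zero_of_mul hq
    have h2 : ζ q.1 ≠ 0 := left_ne_zero_of_mul h1
    have h3 : Real.smoothTransition (inner ℝ N q.1 / ε - 1) ≠ 0 := right_ne_zero_of_mul h1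
    have h4 : η q.2 ≠ 0 := right_ne_zero_of_mul hq
    refine ⟨⟨?_, ?_⟩, ?_⟩
    · rw [← ζ.tsupport_eq]; exact subset_tsupport _ h2
    · have h5 : ¬ inner ℝ N q.1 / ε - 1 ≤ 0 := fun h => h3 (Real.smoothTransition.zero_of_nonpos h)
      rw [not_le, sub_pos, lt_div_iff₀ hε, one_mul] at h5
      exact h5.le
    · rw [← η.tsupport_eq]; exact subset_tsupport _ h4
  refine ⟨((contDiff_layerCutoff ζ.contDiff).comp contDiff_fst).mul (η.contDiff.comp contDiff_snd),
    hSc.of_isClosed_subset (isClosed_tsupport _) hsub, hsub.trans fun q hq => ⟨?_, mem_univ _⟩⟩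
  have h1 : ‖q.1‖ ≤ ζ.rOut := by simpa using hq.1.1
  have h2 := (abs_le.1 (abs_real_inner_le_norm N q.1)).2
  rw [hN, one_mul] at h2
  exact ⟨hε.trans_le hq.1.2, by linarith⟩

theorem abs_layerCutoff_le_one (ζ : ContDiffBump (0 : EuclideanSpace ℝ (Fin n))) (ε : ℝ)
    (x : EuclideanSpace ℝ (Fin n)) : |layerCutoff ζ N ε x| ≤ 1 := by
  rw [layerCutoff, abs_mul, abs_of_nonneg ζ.nonneg, abs_of_nonneg (Real.smoothTransition.nonneg _)]
  exact mul_le_one₀ ζ.le_one (Real.smoothTransition.nonneg _) (Real.smoothTransition.le_one _)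

/-- The point is that `C` does not depend on `ε`: it involves only derivative bounds for the fixed
bumps `ζ`, `η` and for the smooth transition, together with volumes of fixed balls. -/
theorem exists_integral_profile_layer_le (hN : ‖N‖ = 1)
    (ζ : ContDiffBump (0 : EuclideanSpace ℝ (Fin n))) (hζ : ζ.rOut < 1)
    (η : ContDiffBump (0 : ℝ)) (hη : η.rOut = 2) : ∃ C : ℝ, 0 ≤ C ∧ ∀ ε : ℝ, 0 < ε →
    ∫ q, traceProfile 1 (inner ℝ N q.1, q.2) ^ 2 *
      gradSq (fun q => layerCutoff ζ N ε q.1 * η q.2) q.1 q.2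
      ∂((volume.restrict {x | inner ℝ N x ∈ Ioo (0 : ℝ) 1}).prod (volume.restrict (Ioi 0))) ≤ C := by
  obtain ⟨C1, hC1⟩ := ContDiff.lipschitzWith_of_hasCompactSupport (n := ∞) (𝕂 := ℝ)
    ζ.hasCompactSupport ζ.contDiff (by simp)
  obtain ⟨C2, hC2⟩ := ContDiff.lipschitzWith_of_hasCompactSupport (n := ∞) (𝕂 := ℝ)
    η.hasCompactSupport η.contDiff (by simp)
  obtain ⟨M0, hM0⟩ := exists_norm_deriv_smoothTransition_le
  set M : ℝ := max C1 (max C2 M0) with hM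
  set A : ENNReal := ENNReal.ofReal (6 * M ^ 2) *
      volume (Metric.closedBall (0 : EuclideanSpace ℝ (Fin n)) ζ.rOut) +
      ENNReal.ofReal (8 * M ^ 2) *
        volume (Metric.closedBall (0 : EuclideanSpace ℝ (Fin n)) (ζ.rOut + 1)) with hA
  have hAtop : A ≠ ⊤ := ENNReal.add_ne_top.2
    ⟨ENNReal.mul_ne_top ENNReal.ofReal_ne_top measure_closedBall_lt_top.ne,
      ENNReal.mul_ne_top ENNReal.ofReal_ne_top measure_closedBall_lt_top.ne⟩
  refine ⟨A.toReal, ENNReal.toReal_nonneg, fun ε hε => ?_⟩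
  have hv := isTestFunction_layer hN ζ hζ η hε
  obtain ⟨hI, -⟩ := dirichletEnergy_profile_mul hN hv
  have hθ : Differentiable ℝ (layerCutoff ζ N ε) :=
    (contDiff_layerCutoff ζ.contDiff).differentiable (by simp)
  have hts : tsupport (layerCutoff ζ N ε) ⊆ Metric.closedBall 0 ζ.rOut := by
    rw [← ζ.tsupport_eq]; exact tsupport_mul_subset_left
  have key := lintegral_profile_layer_le hN (ε := ε) (η := η) (r := ζ.rOut) (M := M) hθ
    (fun x hx => by
      have h1 : x ∉ tsupport (layerCutoff ζ N ε) := fun h => by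
        have := hts h
        rw [mem_closedBall_zero_iff] at this
        linarith
      refine ⟨image_eq_zero_of_notMem_tsupport h1, ?_⟩
      by_contra h
      exact h1 (support_fderiv_subset ℝ h))
    (fun y hy => by
      have h1 : y ∉ tsupport η := fun h => by
        rw [η.tsupport_eq, hη, mem_closedBall_zero_iff, Real.norm_eq_abs] at h
        linarith [le_abs_self y]
      refine ⟨image_eq_zero_of_notMem_tsupport h1, ?_⟩
      by_contra h
      exact h1 (support_deriv_subset h))
    (fun y => by rw [abs_of_nonneg η.nonneg]; exact η.le_one)
    (fun y => (norm_deriv_le_of_lipschitz hC2).trans ((le_max_left _ _).trans (le_max_right _ _)))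
    (abs_layerCutoff_le_one ζ ε)
    (fun x => by
      refine (norm_fderiv_layerCutoff_le hN ζ.contDiff hC1
        (fun x => by rw [abs_of_nonneg ζ.nonneg]; exact ζ.le_one) hM0 hε x).trans ?_
      have h1 : (C1 : ℝ) ≤ M := le_max_left _ _
      have h2 : M0 ≤ M := (le_max_right _ _).trans (le_max_right _ _)
      have h3 : 0 ≤ (Icc ε (2 * ε)).indicator (fun _ => (1 : ℝ)) (inner ℝ N x) :=
        indicator_nonneg (fun _ _ => zero_le_one) _
      gcongr) hε
  have h0 : ∀ q : EuclideanSpace ℝ (Fin n) × ℝ, 0 ≤ traceProfile 1 (inner ℝ N q.1, q.2) ^ 2 *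
      gradSq (fun q => layerCutoff ζ N ε q.1 * η q.2) q.1 q.2 := fun q => by
    unfold gradSq; positivity
  rw [← ENNReal.ofReal_le_iff_le_toReal hAtop,
    ofReal_integral_eq_lintegral_ofReal hI (ae_of_all _ h0),
    lintegral_prod _ hI.1.aemeasurable.ennreal_ofReal]
  exact key

/-- The energy is at most `2/π` times the Hardy term plus an amount bounded uniformly in `ε`, while
the Hardy term tends to infinity as `ε → 0`. The gap `K - 2/π` eventually wins. -/
theorem exists_halfSpace_sharp (hN : ‖N‖ = 1) {K : ℝ} (hK : 2 / Real.pi < K) :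
    ∃ u : EuclideanSpace ℝ (Fin n) × ℝ → ℝ,
      IsTestFunction ({x | 0 < inner ℝ N x} ×ˢ (univ : Set ℝ)) u ∧
      dirichletEnergy univ u < K * ∫ x, u (x, 0) ^ 2 / inner ℝ N x := by
  let ζ : ContDiffBump (0 : EuclideanSpace ℝ (Fin n)) := ⟨1 / 4, 1 / 2, by norm_num, by norm_num⟩
  let η : ContDiffBump (0 : ℝ) := ⟨1, 2, by norm_num, by norm_num⟩
  have hζ : ζ.rOut < 1 := by norm_num [ζ]
  obtain ⟨C, hC0, hC⟩ := exists_integral_profile_layer_le hN ζ hζ η rfl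
  obtain ⟨c, hc0, hc⟩ := exists_le_lintegral_closedBall_comp_inner hN (r := 1 / 4) (by norm_num)
  set V : ℝ := (volume (Metric.closedBall (0 : EuclideanSpace ℝ (Fin n)) (1 / 2))).toReal with hV
  have hV0 : 0 ≤ V := ENNReal.toReal_nonneg
  have hKpos : 0 < K - 2 / Real.pi := by linarith
  -- `T` makes `(K - 2/π) c T` exceed the bounded error by `1`. The width `ε` is then set so that `∫
  -- dt/t` over `[2ε, 1/8]` equals `T`, where `1/8` is half the radius on which `ζ = 1` and the
  -- transition has reached `1` at `2ε`.
  set T : ℝ := (C + 2 / Real.pi * V + 1) / (c * (K - 2 / Real.pi)) with hT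
  have hT0 : 0 ≤ T := by positivity
  set ε : ℝ := 1 / 4 / 2 * Real.exp (-T) / 2 with hε
  have hε0 : 0 < ε := by positivity
  have hε2 : 2 * ε = 1 / 4 / 2 * Real.exp (-T) := by rw [hε]; ring
  set v : EuclideanSpace ℝ (Fin n) × ℝ → ℝ := fun q => layerCutoff ζ N ε q.1 * η q.2 with hv
  have hvt := isTestFunction_layer hN ζ hζ η hε0
  obtain ⟨-, hE⟩ := dirichletEnergy_profile_mul hN hvt
  have hQ := hC ε hε0
  have hη0 : η 0 = 1 := η.one_of_mem_closedBall (Metric.mem_closedBall_self η.rIn_pos.le)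
  have hv0 : ∀ x, v (x, 0) = layerCutoff ζ N ε x := fun x => by simp [hv, hη0]
  have hsub : ({x | inner ℝ N x ∈ Ioo (0 : ℝ) 1} : Set (EuclideanSpace ℝ (Fin n))) ×ˢ
      (univ : Set ℝ) ⊆ {x | 0 < inner ℝ N x} ×ˢ univ := prod_mono (fun x hx => hx.1) le_rfl
  have hut := isTestFunction_profile_mul (isProfileDistance_inner hN) hvt
  refine ⟨_, ⟨hut.1, hut.2.1, hut.2.2.trans hsub⟩, ?_⟩
  have hu0 : ∀ x, traceProfile 1 (inner ℝ N x, 0) * v (x, 0) = v (x, 0) := fun x => by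
    rw [traceProfile_zero, one_mul]
  change _ < K * ∫ x, (traceProfile 1 (inner ℝ N x, 0) * v (x, 0)) ^ 2 / inner ℝ N x
  simp only [hu0]
  have hv0c : Continuous fun x => v (x, 0) ^ 2 := (hvt.1.continuous.comp (by fun_prop)).pow 2
  have hv0k : HasCompactSupport fun x => v (x, 0) ^ 2 :=
    (hvt.2.1.slice_fst 0).comp_left (g := fun t => t ^ 2) (by simp)
  have hv0s : ∀ x ∈ tsupport fun x => v (x, 0) ^ 2, 0 < inner ℝ N x := fun x hx => by
    refine (hvt.2.2 (tsupport_slice_fst_subset v 0 (closure_mono ?_ hx))).1.1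
    intro w (hw : v (w, 0) ^ 2 ≠ 0) (h : v (w, 0) = 0)
    exact hw (by simp [h])
  have hI1 : Integrable fun x => v (x, 0) ^ 2 / inner ℝ N x :=
    integrable_div_of_pos hv0c hv0k (by fun_prop) hv0s
  have hI2 : Integrable fun x => v (x, 0) ^ 2 := hv0c.integrable_of_hasCompactSupport hv0k
  have hVle : ∫ x, v (x, 0) ^ 2 ≤ V := by
    have hm : MeasurableSet (Metric.closedBall (0 : EuclideanSpace ℝ (Fin n)) (1 / 2)) :=
      Metric.isClosed_closedBall.measurableSet
    calc ∫ x, v (x, 0) ^ 2 ≤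
        ∫ x, (Metric.closedBall (0 : EuclideanSpace ℝ (Fin n)) (1 / 2)).indicator (fun _ => (1 : ℝ)) x := by
          refine integral_mono hI2 ((integrable_indicator_iff hm).2
            (integrableOn_const measure_closedBall_lt_top.ne)) fun x => ?_
          by_cases hx : x ∈ Metric.closedBall (0 : EuclideanSpace ℝ (Fin n)) (1 / 2)
          · rw [indicator_of_mem hx, hv0, ← sq_abs]
            exact pow_le_one₀ (abs_nonneg _) (abs_layerCutoff_le_one ζ ε x)
          · rw [indicator_of_notMem hx, hv0, layerCutoff, ζ.zero_of_le_dist, zero_mul]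
            · norm_num
            · rw [Metric.mem_closedBall, not_le] at hx; exact hx.le
      _ = V := by
          rw [integral_indicator hm, setIntegral_const, smul_eq_mul, mul_one, hV]; rfl
  have hnn : ∀ x, 0 ≤ v (x, 0) ^ 2 / inner ℝ N x := fun x => by
    by_cases hx : v (x, 0) ^ 2 = 0
    · simp [hx]
    · have := hv0s x (subset_tsupport _ hx)
      positivity
  have hlow : c * T ≤ ∫ x, v (x, 0) ^ 2 / inner ℝ N x := by
    refine (ENNReal.ofReal_le_ofReal_iff (integral_nonneg hnn)).1 ?_
    rw [ofReal_integral_eq_lintegral_ofReal hI1 (ae_of_all _ hnn), ENNReal.ofReal_mul hc0.le]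
    have h1 := lintegral_Ioc_inv_ge (b := 1 / 4 / 2) (by norm_num) hT0
    rw [← hε2] at h1
    have hm : Measurable ((Ici (2 * ε)).indicator fun t : ℝ => ENNReal.ofReal (1 / t)) :=
      (by fun_prop : Measurable fun t : ℝ => ENNReal.ofReal (1 / t)).indicator measurableSet_Ici
    refine (mul_le_mul_right h1 _).trans ((hc _ hm).trans ?_)
    refine (setLIntegral_mono' Metric.isClosed_closedBall.measurableSet fun x hx => ?_).trans
      (setLIntegral_le_lintegral _ _)
    by_cases hs : inner ℝ N x ∈ Ici (2 * ε)
    · rw [indicator_of_mem hs, hv0, layerCutoff, ζ.one_of_mem_closedBall hx,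
        Real.smoothTransition.one_of_one_le]
      · norm_num
      · have hs' : 2 * ε ≤ inner ℝ N x := hs
        rw [le_sub_iff_add_le, le_div_iff₀ hε0]
        linarith
    · rw [indicator_of_notMem hs]; exact zero_le
  set h := ∫ x, v (x, 0) ^ 2 / inner ℝ N x with hh
  have h3 : C + 2 / Real.pi * V < (K - 2 / Real.pi) * h := by
    have h4 : (K - 2 / Real.pi) * (c * T) = C + 2 / Real.pi * V + 1 := by
      have hD := hKpos.ne'
      rw [hT]
      generalize K - 2 / Real.pi = D at hD ⊢
      field_simp
    have h5 : (K - 2 / Real.pi) * (c * T) ≤ (K - 2 / Real.pi) * h := by gcongr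
    linarith
  have h6 : 2 / Real.pi * ∫ x, v (x, 0) ^ 2 ≤ 2 / Real.pi * V := by gcongr
  have h7 : (K - 2 / Real.pi) * h = K * h - 2 / Real.pi * h := by ring
  linarith [hE, hQ]

end halfSpaceSharp

theorem theorem1p1 (n : ℕ) (hn : 2 ≤ n) (Ω : Set (EuclideanSpace ℝ (Fin n)))
    (hΩ : IsDomainSet Ω) (hΩne : Ω ≠ Set.univ)
    (hLip : IsUniformlyLipschitz Ω) (hR : HasFiniteInnerRadius Ω)
    (hmc : IsWeaklyMeanConvex Ω) :
    (∃ c : ℝ, 0 < c ∧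
      ∀ u : EuclideanSpace ℝ (Fin n) × ℝ → ℝ,
        IsTestFunction (Ω ×ˢ (Set.univ : Set ℝ)) u →
          2 / Real.pi * traceHardyTerm Ω u + c * traceSobolevTerm Ω u ≤ dirichletEnergy Ω u) ∧
    (∀ K : ℝ, 2 / Real.pi < K →
      ∃ u : EuclideanSpace ℝ (Fin n) × ℝ → ℝ,
        IsTestFunction (Ω ×ˢ (Set.univ : Set ℝ)) u ∧
          dirichletEnergy Ω u < K * traceHardyTerm Ω u) := by
  refine ⟨exists_traceSobolev_le hn hΩ hΩne hLip hR hmc, fun K hK => ?_⟩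
  have hfr : (frontier Ω).Nonempty := nonempty_frontier_iff.2 ⟨hΩ.2.nonempty, hΩne⟩
  obtain ⟨z, N, hN, hblow⟩ := hLip.exists_blowup hΩ.1 hfr
  obtain ⟨u, hu, hE⟩ := exists_halfSpace_sharp hN hK
  have hK0 : 0 < K := lt_trans (by positivity) hK
  exact exists_isTestFunction_rescale hΩ.1 hfr hblow hK0 hu hE
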